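/- Let $\Bbbk$ be an algebraically closed field of characteristic $0$, $G$ a finite abelian group, and $\Phi\colon G^3\to\Bbbk^*$ a normalized $3$-cocycle, i.e. $\Phi(ef,g,h)\Phi(e,f,gh)=\Phi(e,f,g)\Phi(e,fg,h)\Phi(f,g,h)$ and $\Phi(f,1,g)=1$. Put $\widetilde\Phi_g(x,y)=\frac{\Phi(g,x,y)\Phi(x,y,g)}{\Phi(x,g,y)}$. Let ${}^{\Bbbk G}_{\Bbbk G}\mathcal{YD}^\Phi$ be the braided tensor category whose objects are the $G$-graded spaces $V=\bigoplus_{g\in G}V_g$ with degree-preserving linear operators $f\,\triangleright$ $(f\in G)$ such that $1\triangleright v=v$ and $e\triangleright(f\triangleright v)=\widetilde\Phi_g(e,f)\,(ef)\triangleright v$ for $v\in V_g$, and whose morphisms are the linear maps preserving degrees and commuting with the action. On $V\otimes W$ the element $X\otimes Y$ ($X\in V_x$, $Y\in W_y$) has degree $xy$, and $f\triangleright(X\otimes Y)=\widetilde\Phi_f(x,y)(f\triangleright X)\otimes(f\triangleright Y)$; the unit object is $\Bbbk$ in degree $1$ with trivial action; the associativity constraint is $(X\otimes Y)\otimes Z\mapsto\Phi(x,y,z)^{-1}X\otimes(Y\otimes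 Z)$ and the braiding is $X\otimes Y\mapsto(x\triangleright Y)\otimes X$ for $X,Y,Z$ of degrees $x,y,z$. Let $H=\bigoplus_{n\ge0}H(n)$ be an $\mathbb N$-graded braided Hopf algebra in ${}^{\Bbbk G}_{\Bbbk G}\mathcal{YD}^\Phi$, with antipode $S_H$, such that $H(0)=\Bbbk$ and $H$ is generated by $H(1)$ as an algebra. Elements of $H(n)$ are said to have length $n$, and the degree in $G$ of a homogeneous element $X$ is written $x$. Define on $H\otimes\Bbbk G$, for $g,h\in G$ and homogeneous $X,Y\in H$, the product $$(X\otimes g)(Y\otimes h)=\frac{\Phi(xg,y,h)\,\Phi(x,y,g)}{\Phi(x,g,y)\,\Phi(xy,g,h)}\;X(g\triangleright Y)\otimes gh ,$$ with unit $1\otimes1$, and the coproduct $$\Delta(X\otimes g)=\Phi(x_1,x_2,g)^{-1}(X_1\otimes x_2g)\otimes(X_2\otimes g),$$ with counit $\varepsilon(X\otimes g)=\varepsilon_H(X)$, where $\Delta_H(X)=X_1\otimes X_2$ is written with $G$-homogeneous terms. Then $H\otimes\Bbbk G$ is a Majid algebra (coquasi-Hopf algebra), denoted $H\#\Bbbk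 G$, whose associator is the extension of $\Phi$ given by $(X\otimes g,Y\otimes h,Z\otimes e)\mapsto\varepsilon_H(X)\varepsilon_H(Y)\varepsilon_H(Z)\Phi(g,h,e)$ and whose quasi-antipode $(S,\alpha,\beta)$ is given by $$S(X\otimes g)=\frac{\Phi(g^{-1},g,g^{-1})}{\Phi(x^{-1}g^{-1},xg,g^{-1})\,\Phi(x,g,g^{-1})}\,(1\otimes x^{-1}g^{-1})(S_H(X)\otimes1),$$ $$\alpha(1\otimes g)=1,\quad\alpha(X\otimes g)=0,\qquad\beta(1\otimes g)=\Phi(g,g^{-1},g)^{-1},\quad\beta(X\otimes g)=0,$$ where in the formulas $\alpha(X\otimes g)=0$ and $\beta(X\otimes g)=0$ the element $X$ has length $\ge1$. This Majid algebra is $\mathbb N$-graded by length: with $(H\#\Bbbk G)(n)=H(n)\otimes\Bbbk G$, all structure maps (the functionals $\varepsilon,\alpha,\beta$ and the associator being zero in positive degree) respect the grading. Moreover, this grading is coradical, i.e. the $n$-th term of the coradical filtration is $\bigoplus_{i\le n}H(i)\otimes\Bbbk G$ for all $n$, if and only if every primitive element of $H$ (every $X$ with $\Delta_H(X)=X\otimes1+1\otimes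 X$) lies in $H(1)$. -/

import Mathlib

open scoped TensorProduct

namespace QuasiBosonization

universe u v w

/-! ### Normalized 3-cocycles -/

/-- A normalized 3-cocycle on a group `G` with values in `kˣ`. -/
structure NormalizedThreeCocycle (k : Type u) (G : Type v) [Field k] [CommGroup G] where
  /-- the underlying function of three variables -/
  toFun : G → G → G → kˣ
  cocycle : ∀ e f g h : G,
    toFun (e * f) g h * toFun e f (g * h) = toFun e f g * toFun e (f * g) h * toFun f g h
  normalized : ∀ f g : G, toFun f 1 g = 1

instance {k : Type u} {G : Type v} [Field k] [CommGroup G] :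
    CoeFun (NormalizedThreeCocycle k G) (fun _ => G → G → G → kˣ) :=
  ⟨NormalizedThreeCocycle.toFun⟩

namespace NormalizedThreeCocycle

variable {k : Type u} {G : Type v} [Field k] [CommGroup G] (Φ : NormalizedThreeCocycle k G)

/-- `Φ̃_g(x, y) = Φ(g,x,y) Φ(x,y,g) / Φ(x,g,y)`. -/
def tilde (g x y : G) : kˣ := Φ g x y * Φ x y g / Φ x g y

theorem one_left (f g : G) : Φ 1 f g = 1 := by
  have h := Φ.cocycle 1 1 f g
  simp only [one_mul, Φ.normalized, mul_one] at h
  exact (left_eq_mul.mp h)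

theorem one_right (e f : G) : Φ e f 1 = 1 := by
  have h := Φ.cocycle e f 1 1
  simp only [one_mul, mul_one, Φ.normalized] at h
  exact (left_eq_mul.mp h)

theorem tilde_one_one (g : G) : Φ.tilde g 1 1 = 1 := by
  simp [tilde, Φ.one_left, Φ.one_right]

theorem tilde_one (x y : G) : Φ.tilde 1 x y = 1 := by
  simp [tilde, Φ.one_left, Φ.one_right, Φ.normalized]

/-- The compatibility that makes the tensor product of two Yetter-Drinfeld modules
a Yetter-Drinfeld module. -/
theorem tilde_tensor (e f c d : G) :
    Φ.tilde e c d * Φ.tilde f c d * (Φ.tilde c e f * Φ.tilde d e f) =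
      Φ.tilde (c * d) e f * Φ.tilde (e * f) c d := by
  have h1 := congrArg Additive.ofMul (Φ.cocycle e f c d)
  have h2 := congrArg Additive.ofMul (Φ.cocycle e c f d)
  have h3 := congrArg Additive.ofMul (Φ.cocycle e c d f)
  have h4 := congrArg Additive.ofMul (Φ.cocycle c e f d)
  have h5 := congrArg Additive.ofMul (Φ.cocycle c e d f)
  have h6 := congrArg Additive.ofMul (Φ.cocycle c d e f)
  apply Additive.ofMul.injective
  simp only [mul_comm c e, mul_comm c f, mul_comm d e, mul_comm d f] at h1 h2 h3 h4 h5 h6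
  simp only [tilde, ofMul_mul, ofMul_div] at h1 h2 h3 h4 h5 h6 ⊢
  linear_combination (norm := module) -h1 + h2 - h3 - h4 + h5 - h6

end NormalizedThreeCocycle

/-! ### Yetter-Drinfeld modules over `(kG, Φ)` -/

section YetterDrinfeld

variable {k : Type u} {G : Type v} [Field k] [CommGroup G] [Fintype G] [DecidableEq G]

/-- The structure on a vector space `V` of an object of the Yetter-Drinfeld category of `(kG, Φ)`:
a `G`-grading `V = ⊕ V_g`, given by its projections `proj g : V → V_g`
(a complete family of orthogonal idempotents; `G` is finite), and an action `f ▷ v` of `G`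
making each `V_g` a projective representation with respect to the 2-cocycle `Φ̃_g`. -/
structure YDModule (Φ : NormalizedThreeCocycle k G) (V : Type w) [AddCommGroup V] [Module k V] where
  /-- the projection onto the homogeneous component of degree `g` -/
  proj : G → V →ₗ[k] V
  proj_proj : ∀ (g h : G) (v : V), proj g (proj h v) = if g = h then proj h v else 0
  sum_proj : ∀ v : V, ∑ g, proj g v = v
  /-- the action `f ▷ v` -/
  act : G → V →ₗ[k] V
  act_proj : ∀ (f g : G) (v : V), act f (proj g v) = proj g (act f v)
  act_one : ∀ v : V, act 1 v = v
  act_act : ∀ (e f g : G) (v : V),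
    act e (act f (proj g v)) = Φ.tilde g e f • act (e * f) (proj g v)

namespace YDModule

variable {Φ : NormalizedThreeCocycle k G}
variable {U V W : Type*} [AddCommGroup U] [Module k U] [AddCommGroup V] [Module k V]
  [AddCommGroup W] [Module k W]

/-- The homogeneous component `V_g`. -/
def component (D : YDModule Φ V) (g : G) : Submodule k V := LinearMap.range (D.proj g)

/-- A morphism in the Yetter-Drinfeld category: a linear map preserving the `G`-degree
and commuting with the action. -/
structure IsHom (D : YDModule Φ V) (E : YDModule Φ W) (f : V →ₗ[k] W) : Prop where
  map_proj : ∀ (g : G) (v : V), f (D.proj g v) = E.proj g (f v)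
  map_act : ∀ (g : G) (v : V), f (D.act g v) = E.act g (f v)

/-- The unit object: `k` in degree `1` with trivial action. -/
def unit (Φ : NormalizedThreeCocycle k G) : YDModule Φ k where
  proj g := if g = 1 then LinearMap.id else 0
  proj_proj g h v := by
    by_cases hg : g = 1 <;> by_cases hh : h = 1 <;> by_cases hgh : g = h <;> simp_all
  sum_proj v := by
    simp [apply_ite (fun f : k →ₗ[k] k => f v)]
  act _ := LinearMap.id
  act_proj _ _ _ := rfl
  act_one _ := rfl
  act_act e f g v := by
    by_cases hg : g = 1
    · subst hg
      simp [Φ.tilde_one]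
    · simp [hg]

/-- Two linear maps on `V ⊗ W` agree if they agree on tensors of homogeneous elements. -/
theorem tensor_ext (D : YDModule Φ V) (E : YDModule Φ W) {f g : V ⊗[k] W →ₗ[k] U}
    (h : ∀ (a b : G) (v : V) (w : W),
      f (D.proj a v ⊗ₜ[k] E.proj b w) = g (D.proj a v ⊗ₜ[k] E.proj b w)) (t : V ⊗[k] W) :
    f t = g t := by
  induction t with
  | zero => simp
  | add s t hs ht => simp only [map_add, hs, ht]
  | tmul v w =>
    rw [← D.sum_proj v, ← E.sum_proj w]
    simp only [TensorProduct.sum_tmul, TensorProduct.tmul_sum, map_sum, h]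

/-- The projections onto the homogeneous components of `V ⊗ W`. -/
def tensorProj (D : YDModule Φ V) (E : YDModule Φ W) (g : G) : V ⊗[k] W →ₗ[k] V ⊗[k] W :=
  ∑ h, TensorProduct.map (D.proj h) (E.proj (h⁻¹ * g))

/-- The action of `G` on `V ⊗ W`. -/
def tensorAct (D : YDModule Φ V) (E : YDModule Φ W) (f : G) : V ⊗[k] W →ₗ[k] V ⊗[k] W :=
  ∑ x, ∑ y, Φ.tilde f x y • TensorProduct.map (D.act f ∘ₗ D.proj x) (E.act f ∘ₗ E.proj y)

theorem tensorProj_tmul (D : YDModule Φ V) (E : YDModule Φ W) (g a b : G) (v : V) (w : W) :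
    tensorProj D E g (D.proj a v ⊗ₜ[k] E.proj b w) =
      if g = a * b then D.proj a v ⊗ₜ[k] E.proj b w else 0 := by
  have hab : (a⁻¹ * g = b) = (g = a * b) := propext inv_mul_eq_iff_eq_mul
  simp only [tensorProj, LinearMap.sum_apply, TensorProduct.map_tmul, D.proj_proj, E.proj_proj]
  rw [Finset.sum_eq_single a (fun c _ hc => by simp [hc]) (by simp)]
  simp only [if_true, hab]
  split_ifs <;> simp

theorem tensorAct_tmul (D : YDModule Φ V) (E : YDModule Φ W) (f a b : G) (v : V) (w : W) :
    tensorAct D E f (D.proj a v ⊗ₜ[k] E.proj b w) =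
      Φ.tilde f a b • (D.proj a (D.act f v) ⊗ₜ[k] E.proj b (E.act f w)) := by
  simp only [tensorAct, LinearMap.sum_apply, LinearMap.smul_apply, TensorProduct.map_tmul,
    LinearMap.comp_apply, D.proj_proj, E.proj_proj]
  rw [Finset.sum_eq_single a (fun c _ hc => by simp [hc]) (by simp),
    Finset.sum_eq_single b (fun c _ hc => by simp [hc]) (by simp)]
  simp only [if_true, act_proj]

/-- The tensor product of two objects: `V_h ⊗ W_l` has degree `h l`, and
`f ▷ (X ⊗ Y) = Φ̃_f(x, y) (f ▷ X) ⊗ (f ▷ Y)` for `X ∈ V_x`, `Y ∈ W_y`. -/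
def tensor (D : YDModule Φ V) (E : YDModule Φ W) : YDModule Φ (V ⊗[k] W) where
  proj := tensorProj D E
  proj_proj g g' t := by
    have := tensor_ext D E (f := tensorProj D E g ∘ₗ tensorProj D E g')
      (g := if g = g' then tensorProj D E g' else 0) (fun a b v w => by
        by_cases h1 : g' = a * b <;> by_cases h2 : g = g' <;>
          simp_all [tensorProj_tmul]) t
    rw [LinearMap.comp_apply] at this
    rw [this]
    split_ifs <;> rfl
  sum_proj t := by
    have := tensor_ext D E (f := ∑ g, tensorProj D E g) (g := LinearMap.id)
      (fun a b v w => by simp [LinearMap.sum_apply, tensorProj_tmul]) t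
    rwa [LinearMap.sum_apply] at this
  act := tensorAct D E
  act_proj f g t := by
    refine tensor_ext D E (f := tensorAct D E f ∘ₗ tensorProj D E g)
      (g := tensorProj D E g ∘ₗ tensorAct D E f) (fun a b v w => ?_) t
    simp only [LinearMap.comp_apply, tensorProj_tmul, tensorAct_tmul, LinearMap.map_smul_of_tower]
    split_ifs
    · rw [tensorAct_tmul]
    · simp
  act_one t := by
    refine tensor_ext D E (f := tensorAct D E 1) (g := LinearMap.id) (fun a b v w => ?_) t
    simp [tensorAct_tmul, Φ.tilde_one, act_one]
  act_act e f g t := by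
    refine tensor_ext D E (f := tensorAct D E e ∘ₗ tensorAct D E f ∘ₗ tensorProj D E g)
      (g := Φ.tilde g e f • (tensorAct D E (e * f) ∘ₗ tensorProj D E g)) (fun a b v w => ?_) t
    simp only [LinearMap.comp_apply, LinearMap.smul_apply, tensorProj_tmul]
    split_ifs with h
    · subst h
      have hv : D.proj a (D.act e (D.act f v)) = Φ.tilde a e f • D.proj a (D.act (e * f) v) := by
        simp only [← act_proj, act_act]
      have hw : E.proj b (E.act e (E.act f w)) = Φ.tilde b e f • E.proj b (E.act (e * f) w) := by
        simp only [← act_proj, act_act]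
      simp only [tensorAct_tmul, LinearMap.map_smul_of_tower, hv, hw, Units.smul_def,
        TensorProduct.smul_tmul, TensorProduct.tmul_smul, smul_smul, ← Units.val_mul]
      congr 2
      rw [← Φ.tilde_tensor]
      ac_rfl
    · simp

/-- The associativity constraint
`(X ⊗ Y) ⊗ Z ↦ Φ(e,f,g)⁻¹ X ⊗ (Y ⊗ Z)` for `X ∈ U_e`, `Y ∈ V_f`, `Z ∈ W_g`. -/
def assoc (C : YDModule Φ U) (D : YDModule Φ V) (E : YDModule Φ W) :
    (U ⊗[k] V) ⊗[k] W →ₗ[k] U ⊗[k] (V ⊗[k] W) :=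
  ∑ e, ∑ f, ∑ g, (Φ e f g)⁻¹ •
    ((TensorProduct.assoc k U V W).toLinearMap ∘ₗ
      TensorProduct.map (TensorProduct.map (C.proj e) (D.proj f)) (E.proj g))

/-- The inverse of the associativity constraint:
`X ⊗ (Y ⊗ Z) ↦ Φ(e,f,g) (X ⊗ Y) ⊗ Z` for `X ∈ U_e`, `Y ∈ V_f`, `Z ∈ W_g`. -/
def assocInv (C : YDModule Φ U) (D : YDModule Φ V) (E : YDModule Φ W) :
    U ⊗[k] (V ⊗[k] W) →ₗ[k] (U ⊗[k] V) ⊗[k] W :=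
  ∑ e, ∑ f, ∑ g, Φ e f g •
    ((TensorProduct.assoc k U V W).symm.toLinearMap ∘ₗ
      TensorProduct.map (C.proj e) (TensorProduct.map (D.proj f) (E.proj g)))

/-- The braiding `X ⊗ Y ↦ (e ▷ Y) ⊗ X` for `X ∈ V_e`. -/
def braiding (D : YDModule Φ V) (E : YDModule Φ W) : V ⊗[k] W →ₗ[k] W ⊗[k] V :=
  ∑ e, TensorProduct.map (E.act e) (D.proj e) ∘ₗ (TensorProduct.comm k V W).toLinearMap

end YDModule

/-! ### Braided Hopf algebras in the Yetter-Drinfeld category -/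

/-- The multiplication of the braided tensor product algebra `H ⊗ H`:
`(m ⊗ m) ∘ a ∘ (a⁻¹ ⊗ id) ∘ (id ⊗ c ⊗ id) ∘ (a ⊗ id) ∘ a⁻¹`. -/
def braidedTensorMul {Φ : NormalizedThreeCocycle k G} {H : Type w} [AddCommGroup H] [Module k H]
    (D : YDModule Φ H) (m : H ⊗[k] H →ₗ[k] H) :
    (H ⊗[k] H) ⊗[k] (H ⊗[k] H) →ₗ[k] H ⊗[k] H :=
  TensorProduct.map m m ∘ₗ
    YDModule.assoc (D.tensor D) D D ∘ₗ
    (YDModule.assocInv D D D).rTensor H ∘ₗ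
    ((YDModule.braiding D D).lTensor H).rTensor H ∘ₗ
    (YDModule.assoc D D D).rTensor H ∘ₗ
    YDModule.assocInv (D.tensor D) D D

/-- A Hopf algebra in the braided tensor category of Yetter-Drinfeld modules over `(kG, Φ)`,
on the object given by `D`. -/
structure BraidedHopfAlgebra {Φ : NormalizedThreeCocycle k G} {H : Type w}
    [AddCommGroup H] [Module k H] (D : YDModule Φ H) where
  /-- the multiplication -/
  mul : H ⊗[k] H →ₗ[k] H
  /-- the unit -/
  unit : k →ₗ[k] H
  /-- the comultiplication -/
  comul : H →ₗ[k] H ⊗[k] H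
  /-- the counit -/
  counit : H →ₗ[k] k
  /-- the antipode -/
  antipode : H →ₗ[k] H
  mul_isHom : YDModule.IsHom (D.tensor D) D mul
  unit_isHom : YDModule.IsHom (YDModule.unit Φ) D unit
  comul_isHom : YDModule.IsHom D (D.tensor D) comul
  counit_isHom : YDModule.IsHom D (YDModule.unit Φ) counit
  antipode_isHom : YDModule.IsHom D D antipode
  mul_assoc : mul ∘ₗ mul.rTensor H = mul ∘ₗ mul.lTensor H ∘ₗ YDModule.assoc D D D
  mul_unit : mul ∘ₗ unit.lTensor H = (TensorProduct.rid k H).toLinearMap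
  unit_mul : mul ∘ₗ unit.rTensor H = (TensorProduct.lid k H).toLinearMap
  coassoc : YDModule.assoc D D D ∘ₗ comul.rTensor H ∘ₗ comul = comul.lTensor H ∘ₗ comul
  comul_counit : counit.lTensor H ∘ₗ comul = (TensorProduct.rid k H).symm.toLinearMap
  counit_comul : counit.rTensor H ∘ₗ comul = (TensorProduct.lid k H).symm.toLinearMap
  comul_mul : comul ∘ₗ mul = braidedTensorMul D mul ∘ₗ TensorProduct.map comul comul
  comul_unit : comul (unit 1) = unit 1 ⊗ₜ[k] unit 1
  counit_mul : ∀ X Y : H, counit (mul (X ⊗ₜ[k] Y)) = counit X * counit Y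
  counit_unit : counit (unit 1) = 1
  antipode_mul : mul ∘ₗ antipode.rTensor H ∘ₗ comul = unit ∘ₗ counit
  mul_antipode : mul ∘ₗ antipode.lTensor H ∘ₗ comul = unit ∘ₗ counit

end YetterDrinfeld

/-- The degree `n` part `⊕_{i+j=n} V(i) ⊗ V(j)` of the tensor square of an `ℕ`-graded space. -/
def tensorDegree {k : Type u} [Field k] {V : Type w} [AddCommGroup V] [Module k V]
    (gr : ℕ → Submodule k V) (n : ℕ) : Submodule k (V ⊗[k] V) :=
  ⨆ (i : ℕ) (j : ℕ) (_ : i + j = n),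
    LinearMap.range (TensorProduct.map (gr i).subtype (gr j).subtype)

namespace BraidedHopfAlgebra

variable {k : Type u} {G : Type v} [Field k] [CommGroup G] [Fintype G] [DecidableEq G]
  {Φ : NormalizedThreeCocycle k G} {H : Type w} [AddCommGroup H] [Module k H] {D : YDModule Φ H}

/-- `H = ⊕ H(n)` is an `ℕ`-graded braided Hopf algebra: the `H(n)` are subobjects
and all structure maps respect the grading. -/
structure IsGraded (B : BraidedHopfAlgebra D) (gr : ℕ → Submodule k H) : Prop where
  isInternal : DirectSum.IsInternal gr
  proj_mem : ∀ (n : ℕ) (g : G), ∀ X ∈ gr n, D.proj g X ∈ gr n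
  act_mem : ∀ (n : ℕ) (g : G), ∀ X ∈ gr n, D.act g X ∈ gr n
  mul_mem : ∀ m n : ℕ, ∀ X ∈ gr m, ∀ Y ∈ gr n, B.mul (X ⊗ₜ[k] Y) ∈ gr (m + n)
  unit_mem : B.unit 1 ∈ gr 0
  comul_mem : ∀ n : ℕ, ∀ X ∈ gr n, B.comul X ∈ tensorDegree gr n
  counit_eq_zero : ∀ n : ℕ, n ≠ 0 → ∀ X ∈ gr n, B.counit X = 0
  antipode_mem : ∀ n : ℕ, ∀ X ∈ gr n, B.antipode X ∈ gr n

/-- `H(0) = k`. -/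
def IsConnected (B : BraidedHopfAlgebra D) (gr : ℕ → Submodule k H) : Prop :=
  gr 0 = Submodule.span k {B.unit 1}

/-- `H` is generated by `H(1)` as a (unital) algebra. -/
def IsGeneratedInDegreeOne (B : BraidedHopfAlgebra D) (gr : ℕ → Submodule k H) : Prop :=
  ∀ A : Submodule k H, B.unit 1 ∈ A → gr 1 ≤ A →
    (∀ X ∈ A, ∀ Y ∈ A, B.mul (X ⊗ₜ[k] Y) ∈ A) → A = ⊤

/-- The primitive elements of `H`: `Δ(X) = X ⊗ 1 + 1 ⊗ X`. -/
def IsPrimitive (B : BraidedHopfAlgebra D) (X : H) : Prop :=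
  B.comul X = X ⊗ₜ[k] B.unit 1 + B.unit 1 ⊗ₜ[k] X

end BraidedHopfAlgebra

/-! ### Majid algebras (coquasi-Hopf algebras) -/

section Majid

variable {k : Type u} [Field k]

/-- The convolution `φ * f : c ↦ φ(c₁) f(c₂)` of a functional with a linear map. -/
def convLeft {C N : Type*} [AddCommGroup C] [Module k C] [Coalgebra k C]
    [AddCommGroup N] [Module k N] (φ : C →ₗ[k] k) (f : C →ₗ[k] N) : C →ₗ[k] N :=
  (TensorProduct.lid k N).toLinearMap ∘ₗ TensorProduct.map φ f ∘ₗ CoalgebraStruct.comul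

/-- The convolution `f * φ : c ↦ f(c₁) φ(c₂)` of a linear map with a functional. -/
def convRight {C N : Type*} [AddCommGroup C] [Module k C] [Coalgebra k C]
    [AddCommGroup N] [Module k N] (f : C →ₗ[k] N) (φ : C →ₗ[k] k) : C →ₗ[k] N :=
  (TensorProduct.rid k N).toLinearMap ∘ₗ TensorProduct.map f φ ∘ₗ CoalgebraStruct.comul

/-- A Majid algebra (coquasi-Hopf algebra): a coalgebra with a quasi-associative multiplication,
whose associator `Φ` is a convolution-invertible functional on `M ⊗ M ⊗ M`, and a quasi-antipode
`(S, α, β)`. -/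
structure MajidAlgebra (k : Type u) [Field k] (M : Type w) [AddCommGroup M] [Module k M]
    extends Coalgebra k M where
  /-- the multiplication -/
  mul : M ⊗[k] M →ₗ[k] M
  /-- the unit -/
  one : M
  /-- the associator -/
  associator : M ⊗[k] (M ⊗[k] M) →ₗ[k] k
  /-- the convolution inverse of the associator -/
  associatorInv : M ⊗[k] (M ⊗[k] M) →ₗ[k] k
  /-- the map `S` of the quasi-antipode -/
  antipode : M →ₗ[k] M
  /-- the functional `α` of the quasi-antipode -/
  alpha : M →ₗ[k] k
  /-- the functional `β` of the quasi-antipode -/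
  beta : M →ₗ[k] k
  /- The multiplication is a coalgebra map. -/
  comul_mul : comul ∘ₗ mul = TensorProduct.map mul mul ∘ₗ CoalgebraStruct.comul
  counit_mul : ∀ a b : M, counit (mul (a ⊗ₜ[k] b)) = counit a * counit b
  /- The unit is a coalgebra map. -/
  comul_one : comul one = one ⊗ₜ[k] one
  counit_one : counit one = 1
  one_mul : ∀ a : M, mul (one ⊗ₜ[k] a) = a
  mul_one : ∀ a : M, mul (a ⊗ₜ[k] one) = a
  /- `Φ * Φ⁻¹ = ε = Φ⁻¹ * Φ`. -/
  associator_mul_inv : convLeft associator associatorInv = CoalgebraStruct.counit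
  associatorInv_mul : convLeft associatorInv associator = CoalgebraStruct.counit
  /- `a₁(b₁c₁) Φ(a₂,b₂,c₂) = Φ(a₁,b₁,c₁) (a₂b₂)c₂`. -/
  quasi_assoc :
    convRight (mul ∘ₗ mul.lTensor M) associator =
      convLeft associator
        (mul ∘ₗ mul.rTensor M ∘ₗ (TensorProduct.assoc k M M M).symm.toLinearMap)
  /- `Φ(a₁,b₁,c₁d₁) Φ(a₂b₂,c₂,d₂) = Φ(b₁,c₁,d₁) Φ(a₁,b₂c₂,d₂) Φ(a₂,b₃,c₃)`. -/
  associator_cocycle :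
    convLeft (associator ∘ₗ (mul.lTensor M).lTensor M)
        (associator ∘ₗ mul.rTensor (M ⊗[k] M) ∘ₗ
          (TensorProduct.assoc k M M (M ⊗[k] M)).symm.toLinearMap) =
      convLeft
        ((TensorProduct.lid k k).toLinearMap ∘ₗ TensorProduct.map counit associator)
        (convLeft
          (associator ∘ₗ
            (mul.rTensor M ∘ₗ (TensorProduct.assoc k M M M).symm.toLinearMap).lTensor M)
          ((TensorProduct.rid k k).toLinearMap ∘ₗ TensorProduct.map associator counit ∘ₗ
            (TensorProduct.assoc k M (M ⊗[k] M) M).symm.toLinearMap ∘ₗ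
            (TensorProduct.assoc k M M M).symm.toLinearMap.lTensor M))
  /- `Φ(a,1,b) = ε(a) ε(b)`. -/
  associator_one : ∀ a b : M, associator (a ⊗ₜ[k] (one ⊗ₜ[k] b)) = counit a * counit b
  /- `S` is a coalgebra antimorphism. -/
  comul_antipode :
    comul ∘ₗ antipode =
      TensorProduct.map antipode antipode ∘ₗ (TensorProduct.comm k M M).toLinearMap ∘ₗ comul
  counit_antipode : counit ∘ₗ antipode = counit
  /- `S(a₁) α(a₂) a₃ = α(a) 1`. -/
  antipode_alpha :
    mul ∘ₗ TensorProduct.map antipode (convLeft alpha LinearMap.id) ∘ₗ comul =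
      alpha.smulRight one
  /- `a₁ β(a₂) S(a₃) = β(a) 1`. -/
  beta_antipode :
    mul ∘ₗ TensorProduct.map LinearMap.id (convLeft beta antipode) ∘ₗ comul =
      beta.smulRight one
  /- `Φ(a₁, S(a₃), a₅) β(a₂) α(a₄) = ε(a)`. -/
  associator_antipode :
    associator ∘ₗ
      TensorProduct.map LinearMap.id
        (convLeft beta
          (TensorProduct.map antipode (convLeft alpha LinearMap.id) ∘ₗ comul)) ∘ₗ comul = counit
  /- `Φ⁻¹(S(a₁), a₃, S(a₅)) α(a₂) β(a₄) = ε(a)`. -/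
  associatorInv_antipode :
    associatorInv ∘ₗ
      TensorProduct.map antipode
        (convLeft alpha
          (TensorProduct.map LinearMap.id (convLeft beta antipode) ∘ₗ comul)) ∘ₗ comul = counit

/-- `M = ⊕ M(n)` is an `ℕ`-grading respected by all structure maps of the Majid algebra `M`
(functionals being concentrated in degree `0`). -/
structure MajidAlgebra.IsGraded {M : Type w} [AddCommGroup M] [Module k M]
    (A : MajidAlgebra k M) (gr : ℕ → Submodule k M) : Prop where
  isInternal : DirectSum.IsInternal gr
  comul_mem : ∀ n : ℕ, ∀ a ∈ gr n, A.comul a ∈ tensorDegree gr n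
  counit_eq_zero : ∀ n : ℕ, n ≠ 0 → ∀ a ∈ gr n, A.counit a = 0
  mul_mem : ∀ m n : ℕ, ∀ a ∈ gr m, ∀ b ∈ gr n, A.mul (a ⊗ₜ[k] b) ∈ gr (m + n)
  one_mem : A.one ∈ gr 0
  associator_eq_zero : ∀ l m n : ℕ, l + m + n ≠ 0 → ∀ a ∈ gr l, ∀ b ∈ gr m, ∀ c ∈ gr n,
    A.associator (a ⊗ₜ[k] (b ⊗ₜ[k] c)) = 0
  antipode_mem : ∀ n : ℕ, ∀ a ∈ gr n, A.antipode a ∈ gr n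
  alpha_eq_zero : ∀ n : ℕ, n ≠ 0 → ∀ a ∈ gr n, A.alpha a = 0
  beta_eq_zero : ∀ n : ℕ, n ≠ 0 → ∀ a ∈ gr n, A.beta a = 0

/-! ### The coradical filtration -/

/-- A subcoalgebra: `Δ(E) ⊆ E ⊗ E`. -/
def IsSubcoalgebra {C : Type w} [AddCommGroup C] [Module k C] (cC : Coalgebra k C)
    (E : Submodule k C) : Prop :=
  ∀ c ∈ E, cC.comul c ∈ LinearMap.range (TensorProduct.map E.subtype E.subtype)

/-- A simple subcoalgebra. -/
def IsSimpleSubcoalgebra {C : Type w} [AddCommGroup C] [Module k C] (cC : Coalgebra k C)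
    (E : Submodule k C) : Prop :=
  IsSubcoalgebra cC E ∧ E ≠ ⊥ ∧ ∀ F : Submodule k C, IsSubcoalgebra cC F → F ≤ E → F = ⊥ ∨ F = E

/-- The coradical: the sum of all simple subcoalgebras. -/
def coradical {C : Type w} [AddCommGroup C] [Module k C] (cC : Coalgebra k C) : Submodule k C :=
  sSup {E | IsSimpleSubcoalgebra cC E}

/-- The coradical filtration: `C₀` is the coradical, `C_{n+1} = Δ⁻¹(C ⊗ C_n + C₀ ⊗ C)`. -/
def coradicalFiltration {C : Type w} [AddCommGroup C] [Module k C] (cC : Coalgebra k C) :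
    ℕ → Submodule k C
  | 0 => coradical cC
  | n + 1 =>
    (LinearMap.range ((coradicalFiltration cC n).subtype.lTensor C) ⊔
      LinearMap.range ((coradical cC).subtype.rTensor C)).comap cC.comul

/-- The grading `C = ⊕ C(n)` is coradical: `C_n = C(0) ⊕ ⋯ ⊕ C(n)` for all `n`. -/
def IsCoradicalGrading {C : Type w} [AddCommGroup C] [Module k C] (cC : Coalgebra k C)
    (gr : ℕ → Submodule k C) : Prop :=
  ∀ n : ℕ, coradicalFiltration cC n = ⨆ i ∈ Finset.range (n + 1), gr i

end Majid

/-! ### The space `H ⊗ kG` -/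

/-- The element `X ⊗ g` of `H ⊗ kG`, as a linear map in `X`. -/
noncomputable def elt {k : Type u} {G : Type v} {H : Type w} [Field k] [CommGroup G]
    [AddCommGroup H] [Module k H] (g : G) : H →ₗ[k] H ⊗[k] MonoidAlgebra k G :=
  (TensorProduct.mk k H (MonoidAlgebra k G)).flip (MonoidAlgebra.single g 1)

/-- The length grading `H(n) ⊗ kG` of `H ⊗ kG`. -/
noncomputable def lengthGrading {k : Type u} (G : Type v) {H : Type w} [Field k] [CommGroup G]
    [AddCommGroup H] [Module k H] (gr : ℕ → Submodule k H) (n : ℕ) :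
    Submodule k (H ⊗[k] MonoidAlgebra k G) :=
  LinearMap.range ((gr n).subtype.rTensor (MonoidAlgebra k G))

end QuasiBosonization

/-! For `X` of degree `x`, the element `X ⊗ g` has a right degree `g` and a left degree `x * g`, the
group elements seen at the two ends of its coproduct. All structure constants of `H # kG` are
monomials in values of `Φ`. An axiom evaluated on homogeneous elements therefore splits into the
corresponding axiom of the braided Hopf algebra `H` and an identity in `kˣ`, which written
additively is an integral combination of instances of the cocycle condition. The carrying identities
are `mulCoeff_comul` (the product is a coalgebra map), `mulCoeff_assoc` (quasi-associativity), and
`antipodeCoeff_left` and `antipodeCoeff_right` (the antipode identities).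

The associator, `α` and `β` depend only on `ε` and the group part. They are combinations of
functionals `δ_g` (`bosonDelta`) and their tensor products, which are complete orthogonal
idempotents for convolution. Convolution of such functionals is pointwise multiplication of
functions on powers of `G`, so the axioms involving only functionals become identities for `Φ`
itself.

The axiom that `S` reverses the coproduct needs another argument (`IsGraded.bosonComul_antipode`).
Since the product is not associative, uniqueness of convolution inverses is not available. The
difference `T` of the two sides satisfies `T(a₁) Δ(a₂) = 0`; as `Δ(X ⊗ g)` is `(X ⊗ g) ⊗ (1 ⊗ g)`
plus terms whose first leg is shorter, induction on length leaves `T(X ⊗ g) Δ(1 ⊗ g) = 0`, and right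
multiplication by `1 ⊗ g` is injective.

The same leading term shows that every simple subcoalgebra contains some `1 ⊗ g`, so the coradical
is `kG` (`IsGraded.coradical_boson`). For a graded coalgebra whose coradical is its degree-zero
part, the grading is coradical as soon as no nonzero element of degree at least 2 has a coproduct
without inner components (`isCoradicalGrading_of_primitive`). For `H # kG` such elements have
primitive coefficients in `H`; conversely a primitive `X` puts `X ⊗ 1` into the first term of the
filtration. -/

namespace QuasiBosonization

universe u v w

/-! ### Cocycle identities between the structure constants. -/

namespace NormalizedThreeCocycle

variable {k : Type u} {G : Type v} [Field k] [CommGroup G] (Φ : NormalizedThreeCocycle k G)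

/-- The scalar in the product `(X ⊗ g)(Y ⊗ h)`. -/
def mulCoeff (x g y h : G) : kˣ := Φ (x * g) y h * Φ x y g / (Φ x g y * Φ (x * y) g h)

/-- The scalar in the multiplication of the braided tensor square. -/
def braidCoeff (x₁ x₂ y₁ y₂ : G) : kˣ :=
  Φ (x₁ * x₂) y₁ y₂ * Φ x₁ y₁ x₂ / (Φ x₁ x₂ y₁ * Φ (x₁ * y₁) x₂ y₂)

/-- The scalar in the antipode of `X ⊗ g`. -/
def antipodeCoeff (x g : G) : kˣ :=
  Φ g⁻¹ g g⁻¹ / (Φ (x⁻¹ * g⁻¹) (x * g) g⁻¹ * Φ x g g⁻¹)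

/-- Scalar part of `Δ(ab) = Δ(a)Δ(b)`. On the left, `tilde g y₁ y₂` comes from `g` acting on `Δ(Y)`,
`braidCoeff` from the braided tensor square, and `tilde y₁ x₂ g` from merging the actions of `x₂`
and `g` on `Y₁`. -/
theorem mulCoeff_comul (x₁ x₂ y₁ y₂ g h : G) :
    Φ.mulCoeff (x₁ * x₂) g (y₁ * y₂) h * Φ.tilde g y₁ y₂ * Φ.braidCoeff x₁ x₂ y₁ y₂ *
        Φ.tilde y₁ x₂ g * (Φ (x₁ * y₁) (x₂ * y₂) (g * h))⁻¹ =
      (Φ x₁ x₂ g)⁻¹ * (Φ y₁ y₂ h)⁻¹ * Φ.mulCoeff x₁ (x₂ * g) y₁ (y₂ * h) *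
        Φ.mulCoeff x₂ g y₂ h := by
  have h1 := congrArg Additive.ofMul (Φ.cocycle (x₁ * y₁) (x₂ * y₂) g h)
  have h2 := congrArg Additive.ofMul (Φ.cocycle (x₁ * x₂ * g) y₁ y₂ h)
  have h3 := congrArg Additive.ofMul (Φ.cocycle (x₁ * y₁) (x₂ * g) y₂ h)
  have h4 := congrArg Additive.ofMul (Φ.cocycle (x₁ * x₂) g y₁ y₂)
  have h5 := congrArg Additive.ofMul (Φ.cocycle x₁ x₂ g y₁)
  have h6 := congrArg Additive.ofMul (Φ.cocycle (x₁ * y₁) x₂ y₂ g)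
  have h7 := congrArg Additive.ofMul (Φ.cocycle (x₁ * x₂) y₁ y₂ g)
  have h8 := congrArg Additive.ofMul (Φ.cocycle (x₁ * y₁) x₂ g y₂)
  have h9 := congrArg Additive.ofMul (Φ.cocycle x₁ y₁ x₂ g)
  have h10 := congrArg Additive.ofMul (Φ.cocycle (x₁ * x₂) y₁ g y₂)
  have h11 := congrArg Additive.ofMul (Φ.cocycle x₁ x₂ y₁ g)
  -- In additive notation the claim is a ℤ-linear consequence of the cocycle instances. Normalizing
  -- products in `G` makes equal arguments of `Φ` syntactically equal.
  apply Additive.ofMul.injective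
  simp only [tilde, mulCoeff, braidCoeff, ofMul_mul, ofMul_div, ofMul_inv, mul_assoc, mul_comm,
    mul_left_comm] at h1 h2 h3 h4 h5 h6 h7 h8 h9 h10 h11 ⊢
  linear_combination (norm := module)
    -h1 - h2 + h3 - h4 - h5 + h6 - h7 - h8 - h9 + h10 + h11

/-- Scalar part of quasi-associativity: `Φ` occurs at the right degrees on one side and at the left
degrees on the other, and `(Φ x y z)⁻¹` is the associativity constraint of `H`. -/
theorem mulCoeff_assoc (x g y h z e : G) :
    Φ g h e * Φ.mulCoeff y h z e * Φ.mulCoeff x g (y * z) (h * e) * Φ.tilde g y z *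
        Φ.tilde z g h =
      Φ (x * g) (y * h) (z * e) * Φ.mulCoeff x g y h * Φ.mulCoeff (x * y) (g * h) z e *
        (Φ x y z)⁻¹ := by
  have h1 := congrArg Additive.ofMul (Φ.cocycle (x * y * z) g h e)
  have h2 := congrArg Additive.ofMul (Φ.cocycle (x * g) (y * h) z e)
  have h3 := congrArg Additive.ofMul (Φ.cocycle (x * g) (y * z) h e)
  have h4 := congrArg Additive.ofMul (Φ.cocycle x y z g)
  have h5 := congrArg Additive.ofMul (Φ.cocycle (x * y) z g h)
  have h6 := congrArg Additive.ofMul (Φ.cocycle (x * g) y h z)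
  have h7 := congrArg Additive.ofMul (Φ.cocycle (x * y) g h z)
  have h8 := congrArg Additive.ofMul (Φ.cocycle (x * g) y z h)
  have h9 := congrArg Additive.ofMul (Φ.cocycle (x * y) g z h)
  have h10 := congrArg Additive.ofMul (Φ.cocycle x g y z)
  have h11 := congrArg Additive.ofMul (Φ.cocycle x y g z)
  apply Additive.ofMul.injective
  simp only [tilde, mulCoeff, ofMul_mul, ofMul_div, ofMul_inv, mul_assoc, mul_comm,
    mul_left_comm] at h1 h2 h3 h4 h5 h6 h7 h8 h9 h10 h11 ⊢
  linear_combination (norm := module)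
    -h1 - h2 + h3 - h4 - h5 + h6 - h7 - h8 + h9 - h10 + h11

theorem mulCoeff_one_one (g h : G) : Φ.mulCoeff 1 g 1 h = 1 := by
  simp [mulCoeff, Φ.one_left, Φ.normalized]

theorem mulCoeff_one_left_one_right (g y : G) : Φ.mulCoeff 1 g y 1 = 1 := by
  simp [mulCoeff, Φ.one_left, Φ.one_right]

theorem mulCoeff_unit_left (y h : G) : Φ.mulCoeff 1 1 y h = 1 := by
  simp [mulCoeff, Φ.one_left, Φ.normalized]

theorem mulCoeff_of_one (x g h : G) : Φ.mulCoeff x g 1 h = (Φ x g h)⁻¹ := by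
  simp [mulCoeff, Φ.one_right, Φ.normalized]

theorem antipodeCoeff_one (g : G) : Φ.antipodeCoeff 1 g = 1 := by
  simp [antipodeCoeff, Φ.one_left]

/-- The scalar in `S((X ⊗ g)₁) (X ⊗ g)₂`. -/
theorem antipodeCoeff_left (x₁ x₂ g : G) :
    (Φ x₁ x₂ g)⁻¹ * Φ.antipodeCoeff x₁ (x₂ * g) * Φ.mulCoeff x₁ (x₁ * x₂ * g)⁻¹ x₂ g =
      Φ.mulCoeff 1 (x₁ * x₂ * g)⁻¹ (x₁ * x₂) g * Φ.tilde (x₁ * x₂ * g)⁻¹ x₁ x₂ := by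
  have h1 := congrArg Additive.ofMul (Φ.cocycle (x₁ * x₂ * g)⁻¹ x₁ x₂ g)
  have h2 := congrArg Additive.ofMul (Φ.cocycle (x₁ * x₂ * g)⁻¹ x₁ (x₂ * g) (x₂ * g)⁻¹)
  have e1 : (x₁ * x₂ * g)⁻¹ * x₁ = (x₂ * g)⁻¹ := by simp [mul_assoc]
  have e2 : x₁⁻¹ * (x₂ * g)⁻¹ = (x₁ * x₂ * g)⁻¹ := by simp [mul_comm, mul_left_comm]
  have e3 : x₁ * (x₁ * x₂ * g)⁻¹ = (x₂ * g)⁻¹ := by simp [mul_comm, mul_left_comm]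
  apply Additive.ofMul.injective
  simp only [e1, e2, e3, tilde, mulCoeff, antipodeCoeff, ofMul_mul, ofMul_div, ofMul_inv,
    one_mul, mul_inv_cancel, Φ.one_left, Φ.one_right, ofMul_one, ← mul_assoc] at h1 h2 ⊢
  linear_combination (norm := module) h1 + h2

/-- The scalar in `(X ⊗ g)₁ β((X ⊗ g)₂) S((X ⊗ g)₃)`. -/
theorem antipodeCoeff_right (x₁ x₂ g : G) :
    (Φ x₁ x₂ g)⁻¹ * (Φ (x₂ * g) (x₂ * g)⁻¹ (x₂ * g))⁻¹ * Φ.antipodeCoeff x₂ g *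
        Φ.mulCoeff x₁ (x₂ * g) x₂ (x₂ * g)⁻¹ * Φ.tilde x₂ (x₂ * g) (x₂ * g)⁻¹ =
      (Φ g g⁻¹ g)⁻¹ * (Φ (x₁ * x₂) g g⁻¹)⁻¹ := by
  have h1 := congrArg Additive.ofMul (Φ.cocycle (x₁ * x₂) g x₂ (x₂ * g)⁻¹)
  have h2 := congrArg Additive.ofMul (Φ.cocycle x₁ x₂ g x₂)
  have h3 := congrArg Additive.ofMul (Φ.cocycle x₂ g x₂ (x₂ * g)⁻¹)
  have h4 := congrArg Additive.ofMul (Φ.cocycle (x₂ * g) (x₂ * g)⁻¹ (x₂ * g) g⁻¹)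
  have h5 := congrArg Additive.ofMul (Φ.cocycle g⁻¹ g g⁻¹ g)
  have e1 : x₂⁻¹ * g⁻¹ = (x₂ * g)⁻¹ := by simp [mul_comm]
  have e2 : x₂ * (x₂ * g)⁻¹ = g⁻¹ := by simp
  have e3 : x₂ * g * g⁻¹ = x₂ := by simp
  have e4 : g * x₂ = x₂ * g := mul_comm _ _
  apply Additive.ofMul.injective
  simp only [e1, e2, e3, e4, tilde, mulCoeff, antipodeCoeff, ofMul_mul, ofMul_div, ofMul_inv,
    mul_one, mul_inv_cancel, inv_mul_cancel, Φ.one_left, Φ.one_right, Φ.normalized, ofMul_one,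
    mul_assoc] at h1 h2 h3 h4 h5 ⊢
  linear_combination (norm := module) h1 + h2 - h3 + h4 - h5

end NormalizedThreeCocycle

/-! ### Homogeneous elements of Yetter-Drinfeld modules. -/

section Components

variable {k : Type u} {G : Type v} [Field k] [CommGroup G] [Fintype G] [DecidableEq G]
  {Φ : NormalizedThreeCocycle k G}
variable {U V W N : Type*} [AddCommGroup U] [Module k U] [AddCommGroup V] [Module k V]
  [AddCommGroup W] [Module k W] [AddCommGroup N] [Module k N]

namespace YDModule

theorem proj_eq_of_mem (D : YDModule Φ V) {a : G} {v : V} (hv : v ∈ D.component a) :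
    D.proj a v = v := by
  obtain ⟨v, rfl⟩ := hv
  simp [D.proj_proj]

theorem mem_component_iff (D : YDModule Φ V) {a : G} {v : V} :
    v ∈ D.component a ↔ D.proj a v = v :=
  ⟨D.proj_eq_of_mem, fun h => ⟨v, h⟩⟩

theorem proj_mem (D : YDModule Φ V) (a : G) (v : V) : D.proj a v ∈ D.component a := ⟨v, rfl⟩

theorem proj_of_mem (D : YDModule Φ V) {a : G} {v : V} (hv : v ∈ D.component a) (b : G) :
    D.proj b v = if b = a then v else 0 := by
  obtain ⟨v, rfl⟩ := hv
  exact D.proj_proj _ _ _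

theorem act_mem (D : YDModule Φ V) {a : G} {v : V} (hv : v ∈ D.component a) (f : G) :
    D.act f v ∈ D.component a := by
  rw [mem_component_iff] at hv ⊢
  rw [← D.act_proj, hv]

theorem act_act_of_mem (D : YDModule Φ V) {a : G} {v : V} (hv : v ∈ D.component a) (e f : G) :
    D.act e (D.act f v) = Φ.tilde a e f • D.act (e * f) v := by
  have := D.act_act e f a v
  rwa [D.proj_eq_of_mem hv] at this

theorem IsHom.map_mem {D : YDModule Φ V} {E : YDModule Φ W} {f : V →ₗ[k] W} (hf : IsHom D E f)
    {a : G} {v : V} (hv : v ∈ D.component a) : f v ∈ E.component a := by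
  rw [mem_component_iff] at hv ⊢
  rw [← hf.map_proj, hv]

theorem tmul_mem (D : YDModule Φ V) (E : YDModule Φ W) {a b : G} {v : V} {w : W}
    (hv : v ∈ D.component a) (hw : w ∈ E.component b) :
    v ⊗ₜ[k] w ∈ (D.tensor E).component (a * b) := by
  rw [mem_component_iff] at hv hw ⊢
  have := tensorProj_tmul D E (a * b) a b v w
  rwa [hv, hw, if_pos rfl] at this

theorem tensor_act_tmul (D : YDModule Φ V) (E : YDModule Φ W) {a b : G} {v : V} {w : W}
    (hv : v ∈ D.component a) (hw : w ∈ E.component b) (f : G) :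
    (D.tensor E).act f (v ⊗ₜ[k] w) = Φ.tilde f a b • (D.act f v ⊗ₜ[k] E.act f w) := by
  have := tensorAct_tmul D E f a b v w
  rwa [D.proj_eq_of_mem hv, E.proj_eq_of_mem hw, D.proj_eq_of_mem (D.act_mem hv f),
    E.proj_eq_of_mem (E.act_mem hw f)] at this

@[elab_as_elim]
theorem component_induction (D : YDModule Φ V) {motive : V → Prop} (v : V)
    (add : ∀ v w, motive v → motive w → motive (v + w))
    (mem : ∀ a, ∀ v ∈ D.component a, motive v) : motive v := by
  rw [← D.sum_proj v]
  exact Finset.sum_induction _ motive add (mem 1 0 (zero_mem _)) fun a _ => mem a _ (D.proj_mem a v)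

theorem linearMap_ext (D : YDModule Φ V) {f g : V →ₗ[k] N}
    (h : ∀ a, ∀ v ∈ D.component a, f v = g v) : f = g := by
  ext v
  refine D.component_induction v (fun v w hv hw => ?_) h
  rw [map_add, map_add, hv, hw]

/-- The component of degree `x` of a tensor product is spanned by the tensors of homogeneous
elements of degrees with product `x`. -/
@[elab_as_elim]
theorem tensor_component_induction (D : YDModule Φ V) (E : YDModule Φ W) {x : G}
    {motive : V ⊗[k] W → Prop} {t : V ⊗[k] W} (ht : t ∈ (D.tensor E).component x)
    (zero : motive 0) (add : ∀ s t, motive s → motive t → motive (s + t))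
    (tmul : ∀ a b, a * b = x → ∀ v ∈ D.component a, ∀ w ∈ E.component b, motive (v ⊗ₜ[k] w)) :
    motive t := by
  obtain ⟨t, rfl⟩ := ht
  change motive (tensorProj D E x t)
  induction t with
  | zero => simpa using zero
  | add s t hs ht => rw [map_add]; exact add _ _ hs ht
  | tmul v w =>
    rw [tensorProj, LinearMap.sum_apply]
    exact Finset.sum_induction _ motive add zero fun a _ =>
      tmul a (a⁻¹ * x) (by simp) _ (D.proj_mem _ _) _ (E.proj_mem _ _)

@[elab_as_elim]
theorem tensor_induction (D : YDModule Φ V) (E : YDModule Φ W)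
    {motive : V ⊗[k] W → Prop} (t : V ⊗[k] W)
    (zero : motive 0) (add : ∀ s t, motive s → motive t → motive (s + t))
    (tmul : ∀ a b, ∀ v ∈ D.component a, ∀ w ∈ E.component b, motive (v ⊗ₜ[k] w)) :
    motive t :=
  (D.tensor E).component_induction (motive := motive) t add fun _ _ ht =>
    tensor_component_induction D E (motive := motive) ht zero add fun a b _ => tmul a b

theorem assoc_tmul (C : YDModule Φ U) (D : YDModule Φ V) (E : YDModule Φ W) {a b c : G}
    {x : U} {y : V} {z : W} (hx : x ∈ C.component a) (hy : y ∈ D.component b)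
    (hz : z ∈ E.component c) :
    assoc C D E ((x ⊗ₜ[k] y) ⊗ₜ[k] z) = (Φ a b c)⁻¹ • (x ⊗ₜ[k] (y ⊗ₜ[k] z)) := by
  simp only [assoc, LinearMap.sum_apply, LinearMap.smul_apply, LinearMap.comp_apply,
    TensorProduct.map_tmul]
  rw [Finset.sum_eq_single a, Finset.sum_eq_single b, Finset.sum_eq_single c]
  · simp [C.proj_eq_of_mem hx, D.proj_eq_of_mem hy, E.proj_eq_of_mem hz]
  all_goals simp +contextual [C.proj_of_mem hx, D.proj_of_mem hy, E.proj_of_mem hz]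

theorem assocInv_tmul (C : YDModule Φ U) (D : YDModule Φ V) (E : YDModule Φ W) {a b c : G}
    {x : U} {y : V} {z : W} (hx : x ∈ C.component a) (hy : y ∈ D.component b)
    (hz : z ∈ E.component c) :
    assocInv C D E (x ⊗ₜ[k] (y ⊗ₜ[k] z)) = Φ a b c • ((x ⊗ₜ[k] y) ⊗ₜ[k] z) := by
  simp only [assocInv, LinearMap.sum_apply, LinearMap.smul_apply, LinearMap.comp_apply,
    TensorProduct.map_tmul]
  rw [Finset.sum_eq_single a, Finset.sum_eq_single b, Finset.sum_eq_single c]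
  · simp [C.proj_eq_of_mem hx, D.proj_eq_of_mem hy, E.proj_eq_of_mem hz]
  all_goals simp +contextual [C.proj_of_mem hx, D.proj_of_mem hy, E.proj_of_mem hz]

theorem braiding_tmul (D : YDModule Φ V) (E : YDModule Φ W) {a : G} {x : V}
    (hx : x ∈ D.component a) (y : W) :
    braiding D E (x ⊗ₜ[k] y) = E.act a y ⊗ₜ[k] x := by
  simp only [braiding, LinearMap.sum_apply, LinearMap.comp_apply]
  rw [Finset.sum_eq_single a]
  · simp [D.proj_eq_of_mem hx]
  all_goals simp +contextual [D.proj_of_mem hx]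

end YDModule

/-- Each of the four associativity constraints in the composite contributes one factor of
`braidCoeff`; the braiding replaces `Y₁` by `x₂ ▷ Y₁` and contributes no scalar. -/
theorem braidedTensorMul_tmul (D : YDModule Φ V) (m : V ⊗[k] V →ₗ[k] V) {x₁ x₂ y₁ y₂ : G}
    {X₁ X₂ Y₁ Y₂ : V} (hX₁ : X₁ ∈ D.component x₁) (hX₂ : X₂ ∈ D.component x₂)
    (hY₁ : Y₁ ∈ D.component y₁) (hY₂ : Y₂ ∈ D.component y₂) :
    braidedTensorMul D m ((X₁ ⊗ₜ[k] X₂) ⊗ₜ[k] (Y₁ ⊗ₜ[k] Y₂)) =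
      Φ.braidCoeff x₁ x₂ y₁ y₂ • (m (X₁ ⊗ₜ[k] D.act x₂ Y₁) ⊗ₜ[k] m (X₂ ⊗ₜ[k] Y₂)) := by
  have hY : D.act x₂ Y₁ ∈ D.component y₁ := D.act_mem hY₁ _
  simp only [braidedTensorMul, LinearMap.comp_apply, LinearMap.rTensor_tmul, LinearMap.lTensor_tmul,
    YDModule.assocInv_tmul _ _ _ (YDModule.tmul_mem D D hX₁ hX₂) hY₁ hY₂,
    YDModule.assoc_tmul _ _ _ hX₁ hX₂ hY₁, YDModule.braiding_tmul _ _ hX₂,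
    YDModule.assocInv_tmul _ _ _ hX₁ hY hX₂, LinearMap.map_smul_of_tower,
    YDModule.assoc_tmul _ _ _ (YDModule.tmul_mem D D hX₁ hY) hX₂ hY₂, TensorProduct.map_tmul,
    ← TensorProduct.smul_tmul', smul_smul]
  congr 1
  simp only [NormalizedThreeCocycle.braidCoeff, div_eq_mul_inv, mul_inv]
  ac_rfl

end Components

/-! ### The coalgebra `H # kG`. -/

section Bosonization

variable {k : Type u} {G : Type v} [Field k] [CommGroup G]
variable {H : Type w} [AddCommGroup H] [Module k H] {N : Type*} [AddCommGroup N] [Module k N]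

theorem elt_apply (g : G) (X : H) : elt (k := k) g X = X ⊗ₜ[k] MonoidAlgebra.single g 1 := rfl

/-- The coefficient of `g` in an element of `kG`. -/
noncomputable def coeffAt (g : G) : MonoidAlgebra k G →ₗ[k] k :=
  Finsupp.lapply g ∘ₗ (MonoidAlgebra.coeffLinearEquiv k).toLinearMap

omit [CommGroup G] in
theorem coeffAt_single [DecidableEq G] (g h : G) (c : k) :
    coeffAt g (MonoidAlgebra.single h c) = if h = g then c else 0 := by
  classical
  simp only [coeffAt, LinearMap.comp_apply, LinearEquiv.coe_coe,
    MonoidAlgebra.coeffLinearEquiv_apply, Finsupp.lapply_apply]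
  exact Finsupp.single_apply

theorem elt_linearMap_ext {f f' : H ⊗[k] MonoidAlgebra k G →ₗ[k] N}
    (h : ∀ (g : G) (X : H), f (elt g X) = f' (elt g X)) : f = f' := by
  refine TensorProduct.ext' fun X a => ?_
  induction a using MonoidAlgebra.induction_linear with
  | zero => simp
  | add a b ha hb => simp only [TensorProduct.tmul_add, map_add, ha, hb]
  | single g c =>
    have : MonoidAlgebra.single g c = c • (MonoidAlgebra.single g 1 : MonoidAlgebra k G) := by
      simp [MonoidAlgebra.smul_single]
    rw [this, TensorProduct.tmul_smul, map_smul, map_smul]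
    exact congrArg _ (h g X)

variable [Fintype G] [DecidableEq G]

/-- The component at `g` of an element of `H ⊗ kG`. -/
noncomputable def eltCoeff (g : G) : H ⊗[k] MonoidAlgebra k G →ₗ[k] H :=
  (TensorProduct.rid k H).toLinearMap ∘ₗ (coeffAt g).lTensor H

omit [Fintype G] in
theorem eltCoeff_elt (g h : G) (X : H) :
    eltCoeff (k := k) g (elt h X) = if h = g then X else 0 := by
  simp only [eltCoeff, elt_apply, LinearMap.comp_apply, LinearMap.lTensor_tmul, coeffAt_single]
  split_ifs <;> simp

theorem sum_elt_eltCoeff (a : H ⊗[k] MonoidAlgebra k G) :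
    ∑ g, elt g (eltCoeff (k := k) g a) = a := by
  have : ∑ g, elt g ∘ₗ eltCoeff g = (LinearMap.id : H ⊗[k] MonoidAlgebra k G →ₗ[k] _) :=
    elt_linearMap_ext fun g X => by simp [LinearMap.sum_apply, eltCoeff_elt, apply_ite]
  simpa [LinearMap.sum_apply] using LinearMap.congr_fun this a

/-- The linear map on `H ⊗ kG` given by a family of linear maps on `H` indexed by `G`. -/
noncomputable def ofFamily (F : G → H →ₗ[k] N) : H ⊗[k] MonoidAlgebra k G →ₗ[k] N :=
  ∑ g, F g ∘ₗ eltCoeff g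

theorem ofFamily_elt (F : G → H →ₗ[k] N) (g : G) (X : H) : ofFamily F (elt g X) = F g X := by
  simp [ofFamily, LinearMap.sum_apply, eltCoeff_elt, apply_ite]

variable {Φ : NormalizedThreeCocycle k G} {D : YDModule Φ H}

/-- Linear maps on `H ⊗ kG` agree if they agree on the elements `X ⊗ g` with `X` homogeneous. -/
theorem boson_linearMap_ext (D : YDModule Φ H) {f f' : H ⊗[k] MonoidAlgebra k G →ₗ[k] N}
    (h : ∀ (x g : G), ∀ X ∈ D.component x, f (elt g X) = f' (elt g X)) : f = f' :=
  elt_linearMap_ext fun g X =>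
    LinearMap.congr_fun (D.linearMap_ext (f := f ∘ₗ elt g) (g := f' ∘ₗ elt g) fun x => h x g) X

/-- The map `X₁ ⊗ X₂ ↦ Φ(x₁, x₂, g)⁻¹ (X₁ ⊗ x₂ g) ⊗ (X₂ ⊗ g)`. -/
noncomputable def bosonSplit (D : YDModule Φ H) (g : G) :
    H ⊗[k] H →ₗ[k] (H ⊗[k] MonoidAlgebra k G) ⊗[k] (H ⊗[k] MonoidAlgebra k G) :=
  ∑ x₁ : G, ∑ x₂ : G, (Φ x₁ x₂ g)⁻¹ •
    TensorProduct.map (elt (x₂ * g) ∘ₗ D.proj x₁) (elt g ∘ₗ D.proj x₂)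

theorem bosonSplit_tmul (D : YDModule Φ H) (g : G) {x₁ x₂ : G} {X₁ X₂ : H}
    (hX₁ : X₁ ∈ D.component x₁) (hX₂ : X₂ ∈ D.component x₂) :
    bosonSplit D g (X₁ ⊗ₜ[k] X₂) = (Φ x₁ x₂ g)⁻¹ • (elt (x₂ * g) X₁ ⊗ₜ[k] elt g X₂) := by
  simp only [bosonSplit, LinearMap.sum_apply, LinearMap.smul_apply, LinearMap.comp_apply,
    TensorProduct.map_tmul]
  rw [Finset.sum_eq_single x₁, Finset.sum_eq_single x₂]
  · simp [D.proj_eq_of_mem hX₁, D.proj_eq_of_mem hX₂]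
  all_goals simp +contextual [D.proj_of_mem hX₁, D.proj_of_mem hX₂]

namespace BraidedHopfAlgebra

variable (B : BraidedHopfAlgebra D)

theorem unit_mem_component : B.unit 1 ∈ D.component 1 := by
  rw [D.mem_component_iff, ← B.unit_isHom.map_proj]
  simp [YDModule.unit]

theorem act_unit (g : G) : D.act g (B.unit 1) = B.unit 1 :=
  (B.unit_isHom.map_act g 1).symm

theorem counit_eq_zero_of_mem {x : G} (hx : x ≠ 1) {X : H} (hX : X ∈ D.component x) :
    B.counit X = 0 := by
  have := B.counit_isHom.map_proj x X
  rw [D.proj_eq_of_mem hX] at this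
  simpa [YDModule.unit, hx] using this

theorem counit_act (g : G) (X : H) : B.counit (D.act g X) = B.counit X :=
  B.counit_isHom.map_act g X

theorem comul_mem_component {x : G} {X : H} (hX : X ∈ D.component x) :
    B.comul X ∈ (D.tensor D).component x := B.comul_isHom.map_mem hX

theorem mul_mem_component {x y : G} {X Y : H} (hX : X ∈ D.component x) (hY : Y ∈ D.component y) :
    B.mul (X ⊗ₜ[k] Y) ∈ D.component (x * y) := B.mul_isHom.map_mem (YDModule.tmul_mem D D hX hY)

theorem act_mul {x y : G} {X Y : H} (hX : X ∈ D.component x) (hY : Y ∈ D.component y) (g : G) :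
    D.act g (B.mul (X ⊗ₜ[k] Y)) = Φ.tilde g x y • B.mul (D.act g X ⊗ₜ[k] D.act g Y) := by
  rw [← B.mul_isHom.map_act, YDModule.tensor_act_tmul D D hX hY, LinearMap.map_smul_of_tower]

theorem mul_unit_apply (X : H) : B.mul (X ⊗ₜ[k] B.unit 1) = X := by
  simpa using LinearMap.congr_fun B.mul_unit (X ⊗ₜ[k] 1)

theorem unit_mul_apply (X : H) : B.mul (B.unit 1 ⊗ₜ[k] X) = X := by
  simpa using LinearMap.congr_fun B.unit_mul (1 ⊗ₜ[k] X)

theorem mul_assoc_of_mem {x y z : G} {X Y Z : H} (hX : X ∈ D.component x) (hY : Y ∈ D.component y)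
    (hZ : Z ∈ D.component z) :
    B.mul (B.mul (X ⊗ₜ[k] Y) ⊗ₜ[k] Z) = (Φ x y z)⁻¹ • B.mul (X ⊗ₜ[k] B.mul (Y ⊗ₜ[k] Z)) := by
  have := LinearMap.congr_fun B.mul_assoc ((X ⊗ₜ[k] Y) ⊗ₜ[k] Z)
  simpa only [LinearMap.comp_apply, LinearMap.rTensor_tmul, YDModule.assoc_tmul _ _ _ hX hY hZ,
    LinearMap.map_smul_of_tower, LinearMap.lTensor_tmul] using this

/-- The comultiplication of `H ⊗ kG`. -/
noncomputable def bosonComul :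
    H ⊗[k] MonoidAlgebra k G →ₗ[k] (H ⊗[k] MonoidAlgebra k G) ⊗[k] (H ⊗[k] MonoidAlgebra k G) :=
  ofFamily fun g => bosonSplit D g ∘ₗ B.comul

/-- The counit of `H ⊗ kG`. -/
noncomputable def bosonCounit : H ⊗[k] MonoidAlgebra k G →ₗ[k] k :=
  ofFamily fun _ => B.counit

theorem bosonComul_elt (g : G) (X : H) : B.bosonComul (elt g X) = bosonSplit D g (B.comul X) :=
  ofFamily_elt _ _ _

theorem bosonCounit_elt (g : G) (X : H) : B.bosonCounit (elt g X) = B.counit X :=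
  ofFamily_elt _ _ _

/-- The iterated splitting `X₁ ⊗ (X₂ ⊗ X₃) ↦
(Φ(x₁, x₂x₃, g) Φ(x₂, x₃, g))⁻¹ (X₁ ⊗ x₂x₃g) ⊗ ((X₂ ⊗ x₃g) ⊗ (X₃ ⊗ g))`. -/
noncomputable def bosonSplit₃ (D : YDModule Φ H) (g : G) :
    H ⊗[k] (H ⊗[k] H) →ₗ[k] (H ⊗[k] MonoidAlgebra k G) ⊗[k]
      ((H ⊗[k] MonoidAlgebra k G) ⊗[k] (H ⊗[k] MonoidAlgebra k G)) :=
  ∑ x : G, ∑ y : G, (Φ x y g)⁻¹ •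
    TensorProduct.map (elt (y * g) ∘ₗ D.proj x) (bosonSplit D g ∘ₗ (D.tensor D).proj y)

theorem bosonSplit₃_tmul {x y g : G} {X : H} {t : H ⊗[k] H} (hX : X ∈ D.component x)
    (ht : t ∈ (D.tensor D).component y) :
    bosonSplit₃ D g (X ⊗ₜ[k] t) = (Φ x y g)⁻¹ • (elt (y * g) X ⊗ₜ[k] bosonSplit D g t) := by
  simp only [bosonSplit₃, LinearMap.sum_apply, LinearMap.smul_apply, LinearMap.comp_apply,
    TensorProduct.map_tmul]
  rw [Finset.sum_eq_single x, Finset.sum_eq_single y]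
  · simp [D.proj_eq_of_mem hX, (D.tensor D).proj_eq_of_mem ht]
  all_goals simp +contextual [D.proj_of_mem hX, (D.tensor D).proj_of_mem ht]

/-- Together with `assoc_rTensor_bosonComul_split` this expresses both iterated coproducts through
`bosonSplit₃`, so coassociativity in the braided category gives strict coassociativity of `H # kG`.
-/
theorem lTensor_bosonComul_split (g : G) (t : H ⊗[k] H) :
    B.bosonComul.lTensor _ (bosonSplit D g t) = bosonSplit₃ D g (B.comul.lTensor H t) := by
  refine YDModule.tensor_induction D D t (by simp) (fun s t hs ht => by simp only [map_add, hs, ht])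
    fun x y X hX Y hY => ?_
  rw [bosonSplit_tmul D g hX hY, LinearMap.lTensor_tmul,
    bosonSplit₃_tmul hX (B.comul_mem_component hY), LinearMap.map_smul_of_tower,
    LinearMap.lTensor_tmul, bosonComul_elt]

/-- The constants match by the cocycle condition at `(a, b, y, g)`, whose factor `Φ a b y` is
supplied by the associativity constraint of the braided category. -/
theorem assoc_rTensor_bosonComul_split (g : G) (t : H ⊗[k] H) :
    TensorProduct.assoc k _ _ _ (B.bosonComul.rTensor _ (bosonSplit D g t)) =
      bosonSplit₃ D g (YDModule.assoc D D D (B.comul.rTensor H t)) := by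
  refine YDModule.tensor_induction D D t (by simp) (fun s t hs ht => by simp only [map_add, hs, ht])
    fun x y X hX Y hY => ?_
  rw [bosonSplit_tmul D g hX hY, LinearMap.rTensor_tmul, LinearMap.map_smul_of_tower,
    LinearMap.rTensor_tmul, bosonComul_elt]
  refine YDModule.tensor_component_induction D D (B.comul_mem_component hX) (by simp)
    (fun s t hs ht => ?_) fun a b hab X₁ h₁ X₂ h₂ => ?_
  · simp only [map_add, TensorProduct.add_tmul, smul_add, hs, ht]
  · subst hab
    rw [bosonSplit_tmul D _ h₁ h₂, YDModule.assoc_tmul _ _ _ h₁ h₂ hY, LinearMap.map_smul_of_tower,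
      bosonSplit₃_tmul h₁ (YDModule.tmul_mem D D h₂ hY), bosonSplit_tmul D g h₂ hY]
    simp only [Units.smul_def, TensorProduct.tmul_smul, ← TensorProduct.smul_tmul', map_smul,
      TensorProduct.assoc_tmul, smul_smul, ← Units.val_mul, ← mul_inv, Φ.cocycle]
    simp only [_root_.mul_assoc]

/-- The counit of `H` vanishes outside degree `1`, and in that degree the constant of `bosonSplit`
is trivial. -/
theorem rTensor_bosonCounit_split (g : G) (t : H ⊗[k] H) :
    B.bosonCounit.rTensor _ (bosonSplit D g t) = (elt g).lTensor k (B.counit.rTensor H t) := by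
  refine YDModule.tensor_induction D D t (by simp) (fun s t hs ht => by simp only [map_add, hs, ht])
    fun x y X hX Y hY => ?_
  rw [bosonSplit_tmul D g hX hY, LinearMap.map_smul_of_tower]
  simp only [LinearMap.rTensor_tmul, LinearMap.lTensor_tmul, bosonCounit_elt]
  by_cases hx : x = 1
  · subst hx
    simp [Φ.one_left]
  · simp [B.counit_eq_zero_of_mem hx hX]

theorem lTensor_bosonCounit_split (g : G) (t : H ⊗[k] H) :
    B.bosonCounit.lTensor _ (bosonSplit D g t) = (elt g).rTensor k (B.counit.lTensor H t) := by
  refine YDModule.tensor_induction D D t (by simp) (fun s t hs ht => by simp only [map_add, hs, ht])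
    fun x y X hX Y hY => ?_
  rw [bosonSplit_tmul D g hX hY, LinearMap.map_smul_of_tower]
  simp only [LinearMap.rTensor_tmul, LinearMap.lTensor_tmul, bosonCounit_elt]
  by_cases hy : y = 1
  · subst hy
    simp [Φ.normalized]
  · simp [B.counit_eq_zero_of_mem hy hY]

/-- The coalgebra `H # kG`. -/
@[reducible] noncomputable def bosonCoalgebra : Coalgebra k (H ⊗[k] MonoidAlgebra k G) where
  comul := B.bosonComul
  counit := B.bosonCounit
  coassoc := elt_linearMap_ext fun g X => by
    simp only [LinearMap.comp_apply, LinearEquiv.coe_coe, bosonComul_elt,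
      assoc_rTensor_bosonComul_split, lTensor_bosonComul_split]
    exact congrArg _ (LinearMap.congr_fun B.coassoc X)
  rTensor_counit_comp_comul := elt_linearMap_ext fun g X => by
    simp only [LinearMap.comp_apply, bosonComul_elt, rTensor_bosonCounit_split]
    have := LinearMap.congr_fun B.counit_comul X
    simp only [LinearMap.comp_apply] at this
    simp [this]
  lTensor_counit_comp_comul := elt_linearMap_ext fun g X => by
    simp only [LinearMap.comp_apply, bosonComul_elt, lTensor_bosonCounit_split]
    have := LinearMap.congr_fun B.comul_counit X
    simp only [LinearMap.comp_apply] at this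
    simp [this]

end BraidedHopfAlgebra
end Bosonization

/-! ### The product of `H # kG`. -/

section BosonMul

variable {k : Type u} {G : Type v} [Field k] [CommGroup G] [Fintype G] [DecidableEq G]
variable {H : Type w} [AddCommGroup H] [Module k H] {N : Type*} [AddCommGroup N] [Module k N]
variable {Φ : NormalizedThreeCocycle k G} {D : YDModule Φ H}

theorem boson_linearMap_ext₂ (D : YDModule Φ H)
    {f f' : (H ⊗[k] MonoidAlgebra k G) ⊗[k] (H ⊗[k] MonoidAlgebra k G) →ₗ[k] N}
    (h : ∀ (x g : G), ∀ X ∈ D.component x, ∀ (y h : G), ∀ Y ∈ D.component y,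
      f (elt g X ⊗ₜ[k] elt h Y) = f' (elt g X ⊗ₜ[k] elt h Y)) : f = f' := by
  refine TensorProduct.ext (boson_linearMap_ext D fun x g X hX => ?_)
  exact boson_linearMap_ext D fun y l Y hY => h x g X hX y l Y hY

theorem boson_linearMap_ext₃ (D : YDModule Φ H)
    {f f' : (H ⊗[k] MonoidAlgebra k G) ⊗[k]
      ((H ⊗[k] MonoidAlgebra k G) ⊗[k] (H ⊗[k] MonoidAlgebra k G)) →ₗ[k] N}
    (h : ∀ (x g : G), ∀ X ∈ D.component x, ∀ (y h : G), ∀ Y ∈ D.component y,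
      ∀ (z e : G), ∀ Z ∈ D.component z,
      f (elt g X ⊗ₜ[k] (elt h Y ⊗ₜ[k] elt e Z)) = f' (elt g X ⊗ₜ[k] (elt h Y ⊗ₜ[k] elt e Z))) :
    f = f' := by
  refine TensorProduct.ext (boson_linearMap_ext D fun x g X hX => ?_)
  exact boson_linearMap_ext₂ D fun y l Y hY => h x g X hX y l Y hY

theorem boson_linearMap_ext₄ (D : YDModule Φ H)
    {f f' : (H ⊗[k] MonoidAlgebra k G) ⊗[k] ((H ⊗[k] MonoidAlgebra k G) ⊗[k]
      ((H ⊗[k] MonoidAlgebra k G) ⊗[k] (H ⊗[k] MonoidAlgebra k G))) →ₗ[k] N}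
    (h : ∀ (x g : G), ∀ X ∈ D.component x, ∀ (y h : G), ∀ Y ∈ D.component y,
      ∀ (z e : G), ∀ Z ∈ D.component z, ∀ (w d : G), ∀ W ∈ D.component w,
      f (elt g X ⊗ₜ[k] (elt h Y ⊗ₜ[k] (elt e Z ⊗ₜ[k] elt d W))) =
        f' (elt g X ⊗ₜ[k] (elt h Y ⊗ₜ[k] (elt e Z ⊗ₜ[k] elt d W)))) :
    f = f' := by
  refine TensorProduct.ext (boson_linearMap_ext D fun x g X hX => ?_)
  exact boson_linearMap_ext₃ D fun y l Y hY => h x g X hX y l Y hY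

namespace BraidedHopfAlgebra

variable (B : BraidedHopfAlgebra D)

/-- The map `X ⊗ Y ↦ (X ⊗ g)(Y ⊗ h)`. -/
noncomputable def bosonMulAt (g h : G) : H ⊗[k] H →ₗ[k] H ⊗[k] MonoidAlgebra k G :=
  ∑ x : G, ∑ y : G, Φ.mulCoeff x g y h •
    (elt (g * h) ∘ₗ B.mul ∘ₗ TensorProduct.map (D.proj x) (D.act g ∘ₗ D.proj y))

/-- The multiplication of `H ⊗ kG`. -/
noncomputable def bosonMul :
    (H ⊗[k] MonoidAlgebra k G) ⊗[k] (H ⊗[k] MonoidAlgebra k G) →ₗ[k] H ⊗[k] MonoidAlgebra k G :=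
  TensorProduct.lift (ofFamily fun g =>
    (ofFamily fun h => (TensorProduct.curry (B.bosonMulAt g h)).flip).flip)

theorem bosonMul_elt_eq (g h : G) (X Y : H) :
    B.bosonMul (elt g X ⊗ₜ[k] elt h Y) = B.bosonMulAt g h (X ⊗ₜ[k] Y) := by
  simp only [bosonMul, TensorProduct.lift.tmul, ofFamily_elt, LinearMap.flip_apply,
    TensorProduct.curry_apply]

theorem bosonMul_elt {x y : G} {X Y : H} (hX : X ∈ D.component x) (hY : Y ∈ D.component y)
    (g h : G) :
    B.bosonMul (elt g X ⊗ₜ[k] elt h Y) =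
      Φ.mulCoeff x g y h • elt (g * h) (B.mul (X ⊗ₜ[k] D.act g Y)) := by
  rw [bosonMul_elt_eq]
  simp only [bosonMulAt, LinearMap.sum_apply, LinearMap.smul_apply, LinearMap.comp_apply,
    TensorProduct.map_tmul]
  rw [Finset.sum_eq_single x, Finset.sum_eq_single y]
  · simp [D.proj_eq_of_mem hX, D.proj_eq_of_mem hY]
  all_goals simp +contextual [D.proj_of_mem hX, D.proj_of_mem hY]

theorem bosonMul_unit_left (a : H ⊗[k] MonoidAlgebra k G) :
    B.bosonMul (elt 1 (B.unit 1) ⊗ₜ[k] a) = a := by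
  refine LinearMap.congr_fun (boson_linearMap_ext D (f := TensorProduct.curry B.bosonMul _)
    (f' := LinearMap.id) fun y h Y hY => ?_) a
  rw [TensorProduct.curry_apply, B.bosonMul_elt B.unit_mem_component hY, Φ.mulCoeff_unit_left]
  simp [D.act_one, B.unit_mul_apply]

theorem bosonMul_unit_right (a : H ⊗[k] MonoidAlgebra k G) :
    B.bosonMul (a ⊗ₜ[k] elt 1 (B.unit 1)) = a := by
  refine LinearMap.congr_fun (boson_linearMap_ext D
    (f := (TensorProduct.curry B.bosonMul).flip (elt 1 (B.unit 1)))
    (f' := LinearMap.id) fun y h Y hY => ?_) a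
  rw [LinearMap.flip_apply, TensorProduct.curry_apply, B.bosonMul_elt hY B.unit_mem_component,
    Φ.mulCoeff_of_one, Φ.one_right]
  simp [B.act_unit, B.mul_unit_apply]

theorem bosonCounit_mul (a b : H ⊗[k] MonoidAlgebra k G) :
    B.bosonCounit (B.bosonMul (a ⊗ₜ[k] b)) = B.bosonCounit a * B.bosonCounit b := by
  refine LinearMap.congr_fun (boson_linearMap_ext₂ D (f := B.bosonCounit ∘ₗ B.bosonMul)
    (f' := LinearMap.mul' k k ∘ₗ TensorProduct.map B.bosonCounit B.bosonCounit)
    fun x g X hX y h Y hY => ?_) (a ⊗ₜ[k] b)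
  simp only [LinearMap.comp_apply, TensorProduct.map_tmul, LinearMap.mul'_apply, bosonCounit_elt]
  rw [B.bosonMul_elt hX hY, LinearMap.map_smul_of_tower, bosonCounit_elt, B.counit_mul,
    B.counit_act]
  by_cases hx : x = 1
  · by_cases hy : y = 1
    · subst hx hy
      simp [Φ.mulCoeff_one_one]
    · simp [B.counit_eq_zero_of_mem hy hY]
  · simp [B.counit_eq_zero_of_mem hx hX]

theorem bosonComul_unit (g : G) :
    B.bosonComul (elt g (B.unit 1)) = elt g (B.unit 1) ⊗ₜ[k] elt g (B.unit 1) := by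
  rw [bosonComul_elt, B.comul_unit, bosonSplit_tmul D g B.unit_mem_component B.unit_mem_component]
  simp [Φ.one_left]

/-- The braiding of `H` produces `x₂ ▷ (g ▷ Y₁)`. This is `(x₂ g) ▷ Y₁` up to a scalar, exactly the
action of the group part `x₂ g` that the coproduct puts next to `X₁`; only `mulCoeff_comul` then
remains. -/
theorem bosonComul_mul :
    B.bosonComul ∘ₗ B.bosonMul =
      TensorProduct.map B.bosonMul B.bosonMul ∘ₗ
        (TensorProduct.tensorTensorTensorComm k _ _ _ _).toLinearMap ∘ₗ
          TensorProduct.map B.bosonComul B.bosonComul := by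
  refine boson_linearMap_ext₂ D fun x g X hX y h Y hY => ?_
  have hΔ : B.comul (B.mul (X ⊗ₜ[k] D.act g Y)) =
      braidedTensorMul D B.mul (B.comul X ⊗ₜ[k] (D.tensor D).act g (B.comul Y)) := by
    rw [← B.comul_isHom.map_act]
    exact LinearMap.congr_fun B.comul_mul _
  simp only [LinearMap.comp_apply, TensorProduct.map_tmul, bosonComul_elt,
    B.bosonMul_elt hX hY, LinearMap.map_smul_of_tower, hΔ]
  have hs := B.comul_mem_component hX
  have ht := B.comul_mem_component hY
  generalize B.comul X = s at hs
  generalize B.comul Y = t at ht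
  refine YDModule.tensor_component_induction D D hs (by simp) (fun s t hs ht => ?_)
    fun x₁ x₂ hx X₁ hX₁ X₂ hX₂ => ?_
  · simp only [map_add, TensorProduct.add_tmul, smul_add, hs, ht]
  refine YDModule.tensor_component_induction D D ht (by simp) (fun s t hs ht => ?_)
    fun y₁ y₂ hy Y₁ hY₁ Y₂ hY₂ => ?_
  · simp only [map_add, TensorProduct.tmul_add, smul_add, hs, ht]
  subst hx hy
  have hg₁ := D.act_mem hY₁ g
  have hg₂ := D.act_mem hY₂ g
  simp only [YDModule.tensor_act_tmul D D hY₁ hY₂, TensorProduct.tmul_smul,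
    braidedTensorMul_tmul D B.mul hX₁ hX₂ hg₁ hg₂,
    D.act_act_of_mem hY₁,
    bosonSplit_tmul D _ (B.mul_mem_component hX₁ (D.act_mem hY₁ (x₂ * g)))
      (B.mul_mem_component hX₂ hg₂), bosonSplit_tmul D _ hX₁ hX₂, bosonSplit_tmul D _ hY₁ hY₂,
    ← TensorProduct.smul_tmul', Units.smul_def, map_smul]
  simp only [LinearEquiv.coe_coe, TensorProduct.tensorTensorTensorComm_tmul, TensorProduct.map_tmul, B.bosonMul_elt hX₁ hY₁,
    B.bosonMul_elt hX₂ hY₂, TensorProduct.tmul_smul, ← TensorProduct.smul_tmul', smul_smul,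
    Units.smul_def, ← Units.val_mul]
  have e : x₂ * y₂ * (g * h) = x₂ * g * (y₂ * h) := by ac_rfl
  rw [e]
  congr 2
  have := Φ.mulCoeff_comul x₁ x₂ y₁ y₂ g h
  simp only [_root_.mul_assoc, mul_comm, mul_left_comm] at this ⊢
  exact this

/-- Both sides are multiples of `X((g ▷ Y)((g * h) ▷ Z)) ⊗ ghe`, after letting `g` act on a product,
merging two actions on `Z` and reassociating in `H`. -/
theorem bosonMul_quasi_assoc {x y z : G} {X Y Z : H} (hX : X ∈ D.component x)
    (hY : Y ∈ D.component y) (hZ : Z ∈ D.component z) (g h e : G) :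
    Φ g h e • B.bosonMul (elt g X ⊗ₜ[k] B.bosonMul (elt h Y ⊗ₜ[k] elt e Z)) =
      Φ (x * g) (y * h) (z * e) •
        B.bosonMul (B.bosonMul (elt g X ⊗ₜ[k] elt h Y) ⊗ₜ[k] elt e Z) := by
  have hgY := D.act_mem hY g
  have hhZ := D.act_mem hZ h
  simp only [B.bosonMul_elt hY hZ, B.bosonMul_elt hX hY, TensorProduct.tmul_smul,
    ← TensorProduct.smul_tmul', LinearMap.map_smul_of_tower, B.bosonMul_elt hX
    (B.mul_mem_component hY hhZ), B.bosonMul_elt (B.mul_mem_component hX hgY) hZ,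
    B.act_mul hY hhZ, D.act_act_of_mem hZ, B.mul_assoc_of_mem hX hgY (D.act_mem hZ (g * h)),
    smul_smul, _root_.mul_assoc g h e]
  congr 1
  have := Φ.mulCoeff_assoc x g y h z e
  simp only [_root_.mul_assoc] at this ⊢
  exact this

end BraidedHopfAlgebra
end BosonMul

/-! ### Convolution with functionals that are diagonal for a finite family of idempotents. -/

section Convolution

variable {k : Type u} [Field k]
variable {C C' N N' : Type*} [AddCommGroup C] [Module k C] [Coalgebra k C]
  [AddCommGroup C'] [Module k C'] [Coalgebra k C']
  [AddCommGroup N] [Module k N] [AddCommGroup N'] [Module k N']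

theorem convLeft_comp (φ : C →ₗ[k] k) (f : C →ₗ[k] N) (h : N →ₗ[k] N') :
    convLeft φ (h ∘ₗ f) = h ∘ₗ convLeft φ f := by
  ext c
  simp only [convLeft, LinearMap.comp_apply]
  induction CoalgebraStruct.comul (R := k) c with
  | zero => simp
  | add s t hs ht => simp only [map_add, hs, ht]
  | tmul a b => simp

theorem convRight_comp (φ : C →ₗ[k] k) (f : C →ₗ[k] N) (h : N →ₗ[k] N') :
    convRight (h ∘ₗ f) φ = h ∘ₗ convRight f φ := by
  ext c
  simp only [convRight, LinearMap.comp_apply]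
  induction CoalgebraStruct.comul (R := k) c with
  | zero => simp
  | add s t hs ht => simp only [map_add, hs, ht]
  | tmul a b => simp

theorem convLeft_eq_comp_id (φ : C →ₗ[k] k) (f : C →ₗ[k] N) :
    convLeft φ f = f ∘ₗ convLeft φ LinearMap.id := convLeft_comp φ LinearMap.id f

theorem convRight_eq_comp_id (φ : C →ₗ[k] k) (f : C →ₗ[k] N) :
    convRight f φ = f ∘ₗ convRight LinearMap.id φ := convRight_comp φ LinearMap.id f

/-- `convLeft` as a bilinear map. -/
noncomputable def convLeftBilin : (C →ₗ[k] k) →ₗ[k] (C →ₗ[k] N) →ₗ[k] (C →ₗ[k] N) :=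
  LinearMap.mk₂ k convLeft
    (fun _ _ _ => by simp only [convLeft, TensorProduct.map_add_left, LinearMap.comp_add,
      LinearMap.add_comp])
    (fun _ _ _ => by simp only [convLeft, TensorProduct.map_smul_left, LinearMap.comp_smul,
      LinearMap.smul_comp])
    (fun _ _ _ => by simp only [convLeft, TensorProduct.map_add_right, LinearMap.comp_add,
      LinearMap.add_comp])
    (fun _ _ _ => by simp only [convLeft, TensorProduct.map_smul_right, LinearMap.comp_smul,
      LinearMap.smul_comp])

/-- `convRight` as a bilinear map. -/
noncomputable def convRightBilin : (C →ₗ[k] N) →ₗ[k] (C →ₗ[k] k) →ₗ[k] (C →ₗ[k] N) :=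
  LinearMap.mk₂ k convRight
    (fun _ _ _ => by simp only [convRight, TensorProduct.map_add_left, LinearMap.comp_add,
      LinearMap.add_comp])
    (fun _ _ _ => by simp only [convRight, TensorProduct.map_smul_left, LinearMap.comp_smul,
      LinearMap.smul_comp])
    (fun _ _ _ => by simp only [convRight, TensorProduct.map_add_right, LinearMap.comp_add,
      LinearMap.add_comp])
    (fun _ _ _ => by simp only [convRight, TensorProduct.map_smul_right, LinearMap.comp_smul,
      LinearMap.smul_comp])

theorem convLeft_sum_smul {I : Type*} (s : Finset I) (F : I → k) (δ : I → C →ₗ[k] k)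
    (f : C →ₗ[k] N) : convLeft (∑ i ∈ s, F i • δ i) f = ∑ i ∈ s, F i • convLeft (δ i) f := by
  have := map_sum (convLeftBilin.flip f) (fun i => F i • δ i) s
  simp only [map_smul] at this
  exact this

theorem convLeft_sum_smul_right {I : Type*} (s : Finset I) (F : I → k) (δ : I → C →ₗ[k] N)
    (φ : C →ₗ[k] k) : convLeft φ (∑ i ∈ s, F i • δ i) = ∑ i ∈ s, F i • convLeft φ (δ i) := by
  have := map_sum (convLeftBilin φ) (fun i => F i • δ i) s
  simp only [map_smul] at this
  exact this

theorem convRight_sum_smul {I : Type*} (s : Finset I) (F : I → k) (δ : I → C →ₗ[k] k)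
    (f : C →ₗ[k] N) : convRight f (∑ i ∈ s, F i • δ i) = ∑ i ∈ s, F i • convRight f (δ i) := by
  have := map_sum (convRightBilin f) (fun i => F i • δ i) s
  simp only [map_smul] at this
  exact this

/-- The functional `c ⊗ d ↦ φ(c) ψ(d)`. -/
noncomputable def tensorFunctional (φ : N →ₗ[k] k) (ψ : N' →ₗ[k] k) : N ⊗[k] N' →ₗ[k] k :=
  (TensorProduct.lid k k).toLinearMap ∘ₗ TensorProduct.map φ ψ

@[simp]
theorem tensorFunctional_tmul (φ : N →ₗ[k] k) (ψ : N' →ₗ[k] k) (c : N) (d : N') :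
    tensorFunctional φ ψ (c ⊗ₜ[k] d) = φ c * ψ d := by
  simp [tensorFunctional]

theorem convLeft_tensor (φ : C →ₗ[k] k) (ψ : C' →ₗ[k] k) (f : C →ₗ[k] N) (g : C' →ₗ[k] N') :
    convLeft (tensorFunctional φ ψ) (TensorProduct.map f g) =
      TensorProduct.map (convLeft φ f) (convLeft ψ g) := by
  refine TensorProduct.ext' fun c d => ?_
  simp only [convLeft, LinearMap.comp_apply, TensorProduct.map_tmul, LinearEquiv.coe_coe]
  -- The coproduct of a tensor product of coalgebras is the product of the two coproducts followed
  -- by the interchange of the middle factors.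
  change TensorProduct.lid k _ (TensorProduct.map _ _
    (TensorProduct.tensorTensorTensorComm k C C C' C'
      (CoalgebraStruct.comul c ⊗ₜ[k] CoalgebraStruct.comul d))) = _
  induction CoalgebraStruct.comul (R := k) c with
  | zero => simp
  | add s t hs ht => simp only [TensorProduct.add_tmul, map_add, hs, ht]
  | tmul a b =>
    induction CoalgebraStruct.comul (R := k) d with
    | zero => simp
    | add s t hs ht => simp only [TensorProduct.tmul_add, map_add, hs, ht]
    | tmul a' b' => simp [← TensorProduct.smul_tmul', smul_smul, mul_comm]

theorem convRight_tensor (φ : C →ₗ[k] k) (ψ : C' →ₗ[k] k) (f : C →ₗ[k] N) (g : C' →ₗ[k] N') :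
    convRight (TensorProduct.map f g) (tensorFunctional φ ψ) =
      TensorProduct.map (convRight f φ) (convRight g ψ) := by
  refine TensorProduct.ext' fun c d => ?_
  simp only [convRight, LinearMap.comp_apply, TensorProduct.map_tmul, LinearEquiv.coe_coe]
  change TensorProduct.rid k _ (TensorProduct.map _ _
    (TensorProduct.tensorTensorTensorComm k C C C' C'
      (CoalgebraStruct.comul c ⊗ₜ[k] CoalgebraStruct.comul d))) = _
  induction CoalgebraStruct.comul (R := k) c with
  | zero => simp
  | add s t hs ht => simp only [TensorProduct.add_tmul, map_add, hs, ht]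
  | tmul a b =>
    induction CoalgebraStruct.comul (R := k) d with
    | zero => simp
    | add s t hs ht => simp only [TensorProduct.tmul_add, map_add, hs, ht]
    | tmul a' b' => simp [← TensorProduct.smul_tmul', smul_smul, mul_comm]

variable {I J : Type*} [Fintype I] [DecidableEq I] [Fintype J] [DecidableEq J]

/-- The functional `∑ F(i) δᵢ`. -/
noncomputable def weighted (δ : I → N →ₗ[k] k) (F : I → k) : N →ₗ[k] k := ∑ i, F i • δ i

/-- The family `δᵢ ⊗ δ'ⱼ` of functionals on a tensor product. -/
noncomputable def tensorFamily (δ : I → N →ₗ[k] k) (δ' : J → N' →ₗ[k] k) (p : I × J) :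
    N ⊗[k] N' →ₗ[k] k := tensorFunctional (δ p.1) (δ' p.2)

/-- The element `c` has left degree `i`: `δⱼ(c₁) c₂ = [j = i] c`. -/
def IsLeftDegree (δ : I → C →ₗ[k] k) (i : I) (c : C) : Prop :=
  ∀ j, convLeft (δ j) LinearMap.id c = if j = i then c else 0

/-- The element `c` has right degree `i`: `c₁ δⱼ(c₂) = [j = i] c`. -/
def IsRightDegree (δ : I → C →ₗ[k] k) (i : I) (c : C) : Prop :=
  ∀ j, convRight LinearMap.id (δ j) c = if j = i then c else 0

omit [Fintype I] [Fintype J] in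
theorem IsLeftDegree.tmul {δ : I → C →ₗ[k] k} {δ' : J → C' →ₗ[k] k} {i : I} {j : J} {c : C}
    {d : C'} (hc : IsLeftDegree δ i c) (hd : IsLeftDegree δ' j d) :
    IsLeftDegree (tensorFamily δ δ') (i, j) (c ⊗ₜ[k] d) := by
  intro p
  rw [← TensorProduct.map_id, tensorFamily, convLeft_tensor, TensorProduct.map_tmul, hc, hd]
  by_cases h1 : p.1 = i <;> by_cases h2 : p.2 = j <;> simp [h1, h2, Prod.ext_iff]

omit [Fintype I] [Fintype J] in
theorem IsRightDegree.tmul {δ : I → C →ₗ[k] k} {δ' : J → C' →ₗ[k] k} {i : I} {j : J} {c : C}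
    {d : C'} (hc : IsRightDegree δ i c) (hd : IsRightDegree δ' j d) :
    IsRightDegree (tensorFamily δ δ') (i, j) (c ⊗ₜ[k] d) := by
  intro p
  rw [← TensorProduct.map_id, tensorFamily, convRight_tensor, TensorProduct.map_tmul, hc, hd]
  by_cases h1 : p.1 = i <;> by_cases h2 : p.2 = j <;> simp [h1, h2, Prod.ext_iff]

omit [Fintype I] in
theorem IsLeftDegree.convLeft_apply {δ : I → C →ₗ[k] k} {i : I} {c : C} (hc : IsLeftDegree δ i c)
    (j : I) (f : C →ₗ[k] N) : convLeft (δ j) f c = if j = i then f c else 0 := by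
  rw [convLeft_eq_comp_id, LinearMap.comp_apply, hc j, apply_ite f, map_zero]

/-- Only `δ i` survives on an element of left degree `i`, so convolving with a weighted functional
is multiplication by a scalar. -/
theorem IsLeftDegree.convLeft_weighted {δ : I → C →ₗ[k] k} {i : I} {c : C}
    (hc : IsLeftDegree δ i c) (F : I → k) (f : C →ₗ[k] N) :
    convLeft (weighted δ F) f c = F i • f c := by
  rw [weighted, convLeft_sum_smul, LinearMap.sum_apply]
  simp [hc.convLeft_apply]

theorem IsRightDegree.convRight_weighted {δ : I → C →ₗ[k] k} {i : I} {c : C}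
    (hc : IsRightDegree δ i c) (F : I → k) (f : C →ₗ[k] N) :
    convRight f (weighted δ F) c = F i • f c := by
  rw [weighted, convRight_sum_smul, LinearMap.sum_apply]
  simp only [LinearMap.smul_apply]
  simp [convRight_eq_comp_id _ f, hc _, apply_ite f]

/-- The `δᵢ` are orthogonal idempotents for the convolution product with sum the counit. -/
structure IsCompleteOrthogonal (δ : I → C →ₗ[k] k) : Prop where
  conv : ∀ i j, convLeft (δ i) (δ j) = if i = j then δ j else 0
  sum_eq : ∑ i, δ i = CoalgebraStruct.counit

theorem IsCompleteOrthogonal.tensor {δ : I → C →ₗ[k] k} {δ' : J → C' →ₗ[k] k}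
    (h : IsCompleteOrthogonal δ) (h' : IsCompleteOrthogonal δ') :
    IsCompleteOrthogonal (tensorFamily δ δ') where
  conv p q := by
    rw [tensorFamily, tensorFamily, tensorFunctional.eq_def (δ q.1), convLeft_comp,
      convLeft_tensor, h.conv, h'.conv]
    by_cases h1 : p.1 = q.1 <;> by_cases h2 : p.2 = q.2 <;>
      simp [h1, h2, Prod.ext_iff]
  sum_eq := by
    refine TensorProduct.ext' fun c d => ?_
    rw [TensorProduct.counit_tmul, ← h.sum_eq, ← h'.sum_eq]
    simp only [LinearMap.sum_apply, tensorFamily, tensorFunctional_tmul, smul_eq_mul,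
      Fintype.sum_prod_type, Finset.sum_mul_sum]
    rw [Finset.sum_comm]
    exact Finset.sum_congr rfl fun _ _ => Finset.sum_congr rfl fun _ _ => mul_comm _ _

/-- This turns convolution identities between weighted functionals into pointwise identities of
functions on `I`. -/
theorem IsCompleteOrthogonal.conv_weighted {δ : I → C →ₗ[k] k} (h : IsCompleteOrthogonal δ)
    (F F' : I → k) :
    convLeft (weighted δ F) (weighted δ F') = weighted δ fun i => F i * F' i := by
  rw [weighted, convLeft_sum_smul, weighted]
  simp only [weighted, convLeft_sum_smul_right, h.conv, smul_ite, smul_zero, Finset.sum_ite_eq,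
    Finset.mem_univ, if_true, smul_smul]

theorem IsCompleteOrthogonal.weighted_one {δ : I → C →ₗ[k] k} (h : IsCompleteOrthogonal δ) :
    (weighted δ fun _ => 1) = CoalgebraStruct.counit := by
  simp [weighted, h.sum_eq]

omit [DecidableEq I] in
theorem weighted_apply (δ : I → N →ₗ[k] k) (F : I → k) (c : N) :
    weighted δ F c = ∑ i, F i * δ i c := by
  simp [weighted, LinearMap.sum_apply]

end Convolution

section Points

variable {k : Type u} [Field k] {N N' : Type*} [AddCommGroup N] [Module k N] [AddCommGroup N']
  [Module k N'] {I J : Type*} [Fintype I] [DecidableEq I] [Fintype J] [DecidableEq J]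

/-- The functionals `δⱼ` take the value `r` on `c` for `j = i` and vanish on `c` otherwise. -/
def IsPoint (δ : I → N →ₗ[k] k) (i : I) (r : k) (c : N) : Prop :=
  ∀ j, δ j c = if j = i then r else 0

omit [Fintype I] [Fintype J] in
theorem IsPoint.tmul {δ : I → N →ₗ[k] k} {δ' : J → N' →ₗ[k] k} {i : I} {j : J} {r s : k} {c : N}
    {d : N'} (hc : IsPoint δ i r c) (hd : IsPoint δ' j s d) :
    IsPoint (tensorFamily δ δ') (i, j) (r * s) (c ⊗ₜ[k] d) := by
  intro p
  rw [tensorFamily, tensorFunctional_tmul, hc, hd]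
  by_cases h1 : p.1 = i <;> by_cases h2 : p.2 = j <;> simp [h1, h2, Prod.ext_iff]

theorem IsPoint.weighted_eq {δ : I → N →ₗ[k] k} {i : I} {r : k} {c : N} (hc : IsPoint δ i r c)
    (F : I → k) : weighted δ F c = F i * r := by
  simp [weighted_apply, hc _]

end Points

/-! ### The associator of `H # kG`. -/

section Associator

variable {k : Type u} {G : Type v} [Field k] [CommGroup G] [Fintype G] [DecidableEq G]
variable {H : Type w} [AddCommGroup H] [Module k H]
variable {Φ : NormalizedThreeCocycle k G} {D : YDModule Φ H}

namespace BraidedHopfAlgebra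

variable (B : BraidedHopfAlgebra D)

/-- The functional `X ⊗ h ↦ ε(X) δ_g(h)`. -/
noncomputable def bosonDelta (g : G) : H ⊗[k] MonoidAlgebra k G →ₗ[k] k := B.counit ∘ₗ eltCoeff g

theorem isPoint_elt (g : G) (X : H) : IsPoint B.bosonDelta g (B.counit X) (elt g X) := by
  intro j
  simp [bosonDelta, eltCoeff_elt, apply_ite B.counit, eq_comm]

theorem isPoint_mul {x y : G} {X Y : H} (hX : X ∈ D.component x) (hY : Y ∈ D.component y)
    (g h : G) :
    IsPoint B.bosonDelta (g * h) (B.counit X * B.counit Y)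
      (B.bosonMul (elt g X ⊗ₜ[k] elt h Y)) := by
  intro j
  rw [B.bosonMul_elt hX hY, LinearMap.map_smul_of_tower, B.isPoint_elt, B.counit_mul, B.counit_act]
  by_cases hx : x = 1
  · by_cases hy : y = 1
    · subst hx hy
      simp [Φ.mulCoeff_one_one]
    · simp [B.counit_eq_zero_of_mem hy hY]
  · simp [B.counit_eq_zero_of_mem hx hX]

/-- Left and right degrees differ only when `x ≠ 1`, and then `ε(X) = 0`. So the functionals `δ_j`
cannot distinguish them. -/
theorem isPoint_elt_left {x : G} {X : H} (hX : X ∈ D.component x) (g : G) :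
    IsPoint B.bosonDelta (x * g) (B.counit X) (elt g X) := by
  by_cases hx : x = 1
  · simpa [hx] using B.isPoint_elt g X
  · have := B.isPoint_elt g X
    simpa [B.counit_eq_zero_of_mem hx hX, IsPoint] using this

/-- The family `δ_g ⊗ δ_h ⊗ δ_e`. -/
noncomputable abbrev bosonDelta₃ := tensorFamily B.bosonDelta (tensorFamily B.bosonDelta B.bosonDelta)

/-- The extension of a function `G³ → k` to a functional on `(H ⊗ kG)^{⊗ 3}`. -/
noncomputable def extend₃ (F : G → G → G → k) :=
  weighted B.bosonDelta₃ fun p => F p.1 p.2.1 p.2.2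

theorem extend₃_elt (F : G → G → G → k) (g h e : G) (X Y Z : H) :
    B.extend₃ F (elt g X ⊗ₜ[k] (elt h Y ⊗ₜ[k] elt e Z)) =
      F g h e * (B.counit X * (B.counit Y * B.counit Z)) :=
  ((B.isPoint_elt g X).tmul ((B.isPoint_elt h Y).tmul (B.isPoint_elt e Z))).weighted_eq _

/-- The family `δ_g ⊗ δ_h ⊗ δ_e ⊗ δ_f`. -/
noncomputable abbrev bosonDelta₄ := tensorFamily B.bosonDelta B.bosonDelta₃

variable [Coalgebra k (H ⊗[k] MonoidAlgebra k G)]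

/-- The first leg of the coproduct is `X₁ ⊗ x₂ g`. Applying `ε` to `X₁` leaves only the terms with
`x₁ = 1`, hence `x₂ = x`. -/
theorem isLeftDegree_elt (hΔ : CoalgebraStruct.comul = B.bosonComul) {x : G} {X : H}
    (hX : X ∈ D.component x) (g : G) :
    IsLeftDegree B.bosonDelta (x * g) (elt g X) := by
  intro j
  have key : ∀ t ∈ (D.tensor D).component x,
      TensorProduct.lid k _ (TensorProduct.map (B.bosonDelta j) LinearMap.id (bosonSplit D g t)) =
        if j = x * g then elt g (TensorProduct.lid k H (B.counit.rTensor H t)) else 0 := by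
    intro t ht
    refine YDModule.tensor_component_induction D D ht (by simp) (fun s t hs ht => ?_)
      fun a b hab Y hY Z hZ => ?_
    · rw [map_add, map_add, map_add, hs, ht]
      split_ifs <;> simp
    · simp only [bosonSplit_tmul D g hY hZ, TensorProduct.map_tmul,
        B.isPoint_elt _ _ j, LinearMap.rTensor_tmul, TensorProduct.lid_tmul, Units.smul_def,
        map_smul, LinearMap.id_apply]
      by_cases ha : a = 1
      · subst ha hab
        simp [Φ.one_left]
      · simp [B.counit_eq_zero_of_mem ha hY]
  have := LinearMap.congr_fun B.counit_comul X
  simp only [LinearMap.comp_apply] at this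
  simp only [convLeft, LinearMap.comp_apply, hΔ, bosonComul_elt, LinearEquiv.coe_coe]
  rw [key _ (B.comul_mem_component hX), this]
  simp

/-- The second leg of the coproduct always carries the group part `g`. -/
theorem isRightDegree_elt (hΔ : CoalgebraStruct.comul = B.bosonComul) (g : G) (X : H) :
    IsRightDegree B.bosonDelta g (elt g X) := by
  intro j
  have key : ∀ t : H ⊗[k] H,
      TensorProduct.rid k _ (TensorProduct.map LinearMap.id (B.bosonDelta j) (bosonSplit D g t)) =
        if j = g then elt g (TensorProduct.rid k H (B.counit.lTensor H t)) else 0 := by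
    intro t
    refine YDModule.tensor_induction D D t (by simp) (fun s t hs ht => ?_)
      fun a b Y hY Z hZ => ?_
    · rw [map_add, map_add, map_add, hs, ht]
      split_ifs <;> simp
    · simp only [bosonSplit_tmul D g hY hZ, TensorProduct.map_tmul,
        B.isPoint_elt _ _ j, LinearMap.lTensor_tmul, TensorProduct.rid_tmul, Units.smul_def,
        map_smul, LinearMap.id_apply]
      by_cases hb : b = 1
      · subst hb
        simp [Φ.normalized]
      · simp [B.counit_eq_zero_of_mem hb hZ]
  have := LinearMap.congr_fun B.comul_counit X
  simp only [LinearMap.comp_apply] at this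
  simp only [convRight, LinearMap.comp_apply, hΔ, bosonComul_elt, LinearEquiv.coe_coe]
  rw [key, this]
  simp

theorem isCompleteOrthogonal (hΔ : CoalgebraStruct.comul = B.bosonComul)
    (hε : CoalgebraStruct.counit = B.bosonCounit) : IsCompleteOrthogonal B.bosonDelta where
  conv i j := by
    refine boson_linearMap_ext D fun x g X hX => ?_
    rw [(B.isLeftDegree_elt hΔ hX g).convLeft_apply, B.isPoint_elt_left hX]
    by_cases hij : i = j
    · subst hij
      simp +contextual [B.isPoint_elt_left hX g i]
    · by_cases hj : j = x * g <;> simp_all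
  sum_eq := by
    rw [hε]
    refine elt_linearMap_ext fun g X => ?_
    simp [LinearMap.sum_apply, B.isPoint_elt g X _, bosonCounit_elt]

theorem extend₃_mul_inv (hΔ : CoalgebraStruct.comul = B.bosonComul)
    (hε : CoalgebraStruct.counit = B.bosonCounit) (F F' : G → G → G → k)
    (hF : ∀ g h e, F g h e * F' g h e = 1) :
    convLeft (B.extend₃ F) (B.extend₃ F') = CoalgebraStruct.counit := by
  have h := B.isCompleteOrthogonal hΔ hε
  have h₃ := h.tensor (h.tensor h)
  rw [extend₃, extend₃, h₃.conv_weighted, ← h₃.weighted_one]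
  simp only [hF]

theorem extend₃_quasi_assoc (hΔ : CoalgebraStruct.comul = B.bosonComul) :
    convRight (B.bosonMul ∘ₗ B.bosonMul.lTensor _) (B.extend₃ fun g h e => Φ g h e) =
      convLeft (B.extend₃ fun g h e => Φ g h e)
        (B.bosonMul ∘ₗ B.bosonMul.rTensor _ ∘ₗ (TensorProduct.assoc k _ _ _).symm.toLinearMap) := by
  refine boson_linearMap_ext₃ D fun x g X hX y h Y hY z e Z hZ => ?_
  rw [extend₃, ((B.isLeftDegree_elt hΔ hX g).tmul ((B.isLeftDegree_elt hΔ hY h).tmul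
    (B.isLeftDegree_elt hΔ hZ e))).convLeft_weighted,
    ((B.isRightDegree_elt hΔ g X).tmul ((B.isRightDegree_elt hΔ h Y).tmul
    (B.isRightDegree_elt hΔ e Z))).convRight_weighted]
  simpa [Units.smul_def] using B.bosonMul_quasi_assoc hX hY hZ g h e

local notation "𝓜" => H ⊗[k] MonoidAlgebra k G

/-- All five functionals are weighted with respect to `bosonDelta₄`, because a product of elements
over `g` and `h` lies over `g * h`. Their convolutions are pointwise products, and what remains is
the cocycle condition in `G`. -/
theorem extend₃_cocycle (hΔ : CoalgebraStruct.comul = B.bosonComul)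
    (hε : CoalgebraStruct.counit = B.bosonCounit)
    {A : 𝓜 ⊗[k] (𝓜 ⊗[k] 𝓜) →ₗ[k] k} (hA : A = B.extend₃ fun g h e => Φ g h e) :
    convLeft (A ∘ₗ (B.bosonMul.lTensor 𝓜).lTensor 𝓜)
        (A ∘ₗ B.bosonMul.rTensor (𝓜 ⊗[k] 𝓜) ∘ₗ
          (TensorProduct.assoc k 𝓜 𝓜 (𝓜 ⊗[k] 𝓜)).symm.toLinearMap) =
      convLeft
        ((TensorProduct.lid k k).toLinearMap ∘ₗ TensorProduct.map CoalgebraStruct.counit A)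
        (convLeft
          (A ∘ₗ
            (B.bosonMul.rTensor 𝓜 ∘ₗ (TensorProduct.assoc k 𝓜 𝓜 𝓜).symm.toLinearMap).lTensor 𝓜)
          ((TensorProduct.rid k k).toLinearMap ∘ₗ TensorProduct.map A CoalgebraStruct.counit ∘ₗ
            (TensorProduct.assoc k 𝓜 (𝓜 ⊗[k] 𝓜) 𝓜).symm.toLinearMap ∘ₗ
            (TensorProduct.assoc k 𝓜 𝓜 𝓜).symm.toLinearMap.lTensor 𝓜)) := by
  have hp := fun (g h e d : G) (X Y Z W : H) (F : G × G × G × G → k) =>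
    ((B.isPoint_elt g X).tmul ((B.isPoint_elt h Y).tmul
      ((B.isPoint_elt e Z).tmul (B.isPoint_elt d W)))).weighted_eq F
  have h₁ : A ∘ₗ (B.bosonMul.lTensor 𝓜).lTensor 𝓜 =
      weighted B.bosonDelta₄ fun p => Φ p.1 p.2.1 (p.2.2.1 * p.2.2.2) := by
    refine boson_linearMap_ext₄ D fun x g X hX y h Y hY z e Z hZ w d W hW => ?_
    rw [hp, hA]
    exact ((B.isPoint_elt g X).tmul ((B.isPoint_elt h Y).tmul
      (B.isPoint_mul hZ hW e d))).weighted_eq _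
  have h₂ : A ∘ₗ B.bosonMul.rTensor (𝓜 ⊗[k] 𝓜) ∘ₗ
      (TensorProduct.assoc k 𝓜 𝓜 (𝓜 ⊗[k] 𝓜)).symm.toLinearMap =
      weighted B.bosonDelta₄ fun p => Φ (p.1 * p.2.1) p.2.2.1 p.2.2.2 := by
    refine boson_linearMap_ext₄ D fun x g X hX y h Y hY z e Z hZ w d W hW => ?_
    rw [hp, hA]
    refine (((B.isPoint_mul hX hY g h).tmul ((B.isPoint_elt e Z).tmul
      (B.isPoint_elt d W))).weighted_eq _).trans ?_
    ring
  have h₃ : (TensorProduct.lid k k).toLinearMap ∘ₗ TensorProduct.map CoalgebraStruct.counit A =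
      weighted B.bosonDelta₄ fun p => Φ p.2.1 p.2.2.1 p.2.2.2 := by
    refine boson_linearMap_ext₄ D fun x g X hX y h Y hY z e Z hZ w d W hW => ?_
    rw [hp, hε, hA]
    simp only [LinearMap.comp_apply, TensorProduct.map_tmul, extend₃_elt, bosonCounit_elt,
      LinearEquiv.coe_coe, TensorProduct.lid_tmul, smul_eq_mul]
    ring
  have h₄ : A ∘ₗ (B.bosonMul.rTensor 𝓜 ∘ₗ
      (TensorProduct.assoc k 𝓜 𝓜 𝓜).symm.toLinearMap).lTensor 𝓜 =
      weighted B.bosonDelta₄ fun p => Φ p.1 (p.2.1 * p.2.2.1) p.2.2.2 := by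
    refine boson_linearMap_ext₄ D fun x g X hX y h Y hY z e Z hZ w d W hW => ?_
    rw [hp, hA]
    refine (((B.isPoint_elt g X).tmul ((B.isPoint_mul hY hZ h e).tmul
      (B.isPoint_elt d W))).weighted_eq _).trans ?_
    ring
  have h₅ : (TensorProduct.rid k k).toLinearMap ∘ₗ TensorProduct.map A CoalgebraStruct.counit ∘ₗ
      (TensorProduct.assoc k 𝓜 (𝓜 ⊗[k] 𝓜) 𝓜).symm.toLinearMap ∘ₗ
        (TensorProduct.assoc k 𝓜 𝓜 𝓜).symm.toLinearMap.lTensor 𝓜 =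
      weighted B.bosonDelta₄ fun p => Φ p.1 p.2.1 p.2.2.1 := by
    refine boson_linearMap_ext₄ D fun x g X hX y h Y hY z e Z hZ w d W hW => ?_
    rw [hp, hε, hA]
    simp only [LinearMap.comp_apply, LinearMap.lTensor_tmul, LinearEquiv.coe_coe,
      TensorProduct.assoc_symm_tmul, TensorProduct.map_tmul, extend₃_elt, bosonCounit_elt,
      TensorProduct.rid_tmul, smul_eq_mul]
    ring
  have h := B.isCompleteOrthogonal hΔ hε
  have h₆ := h.tensor (h.tensor (h.tensor h))
  rw [h₁, h₂, h₃, h₄, h₅, h₆.conv_weighted, h₆.conv_weighted, h₆.conv_weighted]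
  congr 1
  funext p
  have := congrArg Units.val (Φ.cocycle p.1 p.2.1 p.2.2.1 p.2.2.2)
  simp only [Units.val_mul] at this
  linear_combination this

theorem extend₃_one (hε : CoalgebraStruct.counit = B.bosonCounit)
    (a b : H ⊗[k] MonoidAlgebra k G) :
    B.extend₃ (fun g h e => Φ g h e) (a ⊗ₜ[k] (elt 1 (B.unit 1) ⊗ₜ[k] b)) =
      CoalgebraStruct.counit a * CoalgebraStruct.counit b := by
  rw [hε]
  have := boson_linearMap_ext₂ D
    (f := B.extend₃ (fun g h e => Φ g h e) ∘ₗ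
      (TensorProduct.mk k _ _ (elt 1 (B.unit 1))).lTensor (H ⊗[k] MonoidAlgebra k G))
    (f' := tensorFunctional B.bosonCounit B.bosonCounit) fun x g X hX y h Y hY => by
      simp [extend₃_elt, bosonCounit_elt, Φ.normalized, B.counit_unit]
  simpa using LinearMap.congr_fun this (a ⊗ₜ[k] b)

end BraidedHopfAlgebra
end Associator

/-! ### The quasi-antipode: scalar identities and antipode axioms. -/

section

variable {k : Type u} [Field k]
variable {C N N' : Type*} [AddCommGroup C] [Module k C] [Coalgebra k C]
  [AddCommGroup N] [Module k N] [AddCommGroup N'] [Module k N']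

theorem tensorFunctional_map_comul (φ : N →ₗ[k] k) (ψ : N' →ₗ[k] k) (f : C →ₗ[k] N)
    (q : C →ₗ[k] N') (c : C) :
    tensorFunctional φ ψ (TensorProduct.map f q (CoalgebraStruct.comul c)) =
      convLeft (φ ∘ₗ f) (ψ ∘ₗ q) c := by
  simp only [tensorFunctional, convLeft, LinearMap.comp_apply, TensorProduct.map_comp]

theorem convLeft_counit (f : C →ₗ[k] N) : convLeft CoalgebraStruct.counit f = f := by
  rw [convLeft_eq_comp_id]
  ext c
  have := Coalgebra.rTensor_counit_comul (R := k) c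
  simp only [LinearMap.comp_apply, convLeft]
  rw [show TensorProduct.map (CoalgebraStruct.counit (R := k)) LinearMap.id
    (CoalgebraStruct.comul c) = 1 ⊗ₜ[k] c from this]
  simp

end

section Antipode

variable {k : Type u} {G : Type v} [Field k] [CommGroup G] [Fintype G] [DecidableEq G]
variable {H : Type w} [AddCommGroup H] [Module k H]
variable {Φ : NormalizedThreeCocycle k G} {D : YDModule Φ H}

namespace BraidedHopfAlgebra

variable (B : BraidedHopfAlgebra D)

/-- Apply the multiplicative counit to `S(X₁) X₂ = ε(X) 1` and absorb `ε(X₂)` into the coproduct. -/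
theorem counit_antipode (X : H) : B.counit (B.antipode X) = B.counit X := by
  have h : ∀ t : H ⊗[k] H, B.counit (B.mul (B.antipode.rTensor H t)) =
      B.counit (B.antipode (TensorProduct.rid k H (B.counit.lTensor H t))) := by
    intro t
    induction t with
    | zero => simp
    | add s t hs ht => simp only [map_add, hs, ht]
    | tmul a b => simp [B.counit_mul, mul_comm]
  have h₁ := LinearMap.congr_fun B.antipode_mul X
  have h₂ := LinearMap.congr_fun B.comul_counit X
  simp only [LinearMap.comp_apply] at h₁ h₂
  have h₃ := h (B.comul X)
  rw [h₁, h₂] at h₃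
  have h₄ : B.unit (B.counit X) = B.counit X • B.unit 1 := by rw [← map_smul]; simp
  simpa [h₄, B.counit_unit] using h₃.symm

theorem antipode_mem_component {x : G} {X : H} (hX : X ∈ D.component x) :
    B.antipode X ∈ D.component x := B.antipode_isHom.map_mem hX

/-- The antipode of `H ⊗ kG`. -/
noncomputable def bosonAntipode : H ⊗[k] MonoidAlgebra k G →ₗ[k] H ⊗[k] MonoidAlgebra k G :=
  ofFamily fun g => ∑ x, Φ.antipodeCoeff x g •
    (elt (x * g)⁻¹ ∘ₗ D.act (x * g)⁻¹ ∘ₗ B.antipode ∘ₗ D.proj x)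

theorem bosonAntipode_elt {x : G} {X : H} (hX : X ∈ D.component x) (g : G) :
    B.bosonAntipode (elt g X) =
      Φ.antipodeCoeff x g • elt (x * g)⁻¹ (D.act (x * g)⁻¹ (B.antipode X)) := by
  rw [bosonAntipode, ofFamily_elt]
  simp only [LinearMap.sum_apply, LinearMap.smul_apply, LinearMap.comp_apply]
  rw [Finset.sum_eq_single x]
  · simp [D.proj_eq_of_mem hX]
  all_goals simp +contextual [D.proj_of_mem hX]

theorem bosonAntipode_elt_eq_mul {x : G} {X : H} (hX : X ∈ D.component x) (g : G) :
    B.bosonAntipode (elt g X) = Φ.antipodeCoeff x g •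
      B.bosonMul (elt (x⁻¹ * g⁻¹) (B.unit 1) ⊗ₜ[k] elt 1 (B.antipode X)) := by
  rw [B.bosonAntipode_elt hX, B.bosonMul_elt B.unit_mem_component (B.antipode_mem_component hX),
    Φ.mulCoeff_one_left_one_right, one_smul, B.unit_mul_apply, mul_one, mul_inv]

theorem isPoint_antipode {x : G} {X : H} (hX : X ∈ D.component x) (g : G) :
    IsPoint B.bosonDelta g⁻¹ (B.counit X) (B.bosonAntipode (elt g X)) := by
  intro j
  rw [B.bosonAntipode_elt hX, LinearMap.map_smul_of_tower, B.isPoint_elt, B.counit_act,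
    B.counit_antipode]
  by_cases hx : x = 1
  · subst hx
    simp [Φ.antipodeCoeff_one]
  · simp [B.counit_eq_zero_of_mem hx hX]

/-- This evaluates the associator at antipodes: `S` inverts the group part seen by `δ_g`. -/
theorem bosonDelta_comp_antipode (g : G) :
    B.bosonDelta g ∘ₗ B.bosonAntipode = B.bosonDelta g⁻¹ := by
  refine boson_linearMap_ext D fun x h X hX => ?_
  rw [LinearMap.comp_apply, B.isPoint_antipode hX, B.isPoint_elt]
  simp only [inv_eq_iff_eq_inv]

variable [Coalgebra k (H ⊗[k] MonoidAlgebra k G)]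

omit [Coalgebra k (H ⊗[k] MonoidAlgebra k G)] in
theorem bosonCounit_antipode : B.bosonCounit ∘ₗ B.bosonAntipode = B.bosonCounit := by
  refine boson_linearMap_ext D fun x h X hX => ?_
  rw [LinearMap.comp_apply, B.bosonAntipode_elt hX, LinearMap.map_smul_of_tower, bosonCounit_elt,
    bosonCounit_elt, B.counit_act, B.counit_antipode]
  by_cases hx : x = 1
  · subst hx
    simp [Φ.antipodeCoeff_one]
  · simp [B.counit_eq_zero_of_mem hx hX]

/-- By `antipodeCoeff_left`, the scalar of a term `X₁ ⊗ X₂`, once the `Φ̃` created by acting on a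
product is split off, depends on `x₁ x₂` and `g` only. The sum therefore assembles to `(xg)⁻¹ ▷
(S(X₁) X₂)`, and the antipode axiom of `H` applies; the scalar left over is `1` where `ε(X) ≠ 0`. -/
theorem bosonAntipode_mul (hΔ : CoalgebraStruct.comul = B.bosonComul) :
    B.bosonMul ∘ₗ TensorProduct.map B.bosonAntipode LinearMap.id ∘ₗ CoalgebraStruct.comul =
      B.bosonCounit.smulRight (elt 1 (B.unit 1)) := by
  refine boson_linearMap_ext D fun x g X hX => ?_
  have key : ∀ t ∈ (D.tensor D).component x,
      B.bosonMul (TensorProduct.map B.bosonAntipode LinearMap.id (bosonSplit D g t)) =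
        Φ.mulCoeff 1 (x * g)⁻¹ x g • elt ((x * g)⁻¹ * g)
          (D.act (x * g)⁻¹ (B.mul (B.antipode.rTensor H t))) := by
    intro t ht
    refine YDModule.tensor_component_induction D D ht (by simp) (fun s t hs ht => ?_)
      fun x₁ x₂ hx X₁ h₁ X₂ h₂ => ?_
    · simp only [map_add, smul_add, hs, ht]
    subst hx
    have hS := B.antipode_mem_component h₁
    rw [LinearMap.rTensor_tmul, B.act_mul hS h₂]
    simp only [bosonSplit_tmul D g h₁ h₂, LinearMap.map_smul_of_tower, TensorProduct.map_tmul,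
      B.bosonAntipode_elt h₁, LinearMap.id_apply, ← TensorProduct.smul_tmul',
      B.bosonMul_elt (D.act_mem hS _) h₂, smul_smul]
    have := Φ.antipodeCoeff_left x₁ x₂ g
    simp only [_root_.mul_assoc] at this ⊢
    rw [this]
  have h := LinearMap.congr_fun B.antipode_mul X
  simp only [LinearMap.comp_apply] at h
  have h₄ : B.unit (B.counit X) = B.counit X • B.unit 1 := by rw [← map_smul]; simp
  simp only [LinearMap.comp_apply, hΔ, bosonComul_elt, LinearMap.smulRight_apply, bosonCounit_elt]
  rw [key _ (B.comul_mem_component hX), h, h₄]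
  by_cases hx : x = 1
  · subst hx
    simp [B.act_unit, Φ.mulCoeff_one_one]
  · simp [B.counit_eq_zero_of_mem hx hX]

/-- The functional `β` of the quasi-antipode of `H ⊗ kG`. -/
noncomputable def bosonBeta : H ⊗[k] MonoidAlgebra k G →ₗ[k] k :=
  weighted B.bosonDelta fun g => ((Φ g g⁻¹ g)⁻¹ : kˣ)

omit [Coalgebra k (H ⊗[k] MonoidAlgebra k G)] in
theorem bosonBeta_elt (g : G) (X : H) :
    B.bosonBeta (elt g X) = ((Φ g g⁻¹ g)⁻¹ : kˣ) * B.counit X :=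
  (B.isPoint_elt g X).weighted_eq _

/-- On `X₂ ⊗ g` the functional `β` acts through the left degree `x₂ g`. The action of `x₂ g` in the
product then cancels that of `(x₂ g)⁻¹` in `S`, and `antipodeCoeff_right` makes the remaining scalar
depend on `x₁ x₂` and `g` only. -/
theorem mul_bosonAntipode (hΔ : CoalgebraStruct.comul = B.bosonComul) :
    B.bosonMul ∘ₗ TensorProduct.map LinearMap.id (convLeft B.bosonBeta B.bosonAntipode) ∘ₗ
        CoalgebraStruct.comul =
      B.bosonBeta.smulRight (elt 1 (B.unit 1)) := by
  refine boson_linearMap_ext D fun x g X hX => ?_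
  have key : ∀ t ∈ (D.tensor D).component x,
      B.bosonMul (TensorProduct.map LinearMap.id (convLeft B.bosonBeta B.bosonAntipode)
        (bosonSplit D g t)) =
        ((Φ g g⁻¹ g)⁻¹ * (Φ x g g⁻¹)⁻¹) • elt 1 (B.mul (B.antipode.lTensor H t)) := by
    intro t ht
    refine YDModule.tensor_component_induction D D ht (by simp) (fun s t hs ht => ?_)
      fun x₁ x₂ hx X₁ h₁ X₂ h₂ => ?_
    · simp only [map_add, smul_add, hs, ht]
    subst hx
    have hS := B.antipode_mem_component h₂
    rw [← Φ.antipodeCoeff_right, LinearMap.lTensor_tmul]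
    simp only [bosonSplit_tmul D g h₁ h₂, LinearMap.map_smul_of_tower, TensorProduct.map_tmul,
      LinearMap.id_apply, bosonBeta, (B.isLeftDegree_elt hΔ h₂ g).convLeft_weighted,
      B.bosonAntipode_elt h₂, ← Units.smul_def, TensorProduct.tmul_smul,
      B.bosonMul_elt h₁ (D.act_mem hS _), D.act_act_of_mem hS, smul_smul, mul_inv_cancel,
      D.act_one, _root_.mul_assoc]
  have h := LinearMap.congr_fun B.mul_antipode X
  simp only [LinearMap.comp_apply] at h
  have h₄ : B.unit (B.counit X) = B.counit X • B.unit 1 := by rw [← map_smul]; simp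
  simp only [LinearMap.comp_apply, hΔ, bosonComul_elt, LinearMap.smulRight_apply, bosonBeta_elt]
  rw [key _ (B.comul_mem_component hX), h, h₄]
  by_cases hx : x = 1
  · subst hx
    simp [Φ.one_left, Units.smul_def, smul_smul]
  · simp [B.counit_eq_zero_of_mem hx hX]

omit [Coalgebra k (H ⊗[k] MonoidAlgebra k G)] in
theorem extend₃_eq_sum (F : G → G → G → k) :
    B.extend₃ F = ∑ g, ∑ h, ∑ e, F g h e •
      tensorFunctional (B.bosonDelta g) (tensorFunctional (B.bosonDelta h) (B.bosonDelta e)) := by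
  simp only [extend₃, weighted, Fintype.sum_prod_type, tensorFamily]

/-- Every factor is evaluated at `u = x * g`, so the claim is that `Φ(u, u⁻¹, u)` cancels the value
of `β` at `u`. -/
theorem extend₃_antipode (hΔ : CoalgebraStruct.comul = B.bosonComul) :
    (B.extend₃ fun g h e => Φ g h e) ∘ₗ
      TensorProduct.map LinearMap.id
        (convLeft B.bosonBeta
          (TensorProduct.map B.bosonAntipode LinearMap.id ∘ₗ CoalgebraStruct.comul)) ∘ₗ
        CoalgebraStruct.comul = B.bosonCounit := by
  refine boson_linearMap_ext D fun x g X hX => ?_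
  have hl := B.isLeftDegree_elt hΔ hX g
  have hp := B.isPoint_elt_left hX g
  simp only [extend₃_eq_sum, LinearMap.comp_apply, LinearMap.sum_apply, LinearMap.smul_apply,
    tensorFunctional_map_comul, LinearMap.comp_id, hl.convLeft_apply, bosonBeta,
    hl.convLeft_weighted, map_smul, bosonDelta_comp_antipode, hp _, inv_eq_iff_eq_inv,
    bosonCounit_elt]
  simp

theorem extend₃_antipode' (hΔ : CoalgebraStruct.comul = B.bosonComul) :
    (B.extend₃ fun g h e => ((Φ g h e)⁻¹ : kˣ)) ∘ₗ
      TensorProduct.map B.bosonAntipode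
        (TensorProduct.map LinearMap.id (convLeft B.bosonBeta B.bosonAntipode) ∘ₗ
          CoalgebraStruct.comul) ∘ₗ
        CoalgebraStruct.comul = B.bosonCounit := by
  refine boson_linearMap_ext D fun x g X hX => ?_
  have hl := B.isLeftDegree_elt hΔ hX g
  have hp := B.isPoint_elt_left hX g
  have hS : ∀ j, B.bosonDelta j (B.bosonAntipode (elt g X)) = B.bosonDelta j⁻¹ (elt g X) := fun j =>
    LinearMap.congr_fun (B.bosonDelta_comp_antipode j) _
  -- With `u = x * g`, this instance of the cocycle condition reads `1 = Φ(u, u⁻¹, u) Φ(u⁻¹, u,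
  -- u⁻¹)`, the scalar identity required.
  have hc := congrArg Units.val (Φ.cocycle (x * g) (x * g)⁻¹ (x * g) (x * g)⁻¹)
  rw [mul_inv_cancel, inv_mul_cancel, Φ.one_left, Φ.one_right, Φ.normalized, mul_one, mul_one,
    Units.val_one, Units.val_mul] at hc
  simp only [extend₃_eq_sum, LinearMap.comp_apply, LinearMap.sum_apply, LinearMap.smul_apply,
    tensorFunctional_map_comul, LinearMap.comp_id, hl.convLeft_apply, bosonBeta,
    hl.convLeft_weighted, map_smul, bosonDelta_comp_antipode, hS, hp _, inv_eq_iff_eq_inv,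
    bosonCounit_elt]
  simp only [mul_inv_rev] at hc
  simp [← _root_.mul_assoc]
  rw [← mul_inv_rev (Φ (x * g) _ _ : k), ← hc, inv_one, one_mul]

end BraidedHopfAlgebra
end Antipode

/-! ### Graded spaces, their projections and tensor squares. -/

section Grading

variable {k : Type u} [Field k]
variable {V : Type*} [AddCommGroup V] [Module k V]

/-- The maps `P n` are the projections of a grading `V = ⊕ gr n`. -/
structure IsGradedProj (gr : ℕ → Submodule k V) (P : ℕ → V →ₗ[k] V) : Prop where
  mem : ∀ n v, P n v ∈ gr n
  eq_of_mem : ∀ n, ∀ v ∈ gr n, P n v = v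
  eq_zero_of_mem : ∀ m n, m ≠ n → ∀ v ∈ gr n, P m v = 0
  iSup_eq_top : iSup gr = ⊤

theorem exists_isGradedProj {gr : ℕ → Submodule k V} (h : DirectSum.IsInternal gr) :
    ∃ P, IsGradedProj gr P := by
  let e := LinearEquiv.ofBijective (DirectSum.coeLinearMap gr) h
  have he : ∀ n (v : gr n), e.symm v = DirectSum.lof k ℕ (fun i => gr i) n v := by
    intro n v
    rw [LinearEquiv.symm_apply_eq]
    exact (DirectSum.coeLinearMap_lof gr n v).symm
  refine ⟨fun n => (gr n).subtype ∘ₗ DirectSum.component k ℕ (fun i => gr i) n ∘ₗ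
    e.symm.toLinearMap, fun n v => Submodule.coe_mem _, fun n v hv => ?_, fun m n hmn v hv => ?_,
    h.submodule_iSup_eq_top⟩
  · simp only [LinearMap.comp_apply, LinearEquiv.coe_coe, he n ⟨v, hv⟩]
    simp [DirectSum.component.lof_self]
  · simp only [LinearMap.comp_apply, LinearEquiv.coe_coe, he n ⟨v, hv⟩]
    rw [DirectSum.component.of, dif_neg hmn.symm]
    simp

namespace IsGradedProj

variable {gr : ℕ → Submodule k V} {P : ℕ → V →ₗ[k] V}

theorem proj_proj (h : IsGradedProj gr P) (m n : ℕ) (v : V) :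
    P m (P n v) = if m = n then P n v else 0 := by
  split_ifs with hmn
  · subst hmn; exact h.eq_of_mem _ _ (h.mem _ v)
  · exact h.eq_zero_of_mem _ _ hmn _ (h.mem _ v)

@[elab_as_elim]
theorem induction (h : IsGradedProj gr P) {motive : V → Prop} (v : V)
    (mem : ∀ n, ∀ v ∈ gr n, motive v)
    (add : ∀ v w, motive v → motive w → motive (v + w)) : motive v :=
  Submodule.iSup_induction gr (motive := motive) (h.iSup_eq_top ▸ Submodule.mem_top) mem
    (mem 0 0 (zero_mem _)) add

theorem exists_bound (h : IsGradedProj gr P) (v : V) :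
    ∃ N, (∀ n, N ≤ n → P n v = 0) ∧ ∀ n, N ≤ n → ∑ i ∈ Finset.range n, P i v = v := by
  refine h.induction v (fun n v hv => ⟨n + 1, fun m hm => ?_, fun m hm => ?_⟩) fun v w hv hw => ?_
  · exact h.eq_zero_of_mem _ _ (by omega) _ hv
  · rw [Finset.sum_eq_single n, h.eq_of_mem _ _ hv]
    · exact fun b _ hb => h.eq_zero_of_mem _ _ hb _ hv
    · simp; omega
  · obtain ⟨N₁, h₁, h₁'⟩ := hv
    obtain ⟨N₂, h₂, h₂'⟩ := hw
    refine ⟨max N₁ N₂, fun n hn => ?_, fun n hn => ?_⟩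
    · rw [map_add, h₁ n (by omega), h₂ n (by omega), add_zero]
    · simp only [map_add, Finset.sum_add_distrib, h₁' n (by omega), h₂' n (by omega)]

theorem eq_zero (h : IsGradedProj gr P) {v : V} (hv : ∀ n, P n v = 0) : v = 0 := by
  obtain ⟨N, -, hN⟩ := h.exists_bound v
  rw [← hN N le_rfl]
  exact Finset.sum_eq_zero fun i _ => hv i

theorem mem_of_proj (h : IsGradedProj gr P) {v : V} {n : ℕ} (hv : ∀ m, m ≠ n → P m v = 0) :
    v ∈ gr n := by
  have : v - P n v = 0 := h.eq_zero fun m => by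
    rw [map_sub, h.proj_proj]
    split_ifs with hm
    · rw [hm, sub_self]
    · rw [hv m hm, sub_zero]
  rw [sub_eq_zero.mp this]
  exact h.mem n v

theorem isInternal (h : IsGradedProj gr P) : DirectSum.IsInternal gr := by
  rw [DirectSum.isInternal_submodule_iff_iSupIndep_and_iSup_eq_top]
  refine ⟨fun i => ?_, h.iSup_eq_top⟩
  rw [Submodule.disjoint_def]
  intro v hv hv'
  have hle : ⨆ (j) (_ : j ≠ i), gr j ≤ LinearMap.ker (P i) :=
    iSup₂_le fun j hj w hw => h.eq_zero_of_mem _ _ hj.symm _ hw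
  rw [← h.eq_of_mem i v hv]
  exact hle hv'

theorem mem_iSup_range_iff (h : IsGradedProj gr P) (n : ℕ) (v : V) :
    v ∈ ⨆ i ∈ Finset.range (n + 1), gr i ↔ ∀ m, n < m → P m v = 0 := by
  constructor
  · intro hv m hm
    have hle : ⨆ i ∈ Finset.range (n + 1), gr i ≤ LinearMap.ker (P m) :=
      iSup₂_le fun j hj w hw => h.eq_zero_of_mem _ _ (by simp at hj; omega) _ hw
    exact hle hv
  · intro hv
    obtain ⟨N, -, hN⟩ := h.exists_bound v
    rw [← hN N le_rfl]
    refine Submodule.sum_mem _ fun i _ => ?_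
    by_cases hi : n < i
    · rw [hv i hi]; exact zero_mem _
    · exact Submodule.mem_iSup_of_mem i (Submodule.mem_iSup_of_mem (by simp; omega) (h.mem i v))

theorem map_tensorDegree (h : IsGradedProj gr P) {n : ℕ} {t : V ⊗[k] V}
    (ht : t ∈ tensorDegree gr n) {i j : ℕ} (hij : i + j ≠ n) :
    TensorProduct.map (P i) (P j) t = 0 := by
  have hle : tensorDegree gr n ≤ LinearMap.ker (TensorProduct.map (P i) (P j)) := by
    refine iSup_le fun a => iSup_le fun b => iSup_le fun hab => ?_
    rintro _ ⟨s, rfl⟩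
    rw [LinearMap.mem_ker]
    induction s with
    | zero => simp
    | add s t hs ht => simp only [map_add, hs, ht, add_zero]
    | tmul v w =>
      simp only [TensorProduct.map_tmul, Submodule.coe_subtype]
      by_cases hi : i = a
      · rw [h.eq_zero_of_mem j b (by omega) _ w.2, TensorProduct.tmul_zero]
      · rw [h.eq_zero_of_mem i a hi _ v.2, TensorProduct.zero_tmul]
  exact hle ht

theorem tensor_eq_zero (h : IsGradedProj gr P) {t : V ⊗[k] V}
    (ht : ∀ i j, TensorProduct.map (P i) (P j) t = 0) : t = 0 := by
  have key : ∀ t : V ⊗[k] V, ∃ N, ∀ n, N ≤ n →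
      ∑ i ∈ Finset.range n, ∑ j ∈ Finset.range n, TensorProduct.map (P i) (P j) t = t := by
    intro t
    induction t with
    | zero => exact ⟨0, by simp⟩
    | add s t hs ht =>
      obtain ⟨N₁, h₁⟩ := hs
      obtain ⟨N₂, h₂⟩ := ht
      exact ⟨max N₁ N₂, fun n hn => by
        simp only [map_add, Finset.sum_add_distrib, h₁ n (by omega), h₂ n (by omega)]⟩
    | tmul v w =>
      obtain ⟨N₁, -, h₁⟩ := h.exists_bound v
      obtain ⟨N₂, -, h₂⟩ := h.exists_bound w
      refine ⟨max N₁ N₂, fun n hn => ?_⟩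
      simp only [TensorProduct.map_tmul, ← TensorProduct.tmul_sum, ← TensorProduct.sum_tmul,
        h₁ n (by omega), h₂ n (by omega)]
  obtain ⟨N, hN⟩ := key t
  rw [← hN N le_rfl]
  exact Finset.sum_eq_zero fun i _ => Finset.sum_eq_zero fun j _ => ht i j

end IsGradedProj

theorem map_mem_tensorDegree {W : Type*} [AddCommGroup W] [Module k W] {gr : ℕ → Submodule k V}
    {gr' : ℕ → Submodule k W} {f g : V →ₗ[k] W} (hf : ∀ n, ∀ v ∈ gr n, f v ∈ gr' n)
    (hg : ∀ n, ∀ v ∈ gr n, g v ∈ gr' n) {n : ℕ} {t : V ⊗[k] V} (ht : t ∈ tensorDegree gr n) :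
    TensorProduct.map f g t ∈ tensorDegree gr' n := by
  have hle : tensorDegree gr n ≤ (tensorDegree gr' n).comap (TensorProduct.map f g) := by
    refine iSup_le fun a => iSup_le fun b => iSup_le fun hab => ?_
    rintro _ ⟨s, rfl⟩
    rw [Submodule.mem_comap]
    refine Submodule.mem_iSup_of_mem a (Submodule.mem_iSup_of_mem b
      (Submodule.mem_iSup_of_mem hab ?_))
    induction s with
    | zero => simp
    | add s t hs ht => simp only [map_add]; exact add_mem hs ht
    | tmul v w =>
      exact ⟨⟨f v, hf a v v.2⟩ ⊗ₜ ⟨g w, hg b w w.2⟩, by simp⟩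
  exact hle ht

end Grading

/-! ### The coradical filtration of a graded coalgebra. -/

section CoradicalFiltration

variable {k : Type u} [Field k] {C : Type w} [AddCommGroup C] [Module k C] (cC : Coalgebra k C)
  {gr : ℕ → Submodule k C} {P : ℕ → C →ₗ[k] C}

theorem map_proj_comul (h : IsGradedProj gr P)
    (hΔ : ∀ n, ∀ c ∈ gr n, cC.comul c ∈ tensorDegree gr n) (i j : ℕ) (c : C) :
    TensorProduct.map (P i) (P j) (cC.comul c) =
      TensorProduct.map (P i) (P j) (cC.comul (P (i + j) c)) := by
  refine h.induction c (fun n v hv => ?_) fun v w hv hw => by simp only [map_add, hv, hw]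
  by_cases hn : i + j = n
  · rw [hn, h.eq_of_mem _ _ hv]
  · rw [h.map_tensorDegree (hΔ n v hv) hn, h.eq_zero_of_mem _ _ hn _ hv]
    simp

/-- If the homogeneous elements of degree `≥ 2` are determined by the inner components of their
coproduct, then they are determined by the component of bidegree `(1, m - 1)`. -/
theorem eq_zero_of_map_proj_one (h : IsGradedProj gr P)
    (hΔ : ∀ n, ∀ c ∈ gr n, cC.comul c ∈ tensorDegree gr n)
    (hprim : ∀ m, 2 ≤ m → ∀ c ∈ gr m,
      (∀ i j, 1 ≤ i → 1 ≤ j → TensorProduct.map (P i) (P j) (cC.comul c) = 0) → c = 0)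
    (m : ℕ) (hm : 2 ≤ m) (c : C) (hc : c ∈ gr m)
    (hc₁ : TensorProduct.map (P 1) (P (m - 1)) (cC.comul c) = 0) : c = 0 := by
  induction m using Nat.strong_induction_on generalizing c with
  | _ m ih =>
    refine hprim m hm c hc fun i j hi hj => ?_
    by_cases hij : i + j = m
    swap
    · exact h.map_tensorDegree (hΔ m c hc) hij
    obtain rfl | hi' := hi.eq_or_lt
    · rwa [← hij, Nat.add_sub_cancel_left] at hc₁
    -- As `j ≥ 1`, the degree `i` is below `m` and the induction hypothesis makes `K` injective. A
    -- left inverse `L` lets `P i` be recovered from the component of bidegree `(1, i - 1)` of the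
    -- coproduct.
    let K : gr i →ₗ[k] C ⊗[k] C :=
      TensorProduct.map (P 1) (P (i - 1)) ∘ₗ cC.comul ∘ₗ (gr i).subtype
    have hK : LinearMap.ker K = ⊥ := by
      rw [LinearMap.ker_eq_bot']
      rintro ⟨v, hv⟩ hKv
      exact Subtype.ext (ih i (by omega) hi' v hv hKv)
    obtain ⟨L, hL⟩ := K.exists_leftInverse_of_injective hK
    have hP : P i = (gr i).subtype ∘ₗ L ∘ₗ TensorProduct.map (P 1) (P (i - 1)) ∘ₗ cC.comul := by
      ext v
      have h₁ := LinearMap.congr_fun hL ⟨P i v, h.mem i v⟩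
      have h₂ := map_proj_comul cC h hΔ 1 (i - 1) v
      rw [Nat.add_sub_cancel' hi] at h₂
      simp only [LinearMap.comp_apply, K, Submodule.coe_subtype, LinearMap.id_apply] at h₁ ⊢
      rw [h₂, h₁]
    -- The component of tridegree `(1, i - 1, j)` of the iterated coproduct can by coassociativity
    -- also be read off the component of bidegree `(1, m - 1)`, which vanishes.
    have hco : TensorProduct.map (TensorProduct.map (P 1) (P (i - 1)) ∘ₗ cC.comul) (P j)
        (cC.comul c) = 0 := by
      apply (TensorProduct.assoc k C C C).injective
      have h₁ : ∀ t : C ⊗[k] C, TensorProduct.assoc k C C C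
          (TensorProduct.map (TensorProduct.map (P 1) (P (i - 1)) ∘ₗ cC.comul) (P j) t) =
          TensorProduct.map (P 1) (TensorProduct.map (P (i - 1)) (P j))
            (TensorProduct.assoc k C C C (cC.comul.rTensor C t)) := by
        intro t
        induction t with
        | zero => simp
        | add s t hs ht => simp only [map_add, hs, ht]
        | tmul a b =>
          simp only [TensorProduct.map_tmul, LinearMap.comp_apply, LinearMap.rTensor_tmul]
          induction cC.comul a with
          | zero => simp
          | add s t hs ht => simp only [map_add, TensorProduct.add_tmul, hs, ht]
          | tmul a' b' => simp
      have h₂ : ∀ t : C ⊗[k] C, TensorProduct.map (P 1) (TensorProduct.map (P (i - 1)) (P j))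
          (cC.comul.lTensor C t) =
          TensorProduct.map LinearMap.id (TensorProduct.map (P (i - 1)) (P j) ∘ₗ cC.comul)
            (TensorProduct.map (P 1) (P (m - 1)) t) := by
        intro t
        induction t with
        | zero => simp
        | add s t hs ht => simp only [map_add, hs, ht]
        | tmul a b =>
          simp only [TensorProduct.map_tmul, LinearMap.lTensor_tmul, LinearMap.comp_apply,
            LinearMap.id_apply]
          rw [map_proj_comul cC h hΔ, show i - 1 + j = m - 1 by omega]
      have hcoassoc := LinearMap.congr_fun cC.coassoc c
      simp only [LinearMap.comp_apply, LinearEquiv.coe_coe] at hcoassoc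
      rw [h₁, hcoassoc, h₂, hc₁]
      simp
    have : TensorProduct.map (P i) (P j) (cC.comul c) =
        ((gr i).subtype ∘ₗ L).rTensor C (TensorProduct.map
          (TensorProduct.map (P 1) (P (i - 1)) ∘ₗ cC.comul) (P j) (cC.comul c)) := by
      rw [← LinearMap.comp_apply (LinearMap.rTensor C _), LinearMap.rTensor_comp_map,
        LinearMap.comp_assoc, ← hP]
    rw [this, hco, map_zero]

/-- In `gr a ⊗ gr b` with `a + b ≤ n + 1`, either `b ≤ n` and the second factor lies in the previous
term, or `a = 0` and the first lies in the coradical. -/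
theorem iSup_range_le_coradicalFiltration
    (hΔ : ∀ n, ∀ c ∈ gr n, cC.comul c ∈ tensorDegree gr n) (h₀ : coradical cC = gr 0) (n : ℕ) :
    ⨆ i ∈ Finset.range (n + 1), gr i ≤ coradicalFiltration cC n := by
  induction n with
  | zero => simp [coradicalFiltration, h₀]
  | succ n ih =>
    refine iSup₂_le fun i hi c hc => ?_
    have hi : i ≤ n + 1 := by simpa [Nat.lt_succ_iff] using hi
    rw [coradicalFiltration, Submodule.mem_comap]
    refine (?_ : tensorDegree gr i ≤ _) (hΔ i c hc)
    refine iSup_le fun a => iSup_le fun b => iSup_le fun hab => ?_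
    by_cases hb : b ≤ n
    · refine le_trans ?_ le_sup_left
      rintro _ ⟨s, rfl⟩
      have hle : gr b ≤ coradicalFiltration cC n := le_trans
        (le_iSup₂_of_le (f := fun i (_ : i ∈ Finset.range (n + 1)) => gr i) b
          (by simp; omega) le_rfl) ih
      exact ⟨TensorProduct.map (gr a).subtype (Submodule.inclusion hle) s, by
        rw [← LinearMap.comp_apply, LinearMap.lTensor_comp_map]; rfl⟩
    · refine le_trans ?_ le_sup_right
      rintro _ ⟨s, rfl⟩
      obtain rfl : a = 0 := by omega
      exact ⟨TensorProduct.map (Submodule.inclusion h₀.ge) (gr b).subtype s, by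
        rw [← LinearMap.comp_apply, LinearMap.rTensor_comp_map]; rfl⟩

/-- For `m > n + 1` the map `P 1 ⊗ P (m - 1)` kills `C ⊗ C_n` because `m - 1 > n`, and kills `C₀ ⊗
C` because `C₀` has degree `0`. By `eq_zero_of_map_proj_one`, an element of `C_{n+1}` has no
component of degree `m`. -/
theorem isCoradicalGrading_of_primitive (h : IsGradedProj gr P)
    (hΔ : ∀ n, ∀ c ∈ gr n, cC.comul c ∈ tensorDegree gr n) (h₀ : coradical cC = gr 0)
    (hprim : ∀ m, 2 ≤ m → ∀ c ∈ gr m,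
      (∀ i j, 1 ≤ i → 1 ≤ j → TensorProduct.map (P i) (P j) (cC.comul c) = 0) → c = 0) :
    IsCoradicalGrading cC gr := by
  intro n
  refine le_antisymm ?_ (iSup_range_le_coradicalFiltration cC hΔ h₀ n)
  induction n with
  | zero => simp [coradicalFiltration, h₀]
  | succ n ih =>
    have ih := le_antisymm ih (iSup_range_le_coradicalFiltration cC hΔ h₀ n)
    intro c hc
    rw [coradicalFiltration, Submodule.mem_comap] at hc
    rw [h.mem_iSup_range_iff]
    intro m hm
    refine eq_zero_of_map_proj_one cC h hΔ hprim m (by omega) _ (h.mem m c) ?_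
    have h₁ := map_proj_comul cC h hΔ 1 (m - 1) c
    rw [show 1 + (m - 1) = m by omega] at h₁
    rw [← h₁]
    refine (?_ : _ ≤ LinearMap.ker (TensorProduct.map (P 1) (P (m - 1)))) hc
    refine sup_le ?_ ?_
    · rintro _ ⟨s, rfl⟩
      rw [LinearMap.mem_ker, ← LinearMap.comp_apply, LinearMap.map_comp_lTensor]
      have : P (m - 1) ∘ₗ (coradicalFiltration cC n).subtype = 0 := by
        ext ⟨v, hv⟩
        rw [ih, h.mem_iSup_range_iff] at hv
        exact hv _ (by omega)
      rw [this, TensorProduct.map_zero_right, LinearMap.zero_apply]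
    · rintro _ ⟨s, rfl⟩
      rw [LinearMap.mem_ker, ← LinearMap.comp_apply, LinearMap.map_comp_rTensor]
      have : P 1 ∘ₗ (coradical cC).subtype = 0 := by
        ext ⟨v, hv⟩
        rw [h₀] at hv
        exact h.eq_zero_of_mem _ _ one_ne_zero _ hv
      rw [this, TensorProduct.map_zero_left, LinearMap.zero_apply]

end CoradicalFiltration

/-! ### The length grading of `H ⊗ kG`. -/

section LengthGrading

variable {k : Type u} {G : Type v} [Field k] [CommGroup G] [Fintype G] [DecidableEq G]
variable {H : Type w} [AddCommGroup H] [Module k H] {gr : ℕ → Submodule k H}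

omit [Fintype G] [DecidableEq G] in
theorem elt_mem_lengthGrading {n : ℕ} {X : H} (hX : X ∈ gr n) (g : G) :
    elt g X ∈ lengthGrading G gr n :=
  ⟨⟨X, hX⟩ ⊗ₜ MonoidAlgebra.single g 1, rfl⟩

omit [Fintype G] [DecidableEq G] in
theorem eltCoeff_mem {n : ℕ} {a : H ⊗[k] MonoidAlgebra k G} (ha : a ∈ lengthGrading G gr n)
    (g : G) : eltCoeff g a ∈ gr n := by
  obtain ⟨s, rfl⟩ := ha
  induction s with
  | zero => simp
  | add s t hs ht => simp only [map_add]; exact add_mem hs ht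
  | tmul X b =>
    simp only [eltCoeff, LinearMap.comp_apply, LinearMap.rTensor_tmul, LinearMap.lTensor_tmul,
      LinearEquiv.coe_coe, TensorProduct.rid_tmul]
    exact Submodule.smul_mem _ _ X.2

omit [DecidableEq G] in
@[elab_as_elim]
theorem lengthGrading_induction {n : ℕ} {motive : H ⊗[k] MonoidAlgebra k G → Prop}
    {a : H ⊗[k] MonoidAlgebra k G} (ha : a ∈ lengthGrading G gr n)
    (add : ∀ a b, motive a → motive b → motive (a + b))
    (elt : ∀ g, ∀ X ∈ gr n, motive (elt g X)) : motive a := by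
  classical
  rw [← sum_elt_eltCoeff a]
  refine Finset.sum_induction _ motive add ?_ fun g _ => elt g _ (eltCoeff_mem ha g)
  simpa using elt 1 0 (zero_mem _)

omit [Fintype G] in
theorem eltCoeff_rTensor (P : H →ₗ[k] H) (g : G) (a : H ⊗[k] MonoidAlgebra k G) :
    eltCoeff g (P.rTensor _ a) = P (eltCoeff g a) := by
  refine LinearMap.congr_fun (elt_linearMap_ext (f := eltCoeff g ∘ₗ P.rTensor _)
    (f' := P ∘ₗ eltCoeff g) fun h X => ?_) a
  simp only [LinearMap.comp_apply, eltCoeff_elt, apply_ite P, map_zero]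
  exact eltCoeff_elt g h (P X)

theorem IsGradedProj.lengthGrading {P : ℕ → H →ₗ[k] H} (h : IsGradedProj gr P) :
    IsGradedProj (lengthGrading G gr) fun n => (P n).rTensor (MonoidAlgebra k G) where
  mem n a := by
    rw [← sum_elt_eltCoeff ((P n).rTensor _ a)]
    refine Submodule.sum_mem _ fun g _ => elt_mem_lengthGrading ?_ g
    rw [eltCoeff_rTensor]
    exact h.mem n _
  eq_of_mem n a ha := by
    refine lengthGrading_induction ha (fun a b ha hb => by rw [map_add, ha, hb]) fun g X hX => ?_
    change elt g (P n X) = _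
    rw [h.eq_of_mem n X hX]
  eq_zero_of_mem m n hmn a ha := by
    refine lengthGrading_induction ha (fun a b ha hb => by rw [map_add, ha, hb, add_zero])
      fun g X hX => ?_
    change elt g (P m X) = _
    rw [h.eq_zero_of_mem m n hmn X hX, map_zero]
  iSup_eq_top := by
    rw [eq_top_iff]
    intro a _
    rw [← sum_elt_eltCoeff a]
    refine Submodule.sum_mem _ fun g _ => ?_
    refine h.induction (eltCoeff g a) (fun n X hX => ?_) fun X Y hX hY => ?_
    · exact Submodule.mem_iSup_of_mem n (elt_mem_lengthGrading hX g)
    · rw [map_add]; exact add_mem hX hY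

end LengthGrading

/-! ### Structure maps and length; the leading term of the coproduct. -/

section BosonGrading

variable {k : Type u} {G : Type v} [Field k] [CommGroup G] [Fintype G] [DecidableEq G]
variable {H : Type w} [AddCommGroup H] [Module k H]
variable {Φ : NormalizedThreeCocycle k G} {D : YDModule Φ H}

namespace BraidedHopfAlgebra

variable {B : BraidedHopfAlgebra D} {gr : ℕ → Submodule k H}

theorem IsGraded.bosonSplit_mem (hgr : B.IsGraded gr) {n : ℕ} {t : H ⊗[k] H}
    (ht : t ∈ tensorDegree gr n) (g : G) :
    bosonSplit D g t ∈ tensorDegree (lengthGrading G gr) n := by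
  simp only [bosonSplit, LinearMap.sum_apply, LinearMap.smul_apply]
  refine Submodule.sum_mem _ fun x _ => Submodule.sum_mem _ fun y _ => ?_
  rw [Units.smul_def]
  refine Submodule.smul_mem _ _ (map_mem_tensorDegree (fun m X hX => ?_) (fun m X hX => ?_) ht)
  · exact elt_mem_lengthGrading (hgr.proj_mem m x X hX) _
  · exact elt_mem_lengthGrading (hgr.proj_mem m y X hX) _

theorem IsGraded.bosonComul_mem (hgr : B.IsGraded gr) (n : ℕ) :
    ∀ a ∈ lengthGrading G gr n, B.bosonComul a ∈ tensorDegree (lengthGrading G gr) n := by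
  intro a ha
  refine lengthGrading_induction ha (fun a b ha hb => by rw [map_add]; exact add_mem ha hb)
    fun g X hX => ?_
  rw [bosonComul_elt]
  exact hgr.bosonSplit_mem (hgr.comul_mem n X hX) g

theorem IsGraded.bosonCounit_eq_zero (hgr : B.IsGraded gr) (n : ℕ) (hn : n ≠ 0) :
    ∀ a ∈ lengthGrading G gr n, B.bosonCounit a = 0 := by
  intro a ha
  refine lengthGrading_induction ha (fun a b ha hb => by rw [map_add, ha, hb, add_zero])
    fun g X hX => ?_
  rw [bosonCounit_elt, hgr.counit_eq_zero n hn X hX]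

theorem IsGraded.bosonBeta_eq_zero (hgr : B.IsGraded gr) (n : ℕ) (hn : n ≠ 0) :
    ∀ a ∈ lengthGrading G gr n, B.bosonBeta a = 0 := by
  intro a ha
  refine lengthGrading_induction ha (fun a b ha hb => by rw [map_add, ha, hb, add_zero])
    fun g X hX => ?_
  rw [bosonBeta_elt, hgr.counit_eq_zero n hn X hX, mul_zero]

theorem IsGraded.bosonMul_mem (hgr : B.IsGraded gr) (m n : ℕ) :
    ∀ a ∈ lengthGrading G gr m, ∀ b ∈ lengthGrading G gr n,
      B.bosonMul (a ⊗ₜ[k] b) ∈ lengthGrading G gr (m + n) := by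
  intro a ha b hb
  refine lengthGrading_induction ha
    (fun a b ha hb => by rw [TensorProduct.add_tmul, map_add]; exact add_mem ha hb) fun g X hX => ?_
  refine lengthGrading_induction hb
    (fun a b ha hb => by rw [TensorProduct.tmul_add, map_add]; exact add_mem ha hb) fun h Y hY => ?_
  rw [bosonMul_elt_eq]
  simp only [bosonMulAt, LinearMap.sum_apply, LinearMap.smul_apply, LinearMap.comp_apply,
    TensorProduct.map_tmul]
  refine Submodule.sum_mem _ fun x _ => Submodule.sum_mem _ fun y _ => ?_
  rw [Units.smul_def]
  exact Submodule.smul_mem _ _ (elt_mem_lengthGrading (hgr.mul_mem m n _ (hgr.proj_mem m x X hX) _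
    (hgr.act_mem n g _ (hgr.proj_mem n y Y hY))) _)

theorem IsGraded.bosonAntipode_mem (hgr : B.IsGraded gr) (n : ℕ) :
    ∀ a ∈ lengthGrading G gr n, B.bosonAntipode a ∈ lengthGrading G gr n := by
  intro a ha
  refine lengthGrading_induction ha (fun a b ha hb => by rw [map_add]; exact add_mem ha hb)
    fun g X hX => ?_
  rw [bosonAntipode, ofFamily_elt]
  simp only [LinearMap.sum_apply, LinearMap.smul_apply, LinearMap.comp_apply]
  refine Submodule.sum_mem _ fun x _ => ?_
  rw [Units.smul_def]
  exact Submodule.smul_mem _ _ (elt_mem_lengthGrading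
    (hgr.act_mem n _ _ (hgr.antipode_mem n _ (hgr.proj_mem n x X hX))) _)

theorem IsGraded.extend₃_eq_zero (hgr : B.IsGraded gr) (F : G → G → G → k) (l m n : ℕ)
    (hlmn : l + m + n ≠ 0) : ∀ a ∈ lengthGrading G gr l, ∀ b ∈ lengthGrading G gr m,
      ∀ c ∈ lengthGrading G gr n, B.extend₃ F (a ⊗ₜ[k] (b ⊗ₜ[k] c)) = 0 := by
  intro a ha b hb c hc
  refine lengthGrading_induction ha
    (fun a b ha hb => by rw [TensorProduct.add_tmul, map_add, ha, hb, add_zero]) fun g X hX => ?_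
  refine lengthGrading_induction hb
    (fun a b ha hb => by rw [TensorProduct.add_tmul, TensorProduct.tmul_add, map_add, ha, hb,
      add_zero]) fun h Y hY => ?_
  refine lengthGrading_induction hc
    (fun a b ha hb => by rw [TensorProduct.tmul_add, TensorProduct.tmul_add, map_add, ha, hb,
      add_zero]) fun e Z hZ => ?_
  rw [extend₃_elt]
  by_cases hl : l = 0
  · by_cases hm : m = 0
    · rw [hgr.counit_eq_zero n (by omega) Z hZ, mul_zero, mul_zero, mul_zero]
    · rw [hgr.counit_eq_zero m hm Y hY, zero_mul, mul_zero, mul_zero]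
  · rw [hgr.counit_eq_zero l hl X hX, zero_mul, mul_zero]

/-- In a connected graded braided Hopf algebra, `Δ(X) ∈ X ⊗ 1 + ∑_{i < n} H(i) ⊗ H` for `X` of
length `n`. -/
theorem IsGraded.comul_sub_mem (hgr : B.IsGraded gr) (hconn : B.IsConnected gr) {n : ℕ} {X : H}
    (hX : X ∈ gr n) :
    B.comul X - X ⊗ₜ[k] B.unit 1 ∈
      ⨆ (i : ℕ) (_ : i < n), LinearMap.range (TensorProduct.map (gr i).subtype
        (LinearMap.id : H →ₗ[k] H)) := by
  have hle : ∀ t ∈ tensorDegree gr n,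
      t - (TensorProduct.rid k H (B.counit.lTensor H t)) ⊗ₜ[k] B.unit 1 ∈
      ⨆ (i : ℕ) (_ : i < n), LinearMap.range (TensorProduct.map (gr i).subtype
        (LinearMap.id : H →ₗ[k] H)) := by
    -- `F` subtracts `(id ⊗ ε)(t) ⊗ 1`. On `H(a) ⊗ H(b)` it vanishes if `b = 0`, by connectedness,
    -- and is the identity if `b > 0`, in which case `a < n`.
    let F : H ⊗[k] H →ₗ[k] H ⊗[k] H := LinearMap.id -
      (TensorProduct.mk k H H).flip (B.unit 1) ∘ₗ (TensorProduct.rid k H).toLinearMap ∘ₗ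
        B.counit.lTensor H
    suffices h : tensorDegree gr n ≤ Submodule.comap F (⨆ (i : ℕ) (_ : i < n),
      LinearMap.range (TensorProduct.map (gr i).subtype (LinearMap.id : H →ₗ[k] H))) from
      fun t ht => h ht
    refine iSup_le fun a => iSup_le fun b => iSup_le fun hab => ?_
    rintro _ ⟨s, rfl⟩
    rw [Submodule.mem_comap]
    induction s with
    | zero => simp
    | add s t hs ht => simp only [map_add]; exact add_mem hs ht
    | tmul v w =>
      obtain ⟨w, hw⟩ := w
      simp only [TensorProduct.map_tmul, Submodule.coe_subtype]
      by_cases hb : b = 0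
      · subst hb
        rw [hconn, Submodule.mem_span_singleton] at hw
        obtain ⟨c, rfl⟩ := hw
        simp [F, B.counit_unit]
      · have h0 : F (v.1 ⊗ₜ[k] w) = v.1 ⊗ₜ[k] w := by
          simp [F, hgr.counit_eq_zero b hb w hw]
        rw [h0]
        exact Submodule.mem_iSup_of_mem a (Submodule.mem_iSup_of_mem (by omega)
          ⟨v ⊗ₜ[k] w, by simp⟩)
  have h₂ := LinearMap.congr_fun B.comul_counit X
  simp only [LinearMap.comp_apply] at h₂
  have := hle _ (hgr.comul_mem n X hX)
  rw [h₂] at this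
  simpa using this

theorem bosonSplit_tmul_unit (g : G) (X : H) :
    bosonSplit D g (X ⊗ₜ[k] B.unit 1) = elt g X ⊗ₜ[k] elt g (B.unit 1) := by
  refine D.component_induction X (fun X Y hX hY => ?_) fun x X hX => ?_
  · simp only [TensorProduct.add_tmul, map_add, hX, hY]
  · rw [bosonSplit_tmul D g hX B.unit_mem_component, Φ.normalized]
    simp

/-- A linear map vanishing on lower lengths only sees the leading term of `Δ(X ⊗ g)`. -/
theorem IsGraded.map_bosonComul_elt {N : Type*} [AddCommGroup N] [Module k N]
    (hgr : B.IsGraded gr) (hconn : B.IsConnected gr)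
    {n : ℕ} {X : H} (hX : X ∈ gr n) (g : G)
    (F : (H ⊗[k] MonoidAlgebra k G) ⊗[k] (H ⊗[k] MonoidAlgebra k G) →ₗ[k] N)
    (hF : ∀ i < n, ∀ a ∈ lengthGrading G gr i, ∀ b, F (a ⊗ₜ[k] b) = 0) :
    F (B.bosonComul (elt g X)) = F (elt g X ⊗ₜ[k] elt g (B.unit 1)) := by
  rw [bosonComul_elt, ← bosonSplit_tmul_unit, ← sub_eq_zero, ← map_sub, ← map_sub]
  have hle : (⨆ (i : ℕ) (_ : i < n), LinearMap.range (TensorProduct.map (gr i).subtype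
        (LinearMap.id : H →ₗ[k] H))) ≤ LinearMap.ker (F ∘ₗ bosonSplit D g) := by
    refine iSup₂_le fun i hi => ?_
    rintro _ ⟨s, rfl⟩
    rw [LinearMap.mem_ker]
    induction s with
    | zero => simp
    | add s t hs ht => simp only [map_add, hs, ht, add_zero]
    | tmul v w =>
      simp only [LinearMap.comp_apply, bosonSplit, LinearMap.sum_apply, LinearMap.smul_apply,
        TensorProduct.map_tmul, map_sum, LinearMap.map_smul_of_tower, LinearMap.id_apply,
        Submodule.coe_subtype]
      refine Finset.sum_eq_zero fun x _ => Finset.sum_eq_zero fun y _ => ?_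
      rw [hF i hi _ (elt_mem_lengthGrading (hgr.proj_mem i x _ v.2) _), smul_zero]
  exact hle (hgr.comul_sub_mem hconn hX)

end BraidedHopfAlgebra
end BosonGrading

/-! ### The antipode reverses the coproduct. -/

section AntipodeComul

theorem map_map_sub_left {k : Type u} [Field k] {V V' W W' N : Type*} [AddCommGroup V] [Module k V]
    [AddCommGroup V'] [Module k V'] [AddCommGroup W] [Module k W] [AddCommGroup W'] [Module k W']
    [AddCommGroup N] [Module k N] (F : W ⊗[k] W' →ₗ[k] N) (f g : V →ₗ[k] W) (h : V' →ₗ[k] W')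
    (t : V ⊗[k] V') :
    F (TensorProduct.map (f - g) h t) =
      F (TensorProduct.map f h t) - F (TensorProduct.map g h t) := by
  induction t with
  | zero => simp
  | add s t hs ht => simp only [map_add, hs, ht]; abel
  | tmul v w =>
    simp only [TensorProduct.map_tmul, LinearMap.sub_apply, TensorProduct.sub_tmul, map_sub]

variable {k : Type u} [Field k] {C : Type*} [AddCommGroup C] [Module k C] [Coalgebra k C]

/-- If `S(a₁) a₂ = ε(a) 1`, then `(S(a₂) ⊗ S(a₁)) (a₃ ⊗ a₄) = ε(a) 1 ⊗ 1`. -/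
theorem flip_antipode_mul_comul {m : C ⊗[k] C →ₗ[k] C} {S : C →ₗ[k] C} {e : C}
    (hS : ∀ c : C, m (S.rTensor C (CoalgebraStruct.comul c)) = CoalgebraStruct.counit (R := k) c • e)
    (c : C) :
    TensorProduct.map m m (TensorProduct.tensorTensorTensorComm k C C C C
      (TensorProduct.map (TensorProduct.map S S ∘ₗ (TensorProduct.comm k C C).toLinearMap ∘ₗ
        CoalgebraStruct.comul) CoalgebraStruct.comul (CoalgebraStruct.comul (R := k) c))) =
      CoalgebraStruct.counit (R := k) c • e ⊗ₜ[k] e := by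
  let Δ : C →ₗ[k] C ⊗[k] C := CoalgebraStruct.comul
  -- `Θ` sends `p ⊗ ((q ⊗ r) ⊗ s)` to `S(q) r ⊗ S(p) s`. Once coassociativity groups the middle two
  -- factors as a coproduct, they collapse to a counit, and the outer two then collapse likewise.
  let Θ : C ⊗[k] ((C ⊗[k] C) ⊗[k] C) →ₗ[k] C ⊗[k] C :=
    TensorProduct.map (m ∘ₗ S.rTensor C) (m ∘ₗ S.rTensor C) ∘ₗ
      (TensorProduct.leftComm k C (C ⊗[k] C) C).toLinearMap
  have h₁ : ∀ t : C ⊗[k] C, TensorProduct.map m m (TensorProduct.tensorTensorTensorComm k C C C C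
      (TensorProduct.map (TensorProduct.map S S ∘ₗ (TensorProduct.comm k C C).toLinearMap ∘ₗ
        Δ) Δ t)) =
      Θ ((TensorProduct.assoc k C C C).symm.toLinearMap.lTensor C
        ((Δ.lTensor C).lTensor C (TensorProduct.assoc k C C C (Δ.rTensor C t)))) := by
    intro t
    induction t with
    | zero => simp
    | add s t hs ht => simp only [map_add, hs, ht]
    | tmul p q =>
      simp only [TensorProduct.map_tmul, LinearMap.comp_apply, LinearMap.rTensor_tmul]
      induction Δ p with
      | zero => simp
      | add s t hs ht => simp only [map_add, TensorProduct.add_tmul, hs, ht]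
      | tmul p₁ p₂ =>
        simp only [LinearEquiv.coe_coe, TensorProduct.comm_tmul, TensorProduct.map_tmul,
          TensorProduct.assoc_tmul, LinearMap.lTensor_tmul]
        induction Δ q with
        | zero => simp
        | add s t hs ht => simp only [map_add, TensorProduct.tmul_add, hs, ht]
        | tmul q₁ q₂ => simp [Θ]
  have h₂ : ∀ (p : C) (s : C ⊗[k] C), Θ (p ⊗ₜ[k] Δ.rTensor C s) =
      e ⊗ₜ[k] m (S p ⊗ₜ[k] TensorProduct.lid k C
        ((CoalgebraStruct.counit (R := k) (A := C)).rTensor C s)) := by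
    intro p s
    induction s with
    | zero => simp
    | add s t hs ht => simp only [map_add, TensorProduct.tmul_add, hs, ht]
    | tmul q₁ q₂ =>
      have : m (S.rTensor C (Δ q₁)) = _ := hS q₁
      simp [Θ, this, TensorProduct.smul_tmul]
  have h₃ : ∀ t : C ⊗[k] C, Θ ((Δ.rTensor C ∘ₗ Δ).lTensor C t) = e ⊗ₜ[k] m (S.rTensor C t) := by
    intro t
    induction t with
    | zero => simp
    | add s t hs ht => simp only [map_add, TensorProduct.tmul_add, hs, ht]
    | tmul p q =>
      rw [LinearMap.lTensor_tmul]
      refine (h₂ p (Δ q)).trans ?_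
      simp only [Δ, Coalgebra.rTensor_counit_comul, TensorProduct.lid_tmul, one_smul,
        LinearMap.rTensor_tmul]
  have h₄ : (TensorProduct.assoc k C C C).symm.toLinearMap ∘ₗ Δ.lTensor C ∘ₗ Δ =
      Δ.rTensor C ∘ₗ Δ := by
    ext c
    simp only [LinearMap.comp_apply, LinearEquiv.coe_coe, LinearEquiv.symm_apply_eq]
    exact (Coalgebra.coassoc_apply c).symm
  have h₅ := h₁ (Δ c)
  have h₆ : TensorProduct.assoc k C C C (Δ.rTensor C (Δ c)) = Δ.lTensor C (Δ c) :=
    Coalgebra.coassoc_apply c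
  rw [h₆, ← LinearMap.comp_apply (LinearMap.lTensor C (Δ.lTensor C)), ← LinearMap.lTensor_comp,
    ← LinearMap.comp_apply (LinearMap.lTensor C _), ← LinearMap.lTensor_comp, h₄, h₃] at h₅
  refine h₅.trans ?_
  rw [hS, TensorProduct.tmul_smul]

end AntipodeComul

section Boson

variable {k : Type u} {G : Type v} [Field k] [CommGroup G] [Fintype G] [DecidableEq G]
variable {H : Type w} [AddCommGroup H] [Module k H]
variable {Φ : NormalizedThreeCocycle k G} {D : YDModule Φ H}

namespace BraidedHopfAlgebra

variable (B : BraidedHopfAlgebra D) {gr : ℕ → Submodule k H}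

/-- Right multiplication by `1 ⊗ g` is injective. -/
theorem exists_leftInverse_bosonMul_unit (g : G) :
    ∃ L : H ⊗[k] MonoidAlgebra k G →ₗ[k] H ⊗[k] MonoidAlgebra k G,
      L ∘ₗ B.bosonMul ∘ₗ (TensorProduct.mk k _ _).flip (elt g (B.unit 1)) = LinearMap.id := by
  -- This inverts `(X ⊗ h)(1 ⊗ g) = Φ(x, h, g)⁻¹ X ⊗ hg`.
  refine ⟨ofFamily fun h => ∑ x, Φ x (h * g⁻¹) g • (elt (h * g⁻¹) ∘ₗ D.proj x),
    boson_linearMap_ext D fun x h X hX => ?_⟩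
  simp only [LinearMap.comp_apply, LinearMap.flip_apply, TensorProduct.mk_apply,
    B.bosonMul_elt hX B.unit_mem_component, LinearMap.map_smul_of_tower, ofFamily_elt,
    B.act_unit, B.mul_unit_apply, LinearMap.sum_apply, LinearMap.smul_apply, LinearMap.id_apply,
    Φ.mulCoeff_of_one]
  rw [Finset.sum_eq_single x]
  · simp [D.proj_eq_of_mem hX]
  all_goals simp +contextual [D.proj_of_mem hX]

variable {B}

/-- Both sides are left convolution inverses of the coproduct in the tensor square. Their equality
is obtained by induction on length instead of by associativity: the leading term of `Δ(X ⊗ g)`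
isolates the difference evaluated at `X ⊗ g`. -/
theorem IsGraded.bosonComul_antipode [Coalgebra k (H ⊗[k] MonoidAlgebra k G)]
    (hΔ : CoalgebraStruct.comul = B.bosonComul) (hε : CoalgebraStruct.counit = B.bosonCounit)
    (hgr : B.IsGraded gr) (hconn : B.IsConnected gr) :
    B.bosonComul ∘ₗ B.bosonAntipode =
      TensorProduct.map B.bosonAntipode B.bosonAntipode ∘ₗ
        (TensorProduct.comm k _ _).toLinearMap ∘ₗ B.bosonComul := by
  obtain ⟨P, hP⟩ := exists_isGradedProj hgr.isInternal
  have hS : ∀ a, B.bosonMul (B.bosonAntipode.rTensor _ (B.bosonComul a)) =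
      B.bosonCounit a • elt 1 (B.unit 1) := fun a => by
    have := LinearMap.congr_fun (B.bosonAntipode_mul hΔ) a
    rwa [hΔ] at this
  set T := B.bosonComul ∘ₗ B.bosonAntipode -
      TensorProduct.map B.bosonAntipode B.bosonAntipode ∘ₗ
        (TensorProduct.comm k _ _).toLinearMap ∘ₗ B.bosonComul with hT
  let mul₂ := TensorProduct.map B.bosonMul B.bosonMul ∘ₗ
    (TensorProduct.tensorTensorTensorComm k _ _ _ _).toLinearMap
  -- `T(a₁) Δ(a₂) = 0`: the two contributions are both `ε(a) 1 ⊗ 1`, one by multiplicativity of `Δ`,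
  -- the other by `flip_antipode_mul_comul`.
  have hconv : ∀ a, mul₂ (TensorProduct.map T B.bosonComul (B.bosonComul a)) = 0 := by
    intro a
    rw [hT, map_map_sub_left, sub_eq_zero]
    have h₁ := flip_antipode_mul_comul (m := B.bosonMul) (S := B.bosonAntipode)
      (e := elt 1 (B.unit 1)) (by rw [hΔ, hε]; exact hS) a
    rw [hΔ, hε] at h₁
    refine Eq.trans ?_ h₁.symm
    have h₂ := LinearMap.congr_fun B.bosonComul_mul (B.bosonAntipode.rTensor _ (B.bosonComul a))
    simp only [LinearMap.comp_apply] at h₂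
    rw [hS, map_smul, bosonComul_unit, ← LinearMap.comp_apply (TensorProduct.map B.bosonComul _),
      LinearMap.map_comp_rTensor] at h₂
    exact h₂.symm
  have key : ∀ n, ∀ a ∈ lengthGrading G gr n, T a = 0 := by
    intro n
    induction n using Nat.strong_induction_on with
    | _ n ih =>
      intro a ha
      refine lengthGrading_induction ha (fun a b ha hb => by rw [map_add, ha, hb, add_zero])
        fun g X hX => ?_
      -- `T` vanishes on shorter elements, so only the term `T(X ⊗ g) Δ(1 ⊗ g)` survives; the left
      -- inverse `L` then cancels the two factors `1 ⊗ g`.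
      have h₁ := hgr.map_bosonComul_elt hconn hX g (mul₂ ∘ₗ TensorProduct.map T B.bosonComul)
        fun i hi a ha b => by simp [ih i hi a ha]
      rw [LinearMap.comp_apply, hconv, LinearMap.comp_apply, TensorProduct.map_tmul,
        bosonComul_unit] at h₁
      obtain ⟨L, hL⟩ := B.exists_leftInverse_bosonMul_unit g
      set r := B.bosonMul ∘ₗ (TensorProduct.mk k _ _).flip (elt g (B.unit 1)) with hr
      have h₂ : ∀ t, mul₂ (t ⊗ₜ[k] (elt g (B.unit 1) ⊗ₜ[k] elt g (B.unit 1))) =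
          TensorProduct.map r r t := by
        intro t
        induction t with
        | zero => simp
        | add s t hs ht => simp only [TensorProduct.add_tmul, map_add, hs, ht]
        | tmul a b => simp [mul₂, hr]
      rw [h₂] at h₁
      have h₃ := congrArg (TensorProduct.map L L) h₁
      rw [← LinearMap.comp_apply, ← TensorProduct.map_comp, hL, TensorProduct.map_id,
        LinearMap.id_apply, map_zero] at h₃
      exact h₃.symm
  refine sub_eq_zero.mp (?_ : T = 0)
  refine LinearMap.ext fun a => (hP.lengthGrading (G := G)).induction a key fun a b ha hb => ?_
  rw [map_add, ha, hb, map_add]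

end BraidedHopfAlgebra
end Boson

/-! ### Group-like elements, the coradical, and primitive elements. -/

section GroupLike

variable {k : Type u} [Field k] {C : Type w} [AddCommGroup C] [Module k C] (cC : Coalgebra k C)

theorem isSubcoalgebra_span_groupLike {c : C} (hc : cC.comul c = c ⊗ₜ[k] c) :
    IsSubcoalgebra cC (Submodule.span k {c}) := by
  intro a ha
  obtain ⟨r, rfl⟩ := Submodule.mem_span_singleton.mp ha
  have hm := Submodule.mem_span_singleton_self (R := k) c
  exact ⟨r • (⟨c, hm⟩ ⊗ₜ[k] ⟨c, hm⟩), by simp [hc]⟩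

theorem span_groupLike_le_coradical {c : C} (hc : cC.comul c = c ⊗ₜ[k] c) (h0 : c ≠ 0) :
    Submodule.span k {c} ≤ coradical cC := by
  refine le_sSup ⟨isSubcoalgebra_span_groupLike cC hc, by simpa using h0, fun F _ hF => ?_⟩
  refine or_iff_not_imp_left.mpr fun hF0 => le_antisymm hF ?_
  obtain ⟨a, ha, ha0⟩ := (Submodule.ne_bot_iff F).mp hF0
  obtain ⟨r, rfl⟩ := Submodule.mem_span_singleton.mp (hF ha)
  have hr : r ≠ 0 := fun h => ha0 (by simp [h])
  rw [Submodule.span_singleton_le_iff_mem]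
  simpa [smul_smul, hr] using F.smul_mem r⁻¹ ha

/-- Used to extract a group-like element from an arbitrary nonzero subcoalgebra by a suitable
functional. -/
theorem IsSubcoalgebra.contract_mem {E : Submodule k C} (hE : IsSubcoalgebra cC E) {c : C}
    (hc : c ∈ E) (f : C →ₗ[k] k) : TensorProduct.lid k C (f.rTensor C (cC.comul c)) ∈ E := by
  obtain ⟨s, hs⟩ := hE c hc
  rw [← hs]
  clear hs
  induction s with
  | zero => simp
  | add s t hs ht => simp only [map_add]; exact add_mem hs ht
  | tmul a b => simpa using E.smul_mem _ b.2

end GroupLike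

section Coradical

variable {k : Type u} {G : Type v} [Field k] [CommGroup G] [Fintype G] [DecidableEq G]
variable {H : Type w} [AddCommGroup H] [Module k H]
variable {Φ : NormalizedThreeCocycle k G} {D : YDModule Φ H}

namespace BraidedHopfAlgebra

variable {B : BraidedHopfAlgebra D} {gr : ℕ → Submodule k H}

theorem elt_unit_ne_zero (B : BraidedHopfAlgebra D) (g : G) :
    elt (k := k) g (B.unit 1) ≠ 0 := by
  intro h
  have := congrArg B.bosonCounit h
  rw [bosonCounit_elt, B.counit_unit, map_zero] at this
  exact one_ne_zero this

/-- The coradical of `H # kG` is `kG`. -/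
theorem IsGraded.coradical_boson (hgr : B.IsGraded gr) (hconn : B.IsConnected gr) :
    coradical B.bosonCoalgebra = lengthGrading G gr 0 := by
  refine le_antisymm (sSup_le fun E hE => ?_) fun a ha => ?_
  · obtain ⟨P, hP⟩ := exists_isGradedProj hgr.isInternal
    have hQ := hP.lengthGrading (G := G)
    set Q := fun n => (P n).rTensor (MonoidAlgebra k G)
    obtain ⟨hsub, hbot, hmin⟩ := hE
    obtain ⟨c, hc, hc0⟩ := (Submodule.ne_bot_iff E).mp hbot
    -- `n` is the top length occurring in `c`.
    obtain ⟨n, hn, hn'⟩ : ∃ n, Q n c ≠ 0 ∧ ∀ m, n < m → Q m c = 0 := by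
      obtain ⟨N, hN, hN'⟩ := hQ.exists_bound c
      have hex : ∃ m, m ≤ N ∧ Q m c ≠ 0 := by
        by_contra! hcon
        refine hc0 (hQ.eq_zero fun m => ?_)
        by_cases hm : m ≤ N
        · exact hcon m hm
        · exact hN m (by omega)
      obtain ⟨m₀, hm₀, hm₀'⟩ := hex
      classical
      refine ⟨Nat.findGreatest (fun m => Q m c ≠ 0) N, ?_, fun m hm => ?_⟩
      · exact Nat.findGreatest_spec (P := fun m => Q m c ≠ 0) hm₀ hm₀'
      · by_cases hmN : m ≤ N
        · exact not_not.mp (Nat.findGreatest_is_greatest hm hmN)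
        · exact hN m (by omega)
    obtain ⟨g, hg⟩ : ∃ g, eltCoeff g (Q n c) ≠ 0 := by
      by_contra! hcon
      refine hn ?_
      rw [← sum_elt_eltCoeff (Q n c)]
      simp [hcon]
    obtain ⟨φ, hφ⟩ : ∃ φ : Module.Dual k H, φ (eltCoeff g (Q n c)) ≠ 0 := by
      by_contra! hcon
      exact hg ((Module.forall_dual_apply_eq_zero_iff k _).mp hcon)
    -- `f` sees only length `n`, so contracting the first leg of `Δ(c)` with it retains just the
    -- leading term of the top component of `c`: a nonzero multiple of `1 ⊗ g`, which thus lies in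
    -- `E`. By simplicity `E` is the line it spans.
    let f : H ⊗[k] MonoidAlgebra k G →ₗ[k] k := φ ∘ₗ eltCoeff g ∘ₗ Q n
    let F := (TensorProduct.lid k (H ⊗[k] MonoidAlgebra k G)).toLinearMap ∘ₗ f.rTensor _
    have hF : ∀ i, i ≠ n → ∀ a ∈ lengthGrading G gr i, ∀ b, F (a ⊗ₜ[k] b) = 0 := by
      intro i hi a ha b
      simp [F, f, hQ.eq_zero_of_mem n i hi.symm a ha]
    have hF₁ : ∀ m < n, ∀ a ∈ lengthGrading G gr m, F (B.bosonComul a) = 0 := by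
      intro m hm a ha
      refine lengthGrading_induction ha (fun a b ha hb => by simp only [map_add, ha, hb, add_zero])
        fun h X hX => ?_
      rw [hgr.map_bosonComul_elt hconn hX h F fun i hi => hF i (by omega),
        hF m (by omega) _ (elt_mem_lengthGrading hX h)]
    have hF₂ : ∀ a ∈ lengthGrading G gr n, F (B.bosonComul a) =
        φ (eltCoeff g a) • elt g (B.unit 1) := by
      intro a ha
      refine lengthGrading_induction ha (fun a b ha hb => by simp only [map_add, ha, hb, add_smul])
        fun h X hX => ?_
      rw [hgr.map_bosonComul_elt hconn hX h F fun i hi => hF i (by omega)]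
      simp only [F, f, LinearMap.comp_apply, LinearMap.rTensor_tmul, LinearEquiv.coe_coe,
        TensorProduct.lid_tmul, hQ.eq_of_mem n _ (elt_mem_lengthGrading hX h), eltCoeff_elt]
      split_ifs with hgh
      · rw [hgh]
      · simp
    have hFc : F (B.bosonComul c) = φ (eltCoeff g (Q n c)) • elt g (B.unit 1) := by
      obtain ⟨N, -, hN'⟩ := hQ.exists_bound c
      rw [← hF₂ _ (hQ.mem n c)]
      conv_lhs => rw [← hN' (max N (n + 1)) (by omega)]
      rw [map_sum, map_sum, Finset.sum_eq_single n]
      · intro m _ hm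
        rcases lt_or_gt_of_ne hm with h | h
        · exact hF₁ m h _ (hQ.mem m c)
        · rw [hn' m h, map_zero, map_zero]
      · simp
    have hmem : elt g (B.unit 1) ∈ E := by
      have h := hsub.contract_mem B.bosonCoalgebra hc f
      have h' : F (B.bosonComul c) ∈ E := h
      rw [hFc] at h'
      simpa [smul_smul, hφ] using E.smul_mem (φ (eltCoeff g (Q n c)))⁻¹ h'
    have hspan := hmin (Submodule.span k {elt g (B.unit 1)})
      (isSubcoalgebra_span_groupLike B.bosonCoalgebra (B.bosonComul_unit g))
      ((Submodule.span_singleton_le_iff_mem _ _).mpr hmem)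
    rw [← hspan.resolve_left (by simpa using B.elt_unit_ne_zero g),
      Submodule.span_singleton_le_iff_mem]
    exact elt_mem_lengthGrading hgr.unit_mem g
  · refine lengthGrading_induction ha (fun a b ha hb => add_mem ha hb) fun g X hX => ?_
    rw [hconn, Submodule.mem_span_singleton] at hX
    obtain ⟨r, rfl⟩ := hX
    rw [map_smul]
    exact Submodule.smul_mem _ _ (span_groupLike_le_coradical B.bosonCoalgebra
      (B.bosonComul_unit g) (B.elt_unit_ne_zero g) (Submodule.mem_span_singleton_self _))

/-- A left inverse of the map `X₁ ⊗ X₂ ↦ Φ(x₁, x₂, g)⁻¹ (X₁ ⊗ x₂ g) ⊗ (X₂ ⊗ g)`. -/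
noncomputable def bosonUnsplit (D : YDModule Φ H) (g : G) :
    (H ⊗[k] MonoidAlgebra k G) ⊗[k] (H ⊗[k] MonoidAlgebra k G) →ₗ[k] H ⊗[k] H :=
  ∑ x₁ : G, ∑ x₂ : G, Φ x₁ x₂ g •
    TensorProduct.map (D.proj x₁ ∘ₗ eltCoeff (x₂ * g)) (D.proj x₂ ∘ₗ eltCoeff g)

theorem bosonUnsplit_split (g h : G) (t : H ⊗[k] H) :
    bosonUnsplit D g (bosonSplit D h t) = if h = g then t else 0 := by
  refine YDModule.tensor_induction D D t (by simp) (fun s t hs ht => ?_) fun a b X hX Y hY => ?_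
  · rw [map_add, map_add, hs, ht]
    split_ifs <;> simp
  rw [bosonSplit_tmul D h hX hY, LinearMap.map_smul_of_tower]
  simp only [bosonUnsplit, LinearMap.sum_apply, LinearMap.smul_apply, TensorProduct.map_tmul,
    LinearMap.comp_apply, eltCoeff_elt]
  split_ifs with hgh
  · subst hgh
    rw [Finset.sum_eq_single a, Finset.sum_eq_single b]
    · simp [D.proj_eq_of_mem hX, D.proj_eq_of_mem hY]
    all_goals simp +contextual [D.proj_of_mem hX, D.proj_of_mem hY, apply_ite (D.proj _)]
  · simp

theorem IsGraded.map_bosonUnsplit {P : ℕ → H →ₗ[k] H} (hP : IsGradedProj gr P)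
    (hgr : B.IsGraded gr) (g : G) (i j : ℕ)
    (t : (H ⊗[k] MonoidAlgebra k G) ⊗[k] (H ⊗[k] MonoidAlgebra k G)) :
    bosonUnsplit D g (TensorProduct.map ((P i).rTensor _) ((P j).rTensor _) t) =
      TensorProduct.map (P i) (P j) (bosonUnsplit D g t) := by
  have hcomm : ∀ (n : ℕ) (x : G) (X : H), D.proj x (P n X) = P n (D.proj x X) := by
    intro n x X
    refine hP.induction X (fun m X hX => ?_) fun X Y hX hY => by simp only [map_add, hX, hY]
    by_cases hnm : n = m
    · subst hnm
      rw [hP.eq_of_mem _ _ hX, hP.eq_of_mem _ _ (hgr.proj_mem n x X hX)]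
    · rw [hP.eq_zero_of_mem _ _ hnm _ hX, hP.eq_zero_of_mem _ _ hnm _ (hgr.proj_mem m x X hX),
        map_zero]
  induction t with
  | zero => simp
  | add s t hs ht => simp only [map_add, hs, ht]
  | tmul a b =>
    simp only [bosonUnsplit, LinearMap.sum_apply, LinearMap.smul_apply, TensorProduct.map_tmul,
      LinearMap.comp_apply, eltCoeff_rTensor, hcomm, map_sum, LinearMap.map_smul_of_tower]

/-- In a connected graded braided Hopf algebra, an element of positive length whose coproduct has
no inner components is primitive. -/
theorem IsGraded.isPrimitive_of_map_proj {P : ℕ → H →ₗ[k] H} (hP : IsGradedProj gr P)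
    (hgr : B.IsGraded gr) (hconn : B.IsConnected gr) {m : ℕ} (hm : 1 ≤ m) {X : H} (hX : X ∈ gr m)
    (h : ∀ i j, 1 ≤ i → 1 ≤ j → TensorProduct.map (P i) (P j) (B.comul X) = 0) :
    B.IsPrimitive X := by
  -- By connectedness the projection to length `0` is `ε` followed by the unit, so the outer
  -- components of `Δ(X)` are dictated by the counit axioms.
  have hP₀ : P 0 = B.unit ∘ₗ B.counit := by
    ext Y
    refine hP.induction Y (fun n Y hY => ?_) fun X Y hX hY => by rw [map_add, hX, hY, map_add]
    by_cases hn : n = 0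
    · subst hn
      rw [hP.eq_of_mem 0 Y hY]
      rw [hconn, Submodule.mem_span_singleton] at hY
      obtain ⟨r, rfl⟩ := hY
      simp [B.counit_unit]
    · rw [hP.eq_zero_of_mem 0 n (Ne.symm hn) Y hY, LinearMap.comp_apply,
        hgr.counit_eq_zero n hn Y hY, map_zero]
  have hone : ∀ n, P n (B.unit 1) = if n = 0 then B.unit 1 else 0 := by
    intro n
    split_ifs with hn
    · rw [hn]; exact hP.eq_of_mem 0 _ hgr.unit_mem
    · exact hP.eq_zero_of_mem n 0 hn _ hgr.unit_mem
  have hPX : ∀ n, P n X = if n = m then X else 0 := by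
    intro n
    split_ifs with hn
    · rw [hn]; exact hP.eq_of_mem m _ hX
    · exact hP.eq_zero_of_mem n m hn _ hX
  have hr : ∀ i, TensorProduct.map (P i) (P 0) (B.comul X) = P i X ⊗ₜ[k] B.unit 1 := by
    intro i
    have := LinearMap.congr_fun B.comul_counit X
    simp only [LinearMap.comp_apply] at this
    rw [hP₀, ← LinearMap.map_comp_lTensor, LinearMap.comp_apply, this]
    simp
  have hl : ∀ j, TensorProduct.map (P 0) (P j) (B.comul X) = B.unit 1 ⊗ₜ[k] P j X := by
    intro j
    have := LinearMap.congr_fun B.counit_comul X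
    simp only [LinearMap.comp_apply] at this
    rw [hP₀, ← LinearMap.map_comp_rTensor, LinearMap.comp_apply, this]
    simp
  refine sub_eq_zero.mp (hP.tensor_eq_zero fun i j => ?_)
  rw [map_sub, map_add, TensorProduct.map_tmul, TensorProduct.map_tmul, hone, hone]
  by_cases hi : i = 0
  · subst hi
    by_cases hj : j = 0
    · subst hj
      simp [hl, hPX 0, show ¬ 0 = m by omega]
    · simp [hl, hj]
  · by_cases hj : j = 0
    · subst hj
      simp [hr, hi]
    · rw [h i j (by omega) (by omega)]
      simp [hi, hj]

/-- A primitive `X` gives an element `X ⊗ 1` of the first filtration term, hence of length at most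
`1`. Conversely, a length `m ≥ 2` element without inner coproduct components has primitive
coefficients, which lie in `H(1) ∩ H(m) = 0`. -/
theorem IsGraded.isCoradicalGrading_iff (hgr : B.IsGraded gr) (hconn : B.IsConnected gr) :
    IsCoradicalGrading B.bosonCoalgebra (lengthGrading G gr) ↔
      ∀ X : H, B.IsPrimitive X → X ∈ gr 1 := by
  obtain ⟨P, hP⟩ := exists_isGradedProj hgr.isInternal
  have hQ := hP.lengthGrading (G := G)
  have hcor := hgr.coradical_boson hconn
  constructor
  · intro hgrading X hX
    have hε : B.counit X = 0 := by
      have := LinearMap.congr_fun B.comul_counit X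
      simp only [LinearMap.comp_apply] at this
      rw [hX, map_add, LinearMap.lTensor_tmul, LinearMap.lTensor_tmul, B.counit_unit] at this
      have h₁ := congrArg (fun t => B.counit (TensorProduct.rid k H t)) this
      simpa [B.counit_unit] using h₁
    -- The two terms of `Δ(X ⊗ 1)` have a group-like second, respectively first, leg; the coradical
    -- contains all `1 ⊗ g`.
    have hmem : elt (1 : G) X ∈ coradicalFiltration B.bosonCoalgebra 1 := by
      have hcomul : B.bosonComul (elt 1 X) =
          elt 1 X ⊗ₜ[k] elt 1 (B.unit 1) + bosonSplit D 1 (B.unit 1 ⊗ₜ[k] X) := by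
        rw [bosonComul_elt, hX, map_add, bosonSplit_tmul_unit]
      have hu : ∀ g : G, elt g (B.unit 1) ∈ coradical B.bosonCoalgebra := fun g =>
        hcor ▸ elt_mem_lengthGrading hgr.unit_mem g
      rw [coradicalFiltration, Submodule.mem_comap]
      change B.bosonComul (elt 1 X) ∈ _
      rw [hcomul]
      refine Submodule.add_mem_sup ⟨elt 1 X ⊗ₜ[k] ⟨_, hu 1⟩, by simp⟩ ?_
      refine D.component_induction X (fun X Y hX hY => ?_) fun x X hX => ?_
      · rw [TensorProduct.tmul_add, map_add]
        exact add_mem hX hY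
      · rw [bosonSplit_tmul D 1 B.unit_mem_component hX, Units.smul_def]
        exact Submodule.smul_mem _ _ ⟨⟨_, hu (x * 1)⟩ ⊗ₜ[k] elt 1 X, by simp⟩
    rw [hgrading 1, hQ.mem_iSup_range_iff] at hmem
    refine hP.mem_of_proj fun m hm => ?_
    -- The filtration excludes only lengths above `1`; the component of length `0` is a scalar and
    -- vanishes because `ε(X) = 0`.
    rcases Nat.eq_zero_or_pos m with rfl | hm'
    · have h₀ : P 0 X ∈ gr 0 := hP.mem 0 X
      rw [hconn, Submodule.mem_span_singleton] at h₀
      obtain ⟨r, hr⟩ := h₀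
      have hc : B.counit (P 0 X) = B.counit X := by
        refine hP.induction X (fun n Y hY => ?_) fun X Y hX hY => by
          simp only [map_add, hX, hY]
        by_cases hn : n = 0
        · rw [hn] at hY
          rw [hP.eq_of_mem 0 Y hY]
        · rw [hP.eq_zero_of_mem 0 n (Ne.symm hn) Y hY, map_zero, hgr.counit_eq_zero n hn Y hY]
      rw [← hr, map_smul, B.counit_unit, hε, smul_eq_mul, mul_one] at hc
      rw [← hr, hc, zero_smul]
    · have h₁ := congrArg (eltCoeff 1) (hmem m (by omega))
      rw [eltCoeff_rTensor, eltCoeff_elt, if_pos rfl, map_zero] at h₁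
      exact h₁
  · intro hprim
    refine isCoradicalGrading_of_primitive B.bosonCoalgebra hQ hgr.bosonComul_mem hcor
      fun m hm c hc hzero => ?_
    rw [← sum_elt_eltCoeff c]
    refine Finset.sum_eq_zero fun g _ => ?_
    have hX := eltCoeff_mem hc g
    -- The coproduct of the coefficient at `g` is recovered from that of `c` by a map compatible
    -- with bidegrees, so it has no inner components either.
    have hcomul : bosonUnsplit D g (B.bosonComul c) = B.comul (eltCoeff g c) := by
      conv_lhs => rw [← sum_elt_eltCoeff c]
      simp only [map_sum, bosonComul_elt, bosonUnsplit_split]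
      simp
    have hp := hprim _ (hgr.isPrimitive_of_map_proj hP hconn (by omega) hX fun i j hi hj => by
      rw [← hcomul, ← hgr.map_bosonUnsplit hP]
      exact (congrArg _ (hzero i j hi hj)).trans (map_zero _))
    rw [← hP.eq_of_mem m _ hX, hP.eq_zero_of_mem m 1 (by omega) _ hp, map_zero]

end BraidedHopfAlgebra
end Coradical

/-! ### Assembling the Majid algebra. -/

section MajidBosonization

variable {k : Type u} {G : Type v} [Field k] [CommGroup G] [Fintype G] [DecidableEq G]
variable {H : Type w} [AddCommGroup H] [Module k H]
variable {Φ : NormalizedThreeCocycle k G} {D : YDModule Φ H}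

namespace BraidedHopfAlgebra

variable {B : BraidedHopfAlgebra D} {gr : ℕ → Submodule k H}

/-- The Majid algebra `H # kG` of a connected graded braided Hopf algebra `H`. -/
noncomputable def IsGraded.majidAlgebra (hgr : B.IsGraded gr) (hconn : B.IsConnected gr) :
    MajidAlgebra k (H ⊗[k] MonoidAlgebra k G) where
  toCoalgebra := B.bosonCoalgebra
  mul := B.bosonMul
  one := elt 1 (B.unit 1)
  associator := B.extend₃ fun g h e => Φ g h e
  associatorInv := B.extend₃ fun g h e => ((Φ g h e)⁻¹ : kˣ)
  antipode := B.bosonAntipode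
  -- The prescribed values of `α`, namely `1` on `1 ⊗ g` and `0` in positive length, are those of
  -- `ε`; convolution with `α` is therefore the identity.
  alpha := B.bosonCounit
  beta := B.bosonBeta
  comul_mul := TensorProduct.ext' fun a b => LinearMap.congr_fun B.bosonComul_mul (a ⊗ₜ[k] b)
  counit_mul := B.bosonCounit_mul
  comul_one := B.bosonComul_unit 1
  counit_one := (B.bosonCounit_elt 1 _).trans B.counit_unit
  one_mul := B.bosonMul_unit_left
  mul_one := B.bosonMul_unit_right
  associator_mul_inv :=
    letI := B.bosonCoalgebra
    B.extend₃_mul_inv rfl rfl _ _ fun g h e => Units.mul_inv _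
  associatorInv_mul :=
    letI := B.bosonCoalgebra
    B.extend₃_mul_inv rfl rfl _ _ fun g h e => Units.inv_mul _
  quasi_assoc :=
    letI := B.bosonCoalgebra
    B.extend₃_quasi_assoc rfl
  associator_cocycle :=
    letI := B.bosonCoalgebra
    B.extend₃_cocycle rfl rfl rfl
  associator_one :=
    letI := B.bosonCoalgebra
    B.extend₃_one rfl
  comul_antipode :=
    letI := B.bosonCoalgebra
    hgr.bosonComul_antipode rfl rfl hconn
  counit_antipode := B.bosonCounit_antipode
  antipode_alpha := by
    let _ := B.bosonCoalgebra
    have h : convLeft B.bosonCounit LinearMap.id =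
        (LinearMap.id : H ⊗[k] MonoidAlgebra k G →ₗ[k] _) := convLeft_counit _
    rw [h]
    exact B.bosonAntipode_mul rfl
  beta_antipode :=
    letI := B.bosonCoalgebra
    B.mul_bosonAntipode rfl
  associator_antipode := by
    let _ := B.bosonCoalgebra
    have h : convLeft B.bosonCounit LinearMap.id =
        (LinearMap.id : H ⊗[k] MonoidAlgebra k G →ₗ[k] _) := convLeft_counit _
    rw [h]
    exact B.extend₃_antipode rfl
  associatorInv_antipode := by
    let _ := B.bosonCoalgebra
    have h : ∀ f : H ⊗[k] MonoidAlgebra k G →ₗ[k] (H ⊗[k] MonoidAlgebra k G) ⊗[k]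
        (H ⊗[k] MonoidAlgebra k G), convLeft B.bosonCounit f = f := convLeft_counit
    rw [h]
    exact B.extend₃_antipode' rfl

theorem IsGraded.majidAlgebra_isGraded (hgr : B.IsGraded gr) (hconn : B.IsConnected gr) :
    (hgr.majidAlgebra hconn).IsGraded (lengthGrading G gr) where
  isInternal := by
    obtain ⟨P, hP⟩ := exists_isGradedProj hgr.isInternal
    exact hP.lengthGrading.isInternal
  comul_mem := hgr.bosonComul_mem
  counit_eq_zero := hgr.bosonCounit_eq_zero
  mul_mem := hgr.bosonMul_mem
  one_mem := elt_mem_lengthGrading hgr.unit_mem 1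
  associator_eq_zero := hgr.extend₃_eq_zero _
  antipode_mem := hgr.bosonAntipode_mem
  alpha_eq_zero := hgr.bosonCounit_eq_zero
  beta_eq_zero := hgr.bosonBeta_eq_zero

end BraidedHopfAlgebra
end MajidBosonization

end QuasiBosonization

theorem proposition3p3 {k : Type*} [Field k] [IsAlgClosed k] [CharZero k]
    {G : Type*} [CommGroup G] [Fintype G] [DecidableEq G]
    (Φ : QuasiBosonization.NormalizedThreeCocycle k G)
    {H : Type*} [AddCommGroup H] [Module k H]
    (D : QuasiBosonization.YDModule Φ H)
    (B : QuasiBosonization.BraidedHopfAlgebra D)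
    (gr : ℕ → Submodule k H)
    (hgraded : B.IsGraded gr)
    (hconnected : B.IsConnected gr)
    (hgenerated : B.IsGeneratedInDegreeOne gr) :
    ∃ M : QuasiBosonization.MajidAlgebra k (H ⊗[k] MonoidAlgebra k G),
      -- the product
      (∀ (x y g h : G), ∀ X ∈ D.component x, ∀ Y ∈ D.component y,
        M.mul ((X ⊗ₜ[k] MonoidAlgebra.single g 1) ⊗ₜ[k] (Y ⊗ₜ[k] MonoidAlgebra.single h 1)) =
          (Φ (x * g) y h * Φ x y g / (Φ x g y * Φ (x * y) g h)) •
            (B.mul (X ⊗ₜ[k] D.act g Y) ⊗ₜ[k] MonoidAlgebra.single (g * h) 1)) ∧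
      M.one = B.unit 1 ⊗ₜ[k] MonoidAlgebra.single 1 1 ∧
      -- the coproduct
      (∀ (X : H) (g : G),
        M.comul (X ⊗ₜ[k] MonoidAlgebra.single g 1) =
          ∑ x₁ : G, ∑ x₂ : G, (Φ x₁ x₂ g)⁻¹ •
            TensorProduct.map
              (QuasiBosonization.elt (x₂ * g) ∘ₗ D.proj x₁)
              (QuasiBosonization.elt g ∘ₗ D.proj x₂) (B.comul X)) ∧
      (∀ (X : H) (g : G), M.counit (X ⊗ₜ[k] MonoidAlgebra.single g 1) = B.counit X) ∧
      -- the associator extends `Φ`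
      (∀ (X Y Z : H) (g h e : G),
        M.associator ((X ⊗ₜ[k] MonoidAlgebra.single g 1) ⊗ₜ[k]
            ((Y ⊗ₜ[k] MonoidAlgebra.single h 1) ⊗ₜ[k] (Z ⊗ₜ[k] MonoidAlgebra.single e 1))) =
          B.counit X * B.counit Y * B.counit Z * (Φ g h e : k)) ∧
      -- the quasi-antipode
      (∀ (x g : G), ∀ X ∈ D.component x,
        M.antipode (X ⊗ₜ[k] MonoidAlgebra.single g 1) =
          (Φ g⁻¹ g g⁻¹ / (Φ (x⁻¹ * g⁻¹) (x * g) g⁻¹ * Φ x g g⁻¹)) •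
            M.mul ((B.unit 1 ⊗ₜ[k] MonoidAlgebra.single (x⁻¹ * g⁻¹) 1) ⊗ₜ[k]
              (B.antipode X ⊗ₜ[k] MonoidAlgebra.single 1 1))) ∧
      (∀ g : G, M.alpha (B.unit 1 ⊗ₜ[k] MonoidAlgebra.single g 1) = 1) ∧
      (∀ n : ℕ, 1 ≤ n → ∀ X ∈ gr n, ∀ g : G,
        M.alpha (X ⊗ₜ[k] MonoidAlgebra.single g 1) = 0) ∧
      (∀ g : G, M.beta (B.unit 1 ⊗ₜ[k] MonoidAlgebra.single g 1) = ((Φ g g⁻¹ g)⁻¹ : kˣ)) ∧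
      (∀ n : ℕ, 1 ≤ n → ∀ X ∈ gr n, ∀ g : G,
        M.beta (X ⊗ₜ[k] MonoidAlgebra.single g 1) = 0) ∧
      -- `M` is graded by length
      M.IsGraded (QuasiBosonization.lengthGrading G gr) ∧
      -- this grading is the coradical one exactly when all primitive elements have length one
      (QuasiBosonization.IsCoradicalGrading M.toCoalgebra (QuasiBosonization.lengthGrading G gr) ↔
        ∀ X : H, B.IsPrimitive X → X ∈ gr 1) := by
  refine ⟨hgraded.majidAlgebra hconnected, ?_, rfl, ?_, ?_, ?_, ?_, ?_, ?_, ?_, ?_,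
    hgraded.majidAlgebra_isGraded hconnected, hgraded.isCoradicalGrading_iff hconnected⟩
  · exact fun x y g h X hX Y hY => B.bosonMul_elt hX hY g h
  · intro X g
    refine (B.bosonComul_elt g X).trans ?_
    simp only [QuasiBosonization.bosonSplit, LinearMap.sum_apply, LinearMap.smul_apply]
  · exact fun X g => B.bosonCounit_elt g X
  · intro X Y Z g h e
    refine (B.extend₃_elt _ g h e X Y Z).trans ?_
    ring
  · exact fun x g X hX => B.bosonAntipode_elt_eq_mul hX g
  · exact fun g => (B.bosonCounit_elt g _).trans B.counit_unit
  · exact fun n hn X hX g => (B.bosonCounit_elt g X).trans (hgraded.counit_eq_zero n (by omega) X hX)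
  · exact fun g => (B.bosonBeta_elt g _).trans (by rw [B.counit_unit, mul_one])
  · exact fun n hn X hX g => (B.bosonBeta_elt g X).trans
      (by rw [hgraded.counit_eq_zero n (by omega) X hX, mul_zero])
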